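/- **Setting.** Let $n\ge 2$, let $M$ be a compact smooth $(n-1)$-dimensional manifold without boundary, and for $T,r>0$ put $M^r=M\times(-r,r)$ and $M_T^r=(-T,T)\times M\times(-r,r)$, with points $y=(y^0,y',y^n)=(y^\tau,y^n)$. Standard local coordinates $(y^0,\dots,y^n)$ on $M_T^r$ are those in which $y'=(y^1,\dots,y^{n-1})$ are local coordinates on $M$. Greek indices run over $0,\dots,n$ and are summed when repeated. Let $d(vol)_0$ be a smooth volume form (positive density) on $M$, and write $d(vol)=d(vol)_0\,dy^n$ on $M^r$. Let $F:\mathbb R\to\mathbb R$ be smooth with $F(x)>0$ for $|x|\ne1$, $F(x)\ge c(1-|x|)^2$ for all $x$ and $F(x)\le C_F(1-|x|)^2$ for $|x|\le2$, for some constants $c,C_F>0$. Put $f_0=F'$, let $f_1=\sqrt{2F}$ on $[-1,1]$ and $f_1=-\sqrt{2F}$ elsewhere, and $c_0=\int_{-1}^1f_1(u)\,du$. Let $T,\rho>0$. Let $\mathbf g=(g_{\alpha\beta})$ be a smooth Lorentzian metric, of signature $(-,+,\dots,+)$, and $\kappa$ a smooth bounded function on $M_T^{2\rho}$, and assume that both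 extend smoothly to $M_{T'}^{2\rho}$ for some $T'>T$. Write $(g^{\alpha\beta})=(g_{\alpha\beta})^{-1}$, $g=\det(g_{\alpha\beta})$, $\gamma_{ab}(y^\tau)=g_{ab}(y^\tau,0)$ for $0\le a,b\le n-1$, and $(\gamma^{ab})=(\gamma_{ab})^{-1}$. Fix a finite cover of $M$ by coordinate charts and assume that, in the corresponding standard local coordinates and uniformly on $M_T^{2\rho}$, for $0\le a,b\le n-1$, $$g_{ab}=\gamma_{ab}(y^\tau)+O(|y^n|),\quad g_{an}=O(|y^n|),\quad g_{nn}=1+O((y^n)^2),$$ $$g^{ab}=\gamma^{ab}(y^\tau)+O(|y^n|),\quad g^{an}=O(|y^n|),\quad g^{nn}=1+O((y^n)^2),$$ $$\partial_0g^{ab}=O(1),\quad \partial_0g^{an}=O(|y^n|),\quad \partial_0g^{nn}=O((y^n)^2),$$ $$\frac{-1}{\sqrt{-g}}g^{n\alpha}\partial_\alpha\sqrt{-g}=\frac{-1}{\sqrt{-g}}\partial_n\sqrt{-g}+O(|y^n|)=-\kappa(y^\tau,0)+O(|y^n|).$$ Define the symmetric tensor $a^{\alpha\beta}$ by $a^{\alpha\beta}\xi_\alpha\xi_\beta=-g^{00}\xi_0^2+\sum_{i,j=1}^ng^{ij}\xi_i\xi_j$,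 and let $c_2,c_3,c_4,c_5>0$ be constants such that, in the same coordinates, everywhere in $M_T^{2\rho}$ and for all $\xi\in\mathbb R^{1+n}$, $$\tfrac12\sum_{a,b=0}^{n-1}a^{ab}\xi_a\xi_b+(1+(y^n)^2)\xi_n^2\le(1+c_2(y^n)^2)\,a^{\alpha\beta}\xi_\alpha\xi_\beta\le2\sum_{a,b=0}^{n-1}a^{ab}\xi_a\xi_b+(1+c_3(y^n)^2)\xi_n^2,$$ $$\sum_{a=0}^{n-1}\xi_a^2\le c_4\sum_{a,b=0}^{n-1}a^{ab}\xi_a\xi_b,\qquad |g^{n\alpha}\xi_\alpha\xi_0|\le\tfrac{c_5}2\,a^{\alpha\beta}\xi_\alpha\xi_\beta .$$ **Proposition 5.1.** There is a constant $C$ (depending on $M$, $d(vol)_0$, $F$, $T$, $\rho$, $\mathbf g$, $\kappa$, the chosen charts and $c_2,\dots,c_5$) such that the following holds for every $\varepsilon\in(0,1]$ and every smooth $v:M_T^{2\rho}\to\mathbb R$ that solves $$\varepsilon\,\square_{\mathbf g}v+\tfrac1\varepsilon f_0(v)+\kappa f_1(v)=0,\qquad \square_{\mathbf g}v=\frac{-1}{\sqrt{-g}}\partial_\alpha\big(\sqrt{-g}\,g^{\alpha\beta}\partial_\beta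 v\big).$$ Let $\rho(s)=\rho-c_5s$, $e_\varepsilon(v)=\frac\varepsilon2a^{\alpha\beta}\partial_\alpha v\,\partial_\beta v+\frac1\varepsilon F(v)$ and $$\zeta_1(s)=\int_{M^{\rho(s)}}(1+c_2(y^n)^2)\,e_\varepsilon(v)\,d(vol)\Big|_{y^0=s}-c_0\,vol_0(M),$$ $$\zeta_2(s)=\int_{M^{\rho/2}}|y^n|\,|v-\operatorname{sign}(y^n)|^2\,d(vol)\Big|_{y^0=s},$$ $$\zeta_3(s)=\int_{M^{\rho(s)}}\frac\varepsilon2\sum_{a,b=0}^{n-1}a^{ab}\partial_av\,\partial_bv+(y^n)^2\Big[\frac\varepsilon2|\partial_nv|^2+\frac1\varepsilon F(v)\Big]d(vol)\Big|_{y^0=s}.$$ Then $$\zeta_i(s)\le C\max(\zeta_1(0),\zeta_2(0))\qquad\text{for } i=1,2,3\text{ and }0<s<\min\big(T,\rho/(3c_5)\big).$$ -/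

import Mathlib

open Set MeasureTheory
open scoped Manifold ContDiff

noncomputable section

namespace AcceleratingFronts

/-! ### The nonlinearity -/

/-- `F` is a smooth double-well potential with nondegenerate wells exactly at `±1`.
The quadratic lower bound is required on all of `ℝ`, the upper one on `[-2, 2]`. -/
structure IsDoubleWell (F : ℝ → ℝ) : Prop where
  smooth : ContDiff ℝ ∞ F
  pos : ∀ x, |x| ≠ 1 → 0 < F x
  lower : ∃ c > 0, ∀ x, c * (1 - |x|) ^ 2 ≤ F x
  upper : ∃ C, ∀ x, |x| ≤ 2 → F x ≤ C * (1 - |x|) ^ 2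

/-- `f₀ = F'`. -/
def f0 (F : ℝ → ℝ) : ℝ → ℝ := deriv F

/-- `f₁ = √(2F)` on `[-1, 1]` and `f₁ = -√(2F)` elsewhere. -/
def f1 (F : ℝ → ℝ) (x : ℝ) : ℝ :=
  if x ∈ Icc (-1 : ℝ) 1 then √(2 * F x) else -√(2 * F x)

/-- `c₀ = ∫_{-1}^{1} f₁`. -/
def c0 (F : ℝ → ℝ) : ℝ := ∫ u in (-1 : ℝ)..1, f1 F u

/-! ### The space `ℝ × M × ℝ` and its standard local coordinates

`M` is a manifold of dimension `m = n - 1`. Points of `ℝ × M × ℝ` are `(y⁰, y', yⁿ)`.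
Coordinates `y : Fin (m + 2) → ℝ` are numbered `0, …, n`: index `0` is time, `Fin.last (m + 1)`
is the normal coordinate `yⁿ`, and the indices in between belong to `M`. The tangential
indices `0, …, n - 1` are `a.castSucc` for `a : Fin (m + 1)`. -/

/-- Local charts of an `m`-dimensional manifold `M`. -/
abbrev Chart (m : ℕ) (M : Type*) [TopologicalSpace M] :=
  OpenPartialHomeomorph M (EuclideanSpace ℝ (Fin m))

/-- The model with corners of `ℝ × M × ℝ`. -/
abbrev model (m : ℕ) :=
  (𝓘(ℝ, ℝ)).prod ((𝓡 m).prod 𝓘(ℝ, ℝ))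

/-- The set `M_T^r = (-T, T) × M × (-r, r)`. -/
def slab (M : Type*) (T r : ℝ) : Set (ℝ × M × ℝ) :=
  Ioo (-T) T ×ˢ (univ ×ˢ Ioo (-r) r)

/-- The `M`-part `y' = (y¹, …, yⁿ⁻¹)` of a coordinate vector. -/
def middle {m : ℕ} (y : Fin (m + 2) → ℝ) : EuclideanSpace ℝ (Fin m) :=
  WithLp.toLp 2 fun i => y i.succ.castSucc

/-- The coordinate vector with `yⁿ` replaced by `0`, i.e. the point `(y^τ, 0)`. -/
def toHypersurface {m : ℕ} (y : Fin (m + 2) → ℝ) : Fin (m + 2) → ℝ :=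
  Function.update y (Fin.last (m + 1)) 0

/-- The partial derivative `∂_α h` at `y`. -/
def pd {m : ℕ} (α : Fin (m + 2)) (h : (Fin (m + 2) → ℝ) → ℝ) (y : Fin (m + 2) → ℝ) : ℝ :=
  fderiv ℝ h y (Pi.single α 1)

section Coordinates

variable {m : ℕ} {M : Type*} [TopologicalSpace M]

/-- The local parametrization `(y⁰, …, yⁿ) ↦ (y⁰, e⁻¹(y'), yⁿ)` given by a chart `e` of `M`. -/
def coordMap (e : Chart m M) (y : Fin (m + 2) → ℝ) : ℝ × M × ℝ :=
  (y 0, e.symm (middle y), y (Fin.last (m + 1)))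

/-- The coordinates of a point in the standard local coordinate system given by `e`. -/
def coords (e : Chart m M) (p : ℝ × M × ℝ) : Fin (m + 2) → ℝ :=
  Fin.snoc (α := fun _ => ℝ) (Fin.cons (α := fun _ => ℝ) p.1 fun i => e p.2.1 i) p.2.2

/-- The part of coordinate space that corresponds to `(-T, T) × e.source × (-r, r)`. -/
def coordDomain (e : Chart m M) (T r : ℝ) : Set (Fin (m + 2) → ℝ) :=
  {y | y 0 ∈ Ioo (-T) T ∧ middle y ∈ e.target ∧ y (Fin.last (m + 1)) ∈ Ioo (-r) r}

end Coordinates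

section Geometry

variable {m : ℕ} {M : Type*} [TopologicalSpace M] [ChartedSpace (EuclideanSpace ℝ (Fin m)) M]

variable (m M) in
/-- Fields of bilinear forms on the tangent spaces of `ℝ × M × ℝ`. -/
abbrev BilinField :=
  (p : ℝ × M × ℝ) → LinearMap.BilinForm ℝ (TangentSpace (model m) p)

/-- The coordinate vector field `∂/∂y^α` of the coordinate system given by `e`. -/
def coordVec (e : Chart m M) (y : Fin (m + 2) → ℝ) (α : Fin (m + 2)) :
    TangentSpace (model m) (coordMap e y) :=
  mfderiv 𝓘(ℝ, Fin (m + 2) → ℝ) (model m) (coordMap e) y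
    (show Fin (m + 2) → ℝ from Pi.single α 1)

/-- The components `g_{αβ}` in the coordinates given by `e`. -/
def lower (g : BilinField m M) (e : Chart m M) (y : Fin (m + 2) → ℝ) :
    Matrix (Fin (m + 2)) (Fin (m + 2)) ℝ :=
  Matrix.of fun α β => g (coordMap e y) (coordVec e y α) (coordVec e y β)

/-- The components `g^{αβ}` of the inverse metric. -/
def upper (g : BilinField m M) (e : Chart m M) (y : Fin (m + 2) → ℝ) :
    Matrix (Fin (m + 2)) (Fin (m + 2)) ℝ :=
  (lower g e y)⁻¹

/-- `√(-det (g_{αβ}))`. -/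
def sqrtDet (g : BilinField m M) (e : Chart m M) (y : Fin (m + 2) → ℝ) : ℝ :=
  √(-(lower g e y).det)

/-- The components `γ_{ab}(y^τ)`, `0 ≤ a, b ≤ n - 1`, of the metric induced on `{yⁿ = 0}`. -/
def gam (g : BilinField m M) (e : Chart m M) (y : Fin (m + 2) → ℝ) :
    Matrix (Fin (m + 1)) (Fin (m + 1)) ℝ :=
  (lower g e (toHypersurface y)).submatrix Fin.castSucc Fin.castSucc

/-- The components of the symmetric tensor `a` with
`a^{αβ} ξ_α ξ_β = -g^{00} ξ_0² + ∑_{i,j ≥ 1} g^{ij} ξ_i ξ_j`. -/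
def aTensor (g : BilinField m M) (e : Chart m M) (y : Fin (m + 2) → ℝ) :
    Matrix (Fin (m + 2)) (Fin (m + 2)) ℝ :=
  Matrix.of fun α β =>
    if α = 0 ∧ β = 0 then -upper g e y 0 0
    else if α = 0 ∨ β = 0 then 0
    else upper g e y α β

/-- `∑_{α,β=0}^{n} a^{αβ} ξ_α ξ_β`. -/
def aForm (g : BilinField m M) (e : Chart m M) (y ξ : Fin (m + 2) → ℝ) : ℝ :=
  ∑ α, ∑ β, aTensor g e y α β * ξ α * ξ β

/-- `∑_{a,b=0}^{n-1} a^{ab} ξ_a ξ_b`. -/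
def aFormTan (g : BilinField m M) (e : Chart m M) (y ξ : Fin (m + 2) → ℝ) : ℝ :=
  ∑ a : Fin (m + 1), ∑ b : Fin (m + 1),
    aTensor g e y a.castSucc b.castSucc * ξ a.castSucc * ξ b.castSucc

/-- The wave operator `□_g v = -(1/√-g) ∂_α (√-g g^{αβ} ∂_β v)` in the coordinates given
by `e`. -/
def box (g : BilinField m M) (v : ℝ × M × ℝ → ℝ) (e : Chart m M) (y : Fin (m + 2) → ℝ) : ℝ :=
  -(1 / sqrtDet g e y) *
    ∑ α, pd α (fun z => sqrtDet g e z * ∑ β, upper g e z α β * pd β (v ∘ coordMap e) z) y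

/-- `v` is a smooth solution on `M_T^r` of `ε □_g v + (1/ε) f₀(v) + κ f₁(v) = 0`; the
equation is written in all standard local coordinates. -/
structure IsSmoothSolution (g : BilinField m M) (κ : ℝ × M × ℝ → ℝ) (F : ℝ → ℝ) (ε T r : ℝ)
    (v : ℝ × M × ℝ → ℝ) : Prop where
  smooth : ContMDiffOn (model m) 𝓘(ℝ, ℝ) ∞ v (slab M T r)
  eqn : ∀ e ∈ IsManifold.maximalAtlas (𝓡 m) ∞ M, ∀ y ∈ coordDomain e T r,
    ε * box g v e y + 1 / ε * f0 F (v (coordMap e y))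
      + κ (coordMap e y) * f1 F (v (coordMap e y)) = 0

/-- A bilinear form of signature `(-, +, …, +)`. -/
def IsLorentzian {V : Type*} [AddCommGroup V] [Module ℝ V] (b : LinearMap.BilinForm ℝ V) : Prop :=
  (∀ u w, b u w = b w u) ∧ ∃ u, b u u < 0 ∧ ∀ w, b u w = 0 → w ≠ 0 → 0 < b w w

/-- The field of bilinear forms `g` is smooth on `M_T^r`: its components are smooth in all
standard local coordinates. -/
def SmoothFieldOn (g : BilinField m M) (T r : ℝ) : Prop :=
  ∀ e ∈ IsManifold.maximalAtlas (𝓡 m) ∞ M, ∀ α β,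
    ContDiffOn ℝ ∞ (fun y => lower g e y α β) (coordDomain e T r)

/-- A finite family of smooth charts whose domains cover `M`. -/
structure IsFiniteCover (𝒰 : Set (Chart m M)) : Prop where
  finite : 𝒰.Finite
  smooth : 𝒰 ⊆ IsManifold.maximalAtlas (𝓡 m) ∞ M
  cover : ∀ x : M, ∃ e ∈ 𝒰, x ∈ e.source

/-- `g` is a smooth Lorentzian metric on `M_T^{2ρ}` and `κ` a smooth bounded function there,
both smooth up to `|y⁰| = T`, such that the components of `g` in the charts of `𝒰` satisfy the
estimates of almost-normal coordinates around a hypersurface `{yⁿ = 0}` of mean curvature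
`-κ`, uniformly on `M_T^{2ρ}` with implied constant `K`. -/
structure IsAdapted (𝒰 : Set (Chart m M)) (g : BilinField m M) (κ : ℝ × M × ℝ → ℝ)
    (T ρ K : ℝ) : Prop where
  lorentzian : ∀ p ∈ slab M T (2 * ρ), IsLorentzian (g p)
  smooth : ∃ T' > T, SmoothFieldOn g T' (2 * ρ) ∧
    ContMDiffOn (model m) 𝓘(ℝ, ℝ) ∞ κ (slab M T' (2 * ρ))
  bounded : ∃ B, ∀ p ∈ slab M T (2 * ρ), |κ p| ≤ B
  lower_tan : ∀ e ∈ 𝒰, ∀ y ∈ coordDomain e T (2 * ρ), ∀ a b : Fin (m + 1),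
    |lower g e y a.castSucc b.castSucc - gam g e y a b| ≤ K * |y (Fin.last (m + 1))|
  lower_mixed : ∀ e ∈ 𝒰, ∀ y ∈ coordDomain e T (2 * ρ), ∀ a : Fin (m + 1),
    |lower g e y a.castSucc (Fin.last (m + 1))| ≤ K * |y (Fin.last (m + 1))|
  lower_normal : ∀ e ∈ 𝒰, ∀ y ∈ coordDomain e T (2 * ρ),
    |lower g e y (Fin.last (m + 1)) (Fin.last (m + 1)) - 1| ≤ K * y (Fin.last (m + 1)) ^ 2
  upper_tan : ∀ e ∈ 𝒰, ∀ y ∈ coordDomain e T (2 * ρ), ∀ a b : Fin (m + 1),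
    |upper g e y a.castSucc b.castSucc - (gam g e y)⁻¹ a b| ≤ K * |y (Fin.last (m + 1))|
  upper_mixed : ∀ e ∈ 𝒰, ∀ y ∈ coordDomain e T (2 * ρ), ∀ a : Fin (m + 1),
    |upper g e y a.castSucc (Fin.last (m + 1))| ≤ K * |y (Fin.last (m + 1))|
  upper_normal : ∀ e ∈ 𝒰, ∀ y ∈ coordDomain e T (2 * ρ),
    |upper g e y (Fin.last (m + 1)) (Fin.last (m + 1)) - 1| ≤ K * y (Fin.last (m + 1)) ^ 2
  dt_upper_tan : ∀ e ∈ 𝒰, ∀ y ∈ coordDomain e T (2 * ρ), ∀ a b : Fin (m + 1),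
    |pd 0 (fun z => upper g e z a.castSucc b.castSucc) y| ≤ K
  dt_upper_mixed : ∀ e ∈ 𝒰, ∀ y ∈ coordDomain e T (2 * ρ), ∀ a : Fin (m + 1),
    |pd 0 (fun z => upper g e z a.castSucc (Fin.last (m + 1))) y|
      ≤ K * |y (Fin.last (m + 1))|
  dt_upper_normal : ∀ e ∈ 𝒰, ∀ y ∈ coordDomain e T (2 * ρ),
    |pd 0 (fun z => upper g e z (Fin.last (m + 1)) (Fin.last (m + 1))) y|
      ≤ K * y (Fin.last (m + 1)) ^ 2
  curvature₁ : ∀ e ∈ 𝒰, ∀ y ∈ coordDomain e T (2 * ρ),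
    |-1 / sqrtDet g e y * (∑ α, upper g e y (Fin.last (m + 1)) α * pd α (sqrtDet g e) y)
        - -1 / sqrtDet g e y * pd (Fin.last (m + 1)) (sqrtDet g e) y|
      ≤ K * |y (Fin.last (m + 1))|
  curvature₂ : ∀ e ∈ 𝒰, ∀ y ∈ coordDomain e T (2 * ρ),
    |-1 / sqrtDet g e y * (∑ α, upper g e y (Fin.last (m + 1)) α * pd α (sqrtDet g e) y)
        - -κ (coordMap e (toHypersurface y))|
      ≤ K * |y (Fin.last (m + 1))|

/-- The positive constants `c₂, …, c₅` compare the tensor `a` with its tangential part, with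
the Euclidean form and with the flux `g^{nα} ξ_α ξ_0`, everywhere in `M_T^{2ρ}`. -/
structure AreEnergyConstants (𝒰 : Set (Chart m M)) (g : BilinField m M) (T ρ c₂ c₃ c₄ c₅ : ℝ) :
    Prop where
  pos₂ : 0 < c₂
  pos₃ : 0 < c₃
  pos₄ : 0 < c₄
  pos₅ : 0 < c₅
  form_lower : ∀ e ∈ 𝒰, ∀ y ∈ coordDomain e T (2 * ρ), ∀ ξ,
    1 / 2 * aFormTan g e y ξ + (1 + y (Fin.last (m + 1)) ^ 2) * ξ (Fin.last (m + 1)) ^ 2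
      ≤ (1 + c₂ * y (Fin.last (m + 1)) ^ 2) * aForm g e y ξ
  form_upper : ∀ e ∈ 𝒰, ∀ y ∈ coordDomain e T (2 * ρ), ∀ ξ,
    (1 + c₂ * y (Fin.last (m + 1)) ^ 2) * aForm g e y ξ
      ≤ 2 * aFormTan g e y ξ
        + (1 + c₃ * y (Fin.last (m + 1)) ^ 2) * ξ (Fin.last (m + 1)) ^ 2
  coercive : ∀ e ∈ 𝒰, ∀ y ∈ coordDomain e T (2 * ρ), ∀ ξ : Fin (m + 2) → ℝ,
    ∑ a : Fin (m + 1), ξ a.castSucc ^ 2 ≤ c₄ * aFormTan g e y ξ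
  flux : ∀ e ∈ 𝒰, ∀ y ∈ coordDomain e T (2 * ρ), ∀ ξ : Fin (m + 2) → ℝ,
    |∑ α, upper g e y (Fin.last (m + 1)) α * ξ α * ξ 0| ≤ c₅ / 2 * aForm g e y ξ

/-! ### Energies

The densities below do not depend on the local coordinates on `M`; at the point
`p = (y⁰, y', yⁿ)` they are computed in the preferred chart at `y'`. -/

/-- The gradient `(∂_0 v, …, ∂_n v)` at `p`. -/
def grad (v : ℝ × M × ℝ → ℝ) (p : ℝ × M × ℝ) (α : Fin (m + 2)) : ℝ :=
  pd α (v ∘ coordMap (chartAt (EuclideanSpace ℝ (Fin m)) p.2.1))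
    (coords (chartAt (EuclideanSpace ℝ (Fin m)) p.2.1) p)

/-- `a^{αβ} ∂_α v ∂_β v` at `p`. -/
def aGrad (g : BilinField m M) (v : ℝ × M × ℝ → ℝ) (p : ℝ × M × ℝ) : ℝ :=
  aForm g (chartAt (EuclideanSpace ℝ (Fin m)) p.2.1)
    (coords (chartAt (EuclideanSpace ℝ (Fin m)) p.2.1) p) (grad v p)

/-- `∑_{a,b=0}^{n-1} a^{ab} ∂_a v ∂_b v` at `p`. -/
def aGradTan (g : BilinField m M) (v : ℝ × M × ℝ → ℝ) (p : ℝ × M × ℝ) : ℝ :=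
  aFormTan g (chartAt (EuclideanSpace ℝ (Fin m)) p.2.1)
    (coords (chartAt (EuclideanSpace ℝ (Fin m)) p.2.1) p) (grad v p)

/-- `∂_{yⁿ} v` at `p`. -/
def normalDeriv (v : ℝ × M × ℝ → ℝ) (p : ℝ × M × ℝ) : ℝ :=
  deriv (fun t => v (p.1, p.2.1, t)) p.2.2

/-- The energy density `e_ε(v; g) = (ε/2) a^{αβ} ∂_α v ∂_β v + (1/ε) F(v)`. -/
def energyDensity (g : BilinField m M) (F : ℝ → ℝ) (ε : ℝ) (v : ℝ × M × ℝ → ℝ)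
    (p : ℝ × M × ℝ) : ℝ :=
  ε / 2 * aGrad g v p + 1 / ε * F (v p)

variable [MeasurableSpace M]

variable (m) in
/-- `μ` is the measure of a smooth volume form on `M`: in every smooth chart it has a smooth
positive density with respect to Lebesgue measure. -/
def IsSmoothVolume (μ : Measure M) : Prop :=
  ∀ e ∈ IsManifold.maximalAtlas (𝓡 m) ∞ M, ∃ w : EuclideanSpace ℝ (Fin m) → ℝ,
    ContDiffOn ℝ ∞ w e.target ∧ (∀ x ∈ e.target, 0 < w x) ∧
      ∀ A ⊆ e.target, MeasurableSet A →
        μ (e.symm '' A) = ∫⁻ x in A, ENNReal.ofReal (w x)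

/-- `∫_{M^r} h d(vol)` at `y⁰ = s`, where `M^r = M × (-r, r)` and `d(vol) = d(vol)₀ dyⁿ`. -/
def sliceIntegral (μ : Measure M) (h : ℝ × M × ℝ → ℝ) (r s : ℝ) : ℝ :=
  ∫ q in univ ×ˢ Ioo (-r) r, h (s, q.1, q.2) ∂(μ.prod (volume : Measure ℝ))

/-- The weighted energy excess `ζ₁`. -/
def zeta1 (μ : Measure M) (g : BilinField m M) (F : ℝ → ℝ) (ρ c₂ c₅ ε : ℝ)
    (v : ℝ × M × ℝ → ℝ) (s : ℝ) : ℝ :=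
  sliceIntegral μ (fun p => (1 + c₂ * p.2.2 ^ 2) * energyDensity g F ε v p) (ρ - c₅ * s) s
    - c0 F * μ.real univ

/-- The weighted squared `L²` distance `ζ₂` to `sign(yⁿ)`. -/
def zeta2 (μ : Measure M) (ρ : ℝ) (v : ℝ × M × ℝ → ℝ) (s : ℝ) : ℝ :=
  sliceIntegral μ (fun p => |p.2.2| * |v p - Real.sign p.2.2| ^ 2) (ρ / 2) s

/-- The tangential and weighted normal energy `ζ₃`. -/
def zeta3 (μ : Measure M) (g : BilinField m M) (F : ℝ → ℝ) (ρ c₅ ε : ℝ)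
    (v : ℝ × M × ℝ → ℝ) (s : ℝ) : ℝ :=
  sliceIntegral μ (fun p => ε / 2 * aGradTan g v p
    + p.2.2 ^ 2 * (ε / 2 * |normalDeriv v p| ^ 2 + 1 / ε * F (v p))) (ρ - c₅ * s) s

end Geometry

end AcceleratingFronts

end

set_option linter.unusedSectionVars false

noncomputable section

namespace AcceleratingFronts

/-! ### One-dimensional analysis of the double well -/

section DoubleWell

variable {F : ℝ → ℝ}

/-! The model solution is a one-dimensional front in the normal variable: `ε ∂ₙv = f₁(v)`, with
energy close to `c₀` on every normal line and almost no tangential gradient. The departure from it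
is measured by `N(s)`, the integral over `M^{ρ(s)}` of `excessDensity`, which is the density of `ζ₃`
plus the defect `(ε ∂ₙv - f₁(v))²/ε`. The proof is a Grönwall argument for `N`, built on three
estimates.

Coercivity (`exists_excess_slice_le`). On a normal line, completing the square bounds the energy
below by `c₀` plus a quarter of the defect, up to a multiple of `∫ |z| |v - sign z|²`: the cross
term `v' f₁(v)` integrates to nearly `c₀` between two points at which `v` is near `-1` and `1`
(`profile_energy_lower`). The weight `1 + c₂ (yⁿ)²` pays for the tangential and weighted parts of
the excess. Hence `δ N ≤ ζ₁ + L ζ₂`.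

Growth of the energy (`exists_zeta1_le`). Multiplying the equation by `∂₀v` gives a local energy
identity. The slices shrink at speed `c₅`, so the flux through the lateral boundary has a good sign.
Every source is bounded by the excess: in the quadratic terms each normal derivative comes with a
factor `yⁿ`, with one exception. The volume density contributes `ε κ ∂ₙv ∂₀v`, which has no such
factor, but the forcing contributes `-κ f₁(v) ∂₀v`, and the sum `κ ∂₀v (ε ∂ₙv - f₁(v))` is
controlled by the tangential energy and the defect (`abs_forcing_le`). Hence `ζ₁(s) ≤ ζ₁(0) + B₁ ∫
N`.

Growth of the distance (`exists_signDist_slice_le`). The derivative of `(v - 1)²` does not vanish at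
`v = -1`, where `F` does, so `ζ₂` is replaced by a comparable integral `D` of `signDist`, whose
derivative in `v` has square `(yⁿ)² (1 - |v|)²` and is therefore controlled by `(yⁿ)² F(v)`. Hence
`D(s) ≤ D(0) + B₂ ∫ N`.

A combination `A = ζ₁ + (8L + 1) D` dominates both `δ N` and `D` and satisfies `A(s) ≤ A(0) + B ∫
N`, so Grönwall's inequality bounds `N`, then `A`, then all three `ζᵢ` (`exists_zeta_le`). -/

theorem IsDoubleWell.nonneg (hF : IsDoubleWell F) (x : ℝ) : 0 ≤ F x := by
  obtain ⟨c, hc, h⟩ := hF.lower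
  exact (by positivity : 0 ≤ c * (1 - |x|) ^ 2).trans (h x)

theorem IsDoubleWell.eq_zero (hF : IsDoubleWell F) {x : ℝ} (hx : |x| = 1) : F x = 0 := by
  obtain ⟨C, h⟩ := hF.upper
  refine le_antisymm ?_ (hF.nonneg x)
  simpa [hx] using h x (by rw [hx]; norm_num)

/-- The two branches differ by a sign and meet at `±1`, where `F` vanishes. -/
theorem IsDoubleWell.continuous_f1 (hF : IsDoubleWell F) : Continuous (f1 F) := by
  have hc : Continuous fun x => √(2 * F x) := by
    have := hF.smooth.continuous
    fun_prop
  classical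
  refine Continuous.if ?_ hc hc.neg
  intro a ha
  change a ∈ frontier (Icc (-1 : ℝ) 1) at ha
  rw [frontier_Icc (by norm_num)] at ha
  have : F a = 0 := hF.eq_zero (by rcases ha with h | h <;> simp_all)
  simp [this]

theorem IsDoubleWell.f1_sq (hF : IsDoubleWell F) (x : ℝ) : f1 F x ^ 2 = 2 * F x := by
  have := hF.nonneg x
  unfold f1
  split_ifs
  · rw [Real.sq_sqrt (by positivity)]
  · rw [neg_sq, Real.sq_sqrt (by positivity)]

/-- The function `f₁`, replaced by zero off `[-1, 1]`. -/
def f1Trunc (F : ℝ → ℝ) (x : ℝ) : ℝ := max (f1 F x) 0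

theorem f1Trunc_of_mem {x : ℝ} (hx : x ∈ Icc (-1 : ℝ) 1) :
    f1Trunc F x = f1 F x := by
  unfold f1Trunc f1
  simp [hx]

theorem f1Trunc_of_notMem {x : ℝ} (hx : x ∉ Icc (-1 : ℝ) 1) :
    f1Trunc F x = 0 := by
  unfold f1Trunc f1
  simp [hx]

theorem IsDoubleWell.continuous_f1Trunc (hF : IsDoubleWell F) : Continuous (f1Trunc F) :=
  hF.continuous_f1.max continuous_const

/-- The weighted completion of the square, with a loss outside `[-1, 1]`. -/
theorem IsDoubleWell.square_le (hF : IsDoubleWell F) {ε : ℝ} (hε : 0 < ε) (p x : ℝ) :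
    (ε * p - f1 F x) ^ 2 / (4 * ε) + p * f1Trunc F x ≤ ε / 2 * p ^ 2 + 1 / ε * F x := by
  have h2 := hF.f1_sq x
  have hFx : F x = f1 F x ^ 2 / 2 := by linarith
  rw [hFx]
  -- With the constant `1/4` in front of the square, what remains is a perfect square in both cases:
  -- of `ε p - f₁` inside the interval, where the cross term `p f₁` is subtracted, and of `ε p + f₁`
  -- outside, where it is not.
  by_cases hx : x ∈ Icc (-1 : ℝ) 1
  · rw [f1Trunc_of_mem hx]
    have : ε / 2 * p ^ 2 + 1 / ε * (f1 F x ^ 2 / 2) - ((ε * p - f1 F x) ^ 2 / (4 * ε) + p * f1 F x)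
        = (ε * p - f1 F x) ^ 2 / (4 * ε) := by field_simp; ring
    have h3 : 0 ≤ (ε * p - f1 F x) ^ 2 / (4 * ε) := by positivity
    linarith
  · rw [f1Trunc_of_notMem hx]
    have : ε / 2 * p ^ 2 + 1 / ε * (f1 F x ^ 2 / 2) - ((ε * p - f1 F x) ^ 2 / (4 * ε) + p * 0)
        = (ε * p + f1 F x) ^ 2 / (4 * ε) := by field_simp; ring
    have h3 : 0 ≤ (ε * p + f1 F x) ^ 2 / (4 * ε) := by positivity
    linarith

/-- The version without cross term, for the part of a normal line outside `[-a, a]`, where nothing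
is known about the values of `v`. -/
theorem IsDoubleWell.square_le' (hF : IsDoubleWell F) {ε : ℝ} (hε : 0 < ε) (p x : ℝ) :
    (ε * p - f1 F x) ^ 2 / (4 * ε) ≤ ε / 2 * p ^ 2 + 1 / ε * F x := by
  have h2 := hF.f1_sq x
  have hFx : F x = f1 F x ^ 2 / 2 := by linarith
  rw [hFx]
  have : ε / 2 * p ^ 2 + 1 / ε * (f1 F x ^ 2 / 2) - ((ε * p - f1 F x) ^ 2 / (4 * ε))
        = (ε * p + f1 F x) ^ 2 / (4 * ε) := by field_simp; ring
  have h3 : 0 ≤ (ε * p + f1 F x) ^ 2 / (4 * ε) := by positivity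
  linarith

/-- Since `F ≤ C (1 - |x|)²` on `[-1, 1]`, its root vanishes linearly at both wells. Truncation
makes the bound hold on the whole line, and integrating it gives quadratic errors in `c0_sub_le`. -/
theorem IsDoubleWell.f1Trunc_le (hF : IsDoubleWell F) :
    ∃ L, 0 ≤ L ∧ (∀ x, f1Trunc F x ≤ L * |x - 1|) ∧ ∀ x, f1Trunc F x ≤ L * |x + 1| := by
  obtain ⟨C, hC⟩ := hF.upper
  have key : ∀ x ∈ Icc (-1 : ℝ) 1, f1Trunc F x ≤ √(2 * |C|) * (1 - |x|) := by
    intro x hx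
    have hx1 : |x| ≤ 1 := abs_le.2 hx
    rw [f1Trunc_of_mem hx]
    simp only [f1, hx, if_true]
    rw [← Real.sqrt_sq (by linarith : 0 ≤ 1 - |x|), ← Real.sqrt_mul (by positivity)]
    apply Real.sqrt_le_sqrt
    have := hC x (by linarith)
    have h4 : C * (1 - |x|) ^ 2 ≤ |C| * (1 - |x|) ^ 2 := by gcongr; exact le_abs_self C
    linarith
  refine ⟨√(2 * |C|), by positivity, fun x => ?_, fun x => ?_⟩
  all_goals
    by_cases hx : x ∈ Icc (-1 : ℝ) 1
    · refine (key x hx).trans ?_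
      gcongr
      have h1 := le_abs_self x
      have h2 := neg_abs_le x
      first
      | (have := neg_abs_le (x - 1); linarith)
      | (have := le_abs_self (x + 1); linarith)
    · rw [f1Trunc_of_notMem hx]; positivity

theorem f1Trunc_nonneg (x : ℝ) : 0 ≤ f1Trunc F x := le_max_right _ _

/-- The two integrals differ only over the intervals from `y` to `1` and from `x` to `-1`. There the
integrand is at most `L` times the length of the interval, so each contributes at most `L` times the
squared length. This is the energy deficit of a transition whose end values miss the wells. -/
theorem IsDoubleWell.c0_sub_le (hF : IsDoubleWell F) :
    ∃ L, 0 ≤ L ∧ ∀ x y, c0 F - ∫ u in x..y, f1Trunc F u ≤ L * ((y - 1) ^ 2 + (x + 1) ^ 2) := by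
  obtain ⟨L, hL, h1, h2⟩ := hF.f1Trunc_le
  have hi : ∀ a b, IntervalIntegrable (f1Trunc F) volume a b :=
    fun a b => hF.continuous_f1Trunc.intervalIntegrable a b
  have hc : c0 F = ∫ u in (-1 : ℝ)..1, f1Trunc F u := by
    refine intervalIntegral.integral_congr fun x hx => ?_
    rw [uIcc_of_le (by norm_num)] at hx
    exact (f1Trunc_of_mem hx).symm
  have key : ∀ (p y : ℝ), (∀ x, f1Trunc F x ≤ L * |x - p|) →
      |∫ u in y..p, f1Trunc F u| ≤ L * (y - p) ^ 2 := by
    intro p y h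
    have := intervalIntegral.norm_integral_le_of_norm_le_const (a := y) (b := p)
      (f := f1Trunc F) (C := L * |y - p|) (fun x hx => by
        rw [Real.norm_of_nonneg (f1Trunc_nonneg x)]
        refine (h x).trans ?_
        refine mul_le_mul_of_nonneg_left ?_ hL
        have h3 := abs_sub_right_of_mem_uIcc (uIoc_subset_uIcc hx)
        rwa [abs_sub_comm p x, abs_sub_comm p y] at h3)
    rw [Real.norm_eq_abs, abs_sub_comm p y, mul_assoc, abs_mul_abs_self, ← sq] at this
    exact this
  refine ⟨L, hL, fun x y => ?_⟩
  have e1 : c0 F - ∫ u in x..y, f1Trunc F u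
      = (∫ u in y..(1 : ℝ), f1Trunc F u) - ∫ u in x..(-1 : ℝ), f1Trunc F u := by
    rw [hc, ← intervalIntegral.integral_add_adjacent_intervals (hi (-1) x) (hi x 1),
      ← intervalIntegral.integral_add_adjacent_intervals (hi x y) (hi y 1),
      intervalIntegral.integral_symm x (-1)]
    ring
  have k1 := key 1 y h1
  have k2 := key (-1) x (fun x => by simpa using h2 x)
  rw [e1]
  have := le_abs_self (∫ u in y..(1 : ℝ), f1Trunc F u)
  have := neg_abs_le (∫ u in x..(-1 : ℝ), f1Trunc F u)
  rw [sub_neg_eq_add] at k2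
  linarith

/-- The right-hand side shows that the factor `|z|` removes the jump of the sign function, so the
density of `ζ₂` is continuous. -/
theorem abs_mul_sub_sign_sq (z v : ℝ) :
    |z| * |v - Real.sign z| ^ 2 = |z| * (v ^ 2 + 1) - 2 * z * v := by
  rw [sq_abs]
  rcases lt_trichotomy z 0 with h | h | h
  · rw [Real.sign_of_neg h, abs_of_neg h]; ring
  · simp [h]
  · rw [Real.sign_of_pos h, abs_of_pos h]; ring

/-- Lower bound for the energy of a profile in terms of its weighted distance to `sign`. -/
theorem IsDoubleWell.profile_energy_lower (hF : IsDoubleWell F) {ρ : ℝ} (hρ : 0 < ρ) :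
    ∃ L, 0 ≤ L ∧ ∀ ε > 0, ∀ r, ρ / 2 ≤ r → ∀ v v' : ℝ → ℝ,
      (∀ z ∈ Icc (-r) r, HasDerivAt v (v' z) z) → ContinuousOn v' (Icc (-r) r) →
      c0 F + ∫ z in (-r)..r, (ε * v' z - f1 F (v z)) ^ 2 / (4 * ε)
        ≤ (∫ z in (-r)..r, (ε / 2 * v' z ^ 2 + 1 / ε * F (v z)))
          + L * ∫ z in (-(ρ / 2))..(ρ / 2), |z| * |v z - Real.sign z| ^ 2 := by
  obtain ⟨L, hL, hLc⟩ := hF.c0_sub_le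
  refine ⟨L * (16 / ρ ^ 2), by positivity, fun ε hε r hr v v' hv hv' => ?_⟩
  have hvc : ContinuousOn v (Icc (-r) r) := fun z hz => (hv z hz).continuousAt.continuousWithinAt
  -- a good radius
  set f : ℝ → ℝ := fun a => (v a - 1) ^ 2 + (v (-a) + 1) ^ 2 with hf
  have hneg : MapsTo (fun a : ℝ => -a) (Icc (ρ / 4) (ρ / 2)) (Icc (-r) r) := by
    intro a ha; constructor <;> linarith [ha.1, ha.2]
  have hsub : Icc (ρ / 4) (ρ / 2) ⊆ Icc (-r) r := by
    intro a ha; constructor <;> linarith [ha.1, ha.2]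
  have hfc : ContinuousOn f (Icc (ρ / 4) (ρ / 2)) := by
    have h1 := hvc.mono hsub
    have h2 := hvc.comp continuousOn_neg hneg
    exact ((h1.sub continuousOn_const).pow 2).add ((h2.add continuousOn_const).pow 2)
  -- The best radius in `[ρ/4, ρ/2]` is at least as good as the average one, so the mismatch `f a`
  -- is controlled by an integral.
  obtain ⟨a, ha, hmin⟩ := isCompact_Icc.exists_isMinOn
    (nonempty_Icc.2 (by linarith : ρ / 4 ≤ ρ / 2)) hfc
  -- The constant is `1 / (ρ/4 · ρ/4)`: the interval of radii has length `ρ/4`, and the weight `|z|`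
  -- is at least `ρ/4` on it.
  have hfa : f a ≤ 16 / ρ ^ 2 * ∫ z in (-(ρ / 2))..(ρ / 2), |z| * |v z - Real.sign z| ^ 2 := by
    have hgc : ContinuousOn (fun z => |z| * |v z - Real.sign z| ^ 2) (Icc (-(ρ / 2)) (ρ / 2)) := by
      simp_rw [abs_mul_sub_sign_sq]
      have h1 : ContinuousOn v (Icc (-(ρ / 2)) (ρ / 2)) :=
        hvc.mono (Icc_subset_Icc (by linarith) hr)
      fun_prop
    have hgi : ∀ x y, x ∈ Icc (-(ρ / 2)) (ρ / 2) → y ∈ Icc (-(ρ / 2)) (ρ / 2) →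
        IntervalIntegrable (fun z => |z| * |v z - Real.sign z| ^ 2) volume x y := by
      intro x y hx hy
      exact (hgc.mono (uIcc_subset_Icc hx hy)).intervalIntegrable
    have m1 : -(ρ / 2) ∈ Icc (-(ρ / 2)) (ρ / 2) := by constructor <;> linarith
    have m2 : -(ρ / 4) ∈ Icc (-(ρ / 2)) (ρ / 2) := by constructor <;> linarith
    have m3 : ρ / 4 ∈ Icc (-(ρ / 2)) (ρ / 2) := by constructor <;> linarith
    have m4 : ρ / 2 ∈ Icc (-(ρ / 2)) (ρ / 2) := by constructor <;> linarith
    have s1 : (∫ z in (-(ρ / 2))..(ρ / 2), |z| * |v z - Real.sign z| ^ 2)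
        = (∫ z in (-(ρ / 2))..(-(ρ / 4)), |z| * |v z - Real.sign z| ^ 2)
          + (∫ z in (-(ρ / 4))..(ρ / 4), |z| * |v z - Real.sign z| ^ 2)
          + ∫ z in (ρ / 4)..(ρ / 2), |z| * |v z - Real.sign z| ^ 2 := by
      rw [intervalIntegral.integral_add_adjacent_intervals (hgi _ _ m1 m2) (hgi _ _ m2 m3),
        intervalIntegral.integral_add_adjacent_intervals (hgi _ _ m1 m3) (hgi _ _ m3 m4)]
    have s2 : 0 ≤ ∫ z in (-(ρ / 4))..(ρ / 4), |z| * |v z - Real.sign z| ^ 2 :=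
      intervalIntegral.integral_nonneg (by linarith) fun z _ => by positivity
    have s3 : (∫ z in (-(ρ / 2))..(-(ρ / 4)), |z| * |v z - Real.sign z| ^ 2)
        = ∫ z in (ρ / 4)..(ρ / 2), |z| * |v (-z) + 1| ^ 2 := by
      rw [← intervalIntegral.integral_comp_neg]
      refine intervalIntegral.integral_congr fun z hz => ?_
      rw [uIcc_of_le (by linarith)] at hz
      have : 0 < z := by linarith [hz.1]
      simp only [abs_neg]
      rw [Real.sign_of_neg (by linarith : -z < 0), sub_neg_eq_add]
    have s4 : (∫ z in (ρ / 4)..(ρ / 2), |z| * |v z - Real.sign z| ^ 2)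
        = ∫ z in (ρ / 4)..(ρ / 2), |z| * |v z - 1| ^ 2 := by
      refine intervalIntegral.integral_congr fun z hz => ?_
      rw [uIcc_of_le (by linarith)] at hz
      have : 0 < z := by linarith [hz.1]
      simp only [Real.sign_of_pos this]
    have c1 : ContinuousOn (fun z => |z| * |v (-z) + 1| ^ 2) (Icc (ρ / 4) (ρ / 2)) := by
      have h2 : ContinuousOn (fun z => v (-z)) (Icc (ρ / 4) (ρ / 2)) :=
        hvc.comp continuousOn_neg hneg
      fun_prop
    have c2 : ContinuousOn (fun z => |z| * |v z - 1| ^ 2) (Icc (ρ / 4) (ρ / 2)) := by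
      have h1 := hvc.mono hsub
      fun_prop
    have s5 : ρ / 4 * (ρ / 4 * f a) ≤ ∫ z in (ρ / 4)..(ρ / 2),
        (|z| * |v (-z) + 1| ^ 2 + |z| * |v z - 1| ^ 2) := by
      have hle : ∫ _z in (ρ / 4)..(ρ / 2), ρ / 4 * f a ≤ ∫ z in (ρ / 4)..(ρ / 2),
          (|z| * |v (-z) + 1| ^ 2 + |z| * |v z - 1| ^ 2) := by
        refine intervalIntegral.integral_mono_on (by linarith) (by simp)
          ((c1.add c2).intervalIntegrable_of_Icc (by linarith)) fun z hz => ?_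
        have h3 : f a ≤ f z := hmin hz
        have h4 : 0 ≤ f z := by positivity
        rw [sq_abs, sq_abs, abs_of_pos (by linarith [hz.1] : 0 < z)]
        calc ρ / 4 * f a ≤ ρ / 4 * f z := by gcongr
          _ ≤ z * f z := by gcongr; exact hz.1
          _ = _ := by simp only [hf]; ring
      rw [intervalIntegral.integral_const, smul_eq_mul] at hle
      calc ρ / 4 * (ρ / 4 * f a) = (ρ / 2 - ρ / 4) * (ρ / 4 * f a) := by ring
        _ ≤ _ := hle
    rw [intervalIntegral.integral_add (c1.intervalIntegrable_of_Icc (by linarith))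
      (c2.intervalIntegrable_of_Icc (by linarith))] at s5
    have s6 : ρ / 4 * (ρ / 4 * f a)
        ≤ ∫ z in (-(ρ / 2))..(ρ / 2), |z| * |v z - Real.sign z| ^ 2 := by
      rw [s1, s3, s4]; linarith
    calc f a = 16 / ρ ^ 2 * (ρ / 4 * (ρ / 4 * f a)) := by field_simp; ring
      _ ≤ _ := by gcongr
  -- the energy inside `[-a, a]`
  have hra : a ≤ r := ha.2.trans hr
  have ha0 : 0 < a := by linarith [ha.1]
  have hFc := hF.smooth.continuous
  have hf1c := hF.continuous_f1
  have hftc := hF.continuous_f1Trunc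
  have cS : ContinuousOn (fun z => (ε * v' z - f1 F (v z)) ^ 2 / (4 * ε)) (Icc (-r) r) := by
    have := hf1c.comp_continuousOn hvc
    simp only [Function.comp_def] at this
    fun_prop
  have cW : ContinuousOn (fun z => ε / 2 * v' z ^ 2 + 1 / ε * F (v z)) (Icc (-r) r) := by
    have := hFc.comp_continuousOn hvc
    simp only [Function.comp_def] at this
    fun_prop
  have cD : ContinuousOn (fun z => v' z * f1Trunc F (v z)) (Icc (-r) r) := by
    have := hftc.comp_continuousOn hvc
    simp only [Function.comp_def] at this
    fun_prop
  have mr : -r ∈ Icc (-r) r := by constructor <;> linarith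
  have mr' : r ∈ Icc (-r) r := by constructor <;> linarith
  have ma : -a ∈ Icc (-r) r := by constructor <;> linarith
  have ma' : a ∈ Icc (-r) r := by constructor <;> linarith
  have ii : ∀ {h : ℝ → ℝ}, ContinuousOn h (Icc (-r) r) → ∀ {x y}, x ∈ Icc (-r) r →
      y ∈ Icc (-r) r → IntervalIntegrable h volume x y :=
    fun hh x y hx hy => (hh.mono (uIcc_subset_Icc hx hy)).intervalIntegrable
  -- The cross term is an exact derivative, so it depends only on the end values of `v`, and
  -- `c0_sub_le` applies whether or not `v` is monotone.
  have hsubst : ∫ z in (-a)..a, v' z * f1Trunc F (v z)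
      = ∫ u in (v (-a))..(v a), f1Trunc F u := by
    have := intervalIntegral.integral_comp_mul_deriv (a := -a) (b := a) (f := v) (f' := v')
      (g := f1Trunc F) (fun z hz => hv z (uIcc_subset_Icc ma ma' hz))
      (hv'.mono (uIcc_subset_Icc ma ma')) hftc
    rw [← this]
    refine intervalIntegral.integral_congr fun z _ => ?_
    simp [mul_comm]
  have split : ∀ {h : ℝ → ℝ}, ContinuousOn h (Icc (-r) r) →
      ∫ z in (-r)..r, h z = (∫ z in (-r)..(-a), h z) + (∫ z in (-a)..a, h z)
        + ∫ z in a..r, h z := by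
    intro h hh
    rw [intervalIntegral.integral_add_adjacent_intervals (ii hh mr ma) (ii hh ma ma'),
        intervalIntegral.integral_add_adjacent_intervals (ii hh mr ma') (ii hh ma' mr')]
  have i1 : ∫ z in (-r)..(-a), (ε * v' z - f1 F (v z)) ^ 2 / (4 * ε)
      ≤ ∫ z in (-r)..(-a), (ε / 2 * v' z ^ 2 + 1 / ε * F (v z)) :=
    intervalIntegral.integral_mono_on (by linarith) (ii cS mr ma) (ii cW mr ma)
      fun z _ => hF.square_le' hε _ _
  have i3 : ∫ z in a..r, (ε * v' z - f1 F (v z)) ^ 2 / (4 * ε)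
      ≤ ∫ z in a..r, (ε / 2 * v' z ^ 2 + 1 / ε * F (v z)) :=
    intervalIntegral.integral_mono_on (by linarith) (ii cS ma' mr') (ii cW ma' mr')
      fun z _ => hF.square_le' hε _ _
  have i2 : (∫ z in (-a)..a, (ε * v' z - f1 F (v z)) ^ 2 / (4 * ε))
      + ∫ z in (-a)..a, v' z * f1Trunc F (v z)
      ≤ ∫ z in (-a)..a, (ε / 2 * v' z ^ 2 + 1 / ε * F (v z)) := by
    rw [← intervalIntegral.integral_add (ii cS ma ma') (ii cD ma ma')]
    exact intervalIntegral.integral_mono_on (by linarith)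
      ((ii cS ma ma').add (ii cD ma ma')) (ii cW ma ma') fun z _ => hF.square_le hε _ _
  have hl := hLc (v (-a)) (v a)
  have hl2 : L * ((v a - 1) ^ 2 + (v (-a) + 1) ^ 2) ≤ L * (16 / ρ ^ 2 *
      ∫ z in (-(ρ / 2))..(ρ / 2), |z| * |v z - Real.sign z| ^ 2) :=
    mul_le_mul_of_nonneg_left hfa hL
  rw [split cS, split cW]
  rw [hsubst] at i2
  linarith

end DoubleWell

/-! ### A regularized squared distance to the well at `1` -/

theorem hasDerivAt_mul_abs_self (x : ℝ) : HasDerivAt (fun x : ℝ => x * |x|) (2 * |x|) x := by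
  rcases lt_trichotomy x 0 with h | h | h
  · have := (hasDerivAt_id x).mul (hasDerivAt_abs_neg h)
    convert! this using 1
    rw [abs_of_neg h]; simp; ring
  · subst h
    rw [hasDerivAt_iff_isLittleO_nhds_zero]
    simp only [zero_add, abs_zero, mul_zero, sub_zero, smul_zero]
    have : (fun h : ℝ => h * |h|) =O[nhds 0] fun h => h ^ 2 :=
      Asymptotics.isBigO_of_le _ fun h => by simp [sq]
    exact this.trans_isLittleO (by
      simpa using Asymptotics.isLittleO_pow_pow (𝕜 := ℝ) (m := 1) (n := 2) (by norm_num))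
  · have := (hasDerivAt_id x).mul (hasDerivAt_abs_pos h)
    convert! this using 1
    rw [abs_of_pos h]; simp; ring

/-- A `C¹` function comparable to `(v - 1)²` with a critical point at `-1`. -/
def wellDist (v : ℝ) : ℝ := 1 / 2 - v + v * |v| / 2 + ((v + 1) ^ 2 - (v + 1) * |v + 1|) / 2

/-- The derivative of `wellDist`. -/
def wellDistDeriv (v : ℝ) : ℝ := -1 + |v| + (v + 1) - |v + 1|

theorem hasDerivAt_wellDist (v : ℝ) : HasDerivAt wellDist (wellDistDeriv v) v := by
  have h1 := hasDerivAt_mul_abs_self v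
  have h2 : HasDerivAt (fun v : ℝ => (v + 1) * |v + 1|) (2 * |v + 1|) v := by
    simpa using (hasDerivAt_mul_abs_self (v + 1)).comp_add_const v 1
  have h3 : HasDerivAt (fun v : ℝ => (v + 1) ^ 2) (2 * (v + 1)) v := by
    simpa using ((hasDerivAt_id v).add_const (1 : ℝ)).fun_pow 2
  have := (((hasDerivAt_id v).const_sub (1 / 2)).add (h1.div_const 2)).add
    ((h3.sub h2).div_const 2)
  convert! this using 1
  unfold wellDistDeriv; ring

/-- This identity is why `wellDist` is used in place of `(v - 1)²`: the derivative vanishes at both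
wells, and its square is controlled by `F` through the lower bound on the potential. -/
theorem wellDistDeriv_sq (v : ℝ) : wellDistDeriv v ^ 2 = (1 - |v|) ^ 2 := by
  unfold wellDistDeriv
  rcases le_total 0 (v + 1) with h | h
  · rw [abs_of_nonneg h]; ring
  · rw [abs_of_nonpos h, abs_of_nonpos (by linarith : v ≤ 0)]; ring

theorem continuous_wellDistDeriv : Continuous wellDistDeriv := by
  unfold wellDistDeriv; fun_prop

theorem continuous_wellDist : Continuous wellDist := by
  unfold wellDist; fun_prop

theorem le_wellDist (v : ℝ) : 1 / 8 * (v - 1) ^ 2 ≤ wellDist v := by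
  unfold wellDist
  rcases le_total 0 v with h | h
  · rw [abs_of_nonneg h, abs_of_nonneg (by linarith : 0 ≤ v + 1)]; nlinarith [sq_nonneg (v - 1)]
  · rw [abs_of_nonpos h]
    rcases le_total 0 (v + 1) with h' | h'
    · rw [abs_of_nonneg h']; nlinarith
    · rw [abs_of_nonpos h']; nlinarith [sq_nonneg (v + 2), sq_nonneg (v + 1)]

theorem wellDist_le (v : ℝ) : wellDist v ≤ (v - 1) ^ 2 := by
  unfold wellDist
  rcases le_total 0 v with h | h
  · rw [abs_of_nonneg h, abs_of_nonneg (by linarith : 0 ≤ v + 1)]; nlinarith [sq_nonneg (v - 1)]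
  · rw [abs_of_nonpos h]
    rcases le_total 0 (v + 1) with h' | h'
    · rw [abs_of_nonneg h']; nlinarith
    · rw [abs_of_nonpos h']; nlinarith [sq_nonneg (v + 2), sq_nonneg (v + 1)]

/-- The weighted regularized squared distance of `v` to `sign z`. -/
def signDist (z v : ℝ) : ℝ := max z 0 * wellDist v + max (-z) 0 * wellDist (-v)

theorem continuous_signDist : Continuous fun p : ℝ × ℝ => signDist p.1 p.2 := by
  have := continuous_wellDist
  unfold signDist; fun_prop

theorem le_signDist (z v : ℝ) : 1 / 8 * (|z| * |v - Real.sign z| ^ 2) ≤ signDist z v := by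
  unfold signDist
  rw [sq_abs]
  rcases lt_trichotomy z 0 with h | h | h
  · rw [Real.sign_of_neg h, abs_of_neg h, max_eq_right h.le, max_eq_left (by linarith)]
    nlinarith [le_wellDist (-v)]
  · simp [h]
  · rw [Real.sign_of_pos h, abs_of_pos h, max_eq_right (by linarith : -z ≤ 0), max_eq_left h.le]
    nlinarith [le_wellDist v]

theorem signDist_le (z v : ℝ) : signDist z v ≤ |z| * |v - Real.sign z| ^ 2 := by
  unfold signDist
  rw [sq_abs]
  rcases lt_trichotomy z 0 with h | h | h
  · rw [Real.sign_of_neg h, abs_of_neg h, max_eq_right h.le, max_eq_left (by linarith)]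
    nlinarith [wellDist_le (-v)]
  · simp [h]
  · rw [Real.sign_of_pos h, abs_of_pos h, max_eq_right (by linarith : -z ≤ 0), max_eq_left h.le]
    nlinarith [wellDist_le v]

/-- The derivative of `signDist` in its second variable. -/
def signDistDeriv (z v : ℝ) : ℝ :=
  max z 0 * wellDistDeriv v - max (-z) 0 * wellDistDeriv (-v)

theorem hasDerivAt_signDist (z v : ℝ) : HasDerivAt (signDist z) (signDistDeriv z v) v := by
  have h1 := (hasDerivAt_wellDist v).const_mul (max z 0)
  have h2 := ((hasDerivAt_wellDist (-v)).comp v (hasDerivAt_neg v)).const_mul (max (-z) 0)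
  convert! h1.add h2 using 1
  unfold signDistDeriv; ring

theorem continuous_signDistDeriv : Continuous fun p : ℝ × ℝ => signDistDeriv p.1 p.2 := by
  have := continuous_wellDistDeriv
  unfold signDistDeriv; fun_prop

theorem signDistDeriv_sq (z v : ℝ) : signDistDeriv z v ^ 2 = z ^ 2 * (1 - |v|) ^ 2 := by
  unfold signDistDeriv
  rcases le_total 0 z with h | h
  · rw [max_eq_left h, max_eq_right (by linarith), zero_mul, sub_zero, mul_pow, wellDistDeriv_sq]
  · rw [max_eq_right h, max_eq_left (by linarith), zero_mul, zero_sub, neg_sq, mul_pow,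
      wellDistDeriv_sq, abs_neg, neg_sq]

/-! ### Grönwall's inequality in integral form -/

/-- The right-hand side `H = a + b ∫ N` has right derivative `b N ≤ b H`, so the differential form
of Grönwall's inequality applies to `H`, and `N ≤ H`. No sign of `a` or `N` is needed. -/
theorem le_mul_exp_of_le_add_integral {N : ℝ → ℝ} {a b S : ℝ} (hb : 0 ≤ b)
    (hN : ContinuousOn N (Icc 0 S))
    (h : ∀ s ∈ Icc 0 S, N s ≤ a + b * ∫ t in (0 : ℝ)..s, N t) :
    ∀ s ∈ Icc 0 S, N s ≤ a * Real.exp (b * s) := by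
  intro s hs
  have hii : ∀ t ∈ Icc 0 S, IntervalIntegrable N volume 0 t := fun t ht =>
    (hN.mono (uIcc_subset_Icc ⟨le_rfl, ht.1.trans ht.2⟩ ht)).intervalIntegrable
  have hS : 0 ≤ S := hs.1.trans hs.2
  have hder : ∀ x ∈ Ico 0 S, HasDerivWithinAt (fun s => a + b * ∫ t in (0 : ℝ)..s, N t)
      (b * N x) (Ici x) x := by
    intro x hx
    have hx' : x ∈ Icc 0 S := ⟨hx.1, hx.2.le⟩
    have hcw : ContinuousWithinAt N (Ioi x) x :=
      ((hN x hx').mono_of_mem_nhdsWithin (Filter.mem_of_superset (Ico_mem_nhdsGE hx.2)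
        (fun y hy => ⟨hx.1.trans hy.1, hy.2.le⟩) : Icc 0 S ∈ nhdsWithin x (Ici x))).mono Ioi_subset_Ici_self
    have hm : StronglyMeasurableAtFilter N (nhdsWithin x (Ioi x)) :=
      ⟨Ioo x S, Ioo_mem_nhdsGT hx.2,
        ((hN.mono fun y hy => ⟨hx.1.trans hy.1.le, hy.2.le⟩).aestronglyMeasurable
          measurableSet_Ioo)⟩
    have := intervalIntegral.integral_hasDerivWithinAt_right (s := Ici x) (t := Ioi x)
      (hii x hx') hm hcw
    exact (this.const_mul b).const_add a
  have hc : ContinuousOn (fun s => a + b * ∫ t in (0 : ℝ)..s, N t) (Icc 0 S) := by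
    have h3 : IntegrableOn N (uIcc 0 S) := by
      rw [uIcc_of_le hS]; exact hN.integrableOn_Icc
    have := intervalIntegral.continuousOn_primitive_interval h3
    rw [uIcc_of_le hS] at this
    fun_prop
  have key := le_gronwallBound_of_liminf_deriv_right_le (δ := a) (K := b) (ε := 0) hc
    (fun x hx r hr => (hder x hx).liminf_right_slope_le hr) (by simp)
    (fun x hx => by
      rw [add_zero]
      exact mul_le_mul_of_nonneg_left (h x ⟨hx.1, hx.2.le⟩) hb) s hs
  rw [gronwallBound_ε0, sub_zero] at key
  exact (h s hs).trans key

/-! ### Coordinates on `ℝ × M × ℝ` -/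

section CoordPoint

variable {m : ℕ}

/-- The coordinate vector with time `t`, middle part `x` and normal coordinate `z`. -/
def coordPoint (t : ℝ) (x : EuclideanSpace ℝ (Fin m)) (z : ℝ) : Fin (m + 2) → ℝ :=
  Fin.snoc (α := fun _ => ℝ) (Fin.cons (α := fun _ => ℝ) t fun i => x i) z

@[simp] theorem coordPoint_last (t : ℝ) (x : EuclideanSpace ℝ (Fin m)) (z : ℝ) :
    coordPoint t x z (Fin.last (m + 1)) = z := by simp [coordPoint]

@[simp] theorem coordPoint_zero (t : ℝ) (x : EuclideanSpace ℝ (Fin m)) (z : ℝ) :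
    coordPoint t x z 0 = t := by
  rw [← Fin.castSucc_zero, coordPoint, Fin.snoc_castSucc, Fin.cons_zero]

theorem coordPoint_succ (t : ℝ) (x : EuclideanSpace ℝ (Fin m)) (z : ℝ) (i : Fin m) :
    coordPoint t x z i.succ.castSucc = x i := by
  rw [coordPoint, Fin.snoc_castSucc, Fin.cons_succ]

@[simp] theorem coordPoint_castSucc_succ (t : ℝ) (x : EuclideanSpace ℝ (Fin m)) (z : ℝ)
    (i : Fin m) : coordPoint t x z i.castSucc.succ = x i :=
  coordPoint_succ t x z i

@[simp] theorem middle_coordPoint (t : ℝ) (x : EuclideanSpace ℝ (Fin m)) (z : ℝ) :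
    middle (coordPoint t x z) = x := by
  ext i; simp [middle]

/-- Splits an index into the time, `M` and normal cases, which is how all identities between
coordinate vectors are checked. -/
theorem index_cases {P : Fin (m + 2) → Prop} (h0 : P 0) (hi : ∀ i : Fin m, P i.succ.castSucc)
    (hl : P (Fin.last (m + 1))) (α : Fin (m + 2)) : P α := by
  refine Fin.lastCases hl (fun a => ?_) α
  refine Fin.cases ?_ hi a
  simpa using h0

@[simp] theorem coordPoint_eta (y : Fin (m + 2) → ℝ) :
    coordPoint (y 0) (middle y) (y (Fin.last (m + 1))) = y := by
  funext α
  refine index_cases (P := fun α => coordPoint (y 0) (middle y) (y (Fin.last (m + 1))) α = y α)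
    ?_ (fun i => ?_) ?_ α <;> simp [middle]

theorem contDiff_coordPoint {n : ℕ∞ω} : ContDiff ℝ n
    fun p : ℝ × EuclideanSpace ℝ (Fin m) × ℝ => coordPoint p.1 p.2.1 p.2.2 := by
  rw [contDiff_pi]
  refine index_cases ?_ (fun i => ?_) ?_
  · simpa using contDiff_fst
  · simp only [coordPoint_succ]; fun_prop
  · simp only [coordPoint_last]; fun_prop

theorem continuous_coordPoint :
    Continuous fun p : ℝ × EuclideanSpace ℝ (Fin m) × ℝ => coordPoint p.1 p.2.1 p.2.2 :=
  (contDiff_coordPoint (n := 0)).continuous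

theorem contDiff_middle {n : ℕ∞ω} : ContDiff ℝ n (middle (m := m)) := by
  unfold middle
  exact (PiLp.contDiff_toLp).comp (contDiff_pi.2 fun i => contDiff_apply _ _ _)

theorem continuous_middle : Continuous (middle (m := m)) := (contDiff_middle (n := 0)).continuous

theorem coordPoint_add_time (t h : ℝ) (x : EuclideanSpace ℝ (Fin m)) (z : ℝ) :
    coordPoint (t + h) x z = coordPoint t x z + h • Pi.single 0 1 := by
  funext α
  refine index_cases (P := fun α => coordPoint (t + h) x z α
    = (coordPoint t x z + h • (Pi.single 0 1 : Fin (m + 2) → ℝ)) α) ?_ (fun i => ?_) ?_ α <;>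
    simp [Fin.ext_iff]

theorem coordPoint_add_normal (t : ℝ) (x : EuclideanSpace ℝ (Fin m)) (z h : ℝ) :
    coordPoint t x (z + h) = coordPoint t x z + h • Pi.single (Fin.last (m + 1)) 1 := by
  funext α
  refine index_cases (P := fun α => coordPoint t x (z + h) α
    = (coordPoint t x z + h • (Pi.single (Fin.last (m + 1)) 1 : Fin (m + 2) → ℝ)) α) ?_ (fun i => ?_) ?_ α <;>
    simp [Pi.single_apply, Fin.ext_iff]
  omega

theorem coordPoint_add_middle (t : ℝ) (x : EuclideanSpace ℝ (Fin m)) (z h : ℝ) (j : Fin m) :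
    coordPoint t (x + h • EuclideanSpace.single j 1) z
      = coordPoint t x z + h • Pi.single j.succ.castSucc 1 := by
  funext α
  refine index_cases (P := fun α => coordPoint t (x + h • EuclideanSpace.single j 1) z α
    = (coordPoint t x z + h • (Pi.single j.succ.castSucc 1 : Fin (m + 2) → ℝ)) α) ?_ (fun i => ?_) ?_ α <;>
    simp [Pi.single_apply, Fin.ext_iff]
  omega

theorem hasDerivAt_comp_line {f : (Fin (m + 2) → ℝ) → ℝ} {y : Fin (m + 2) → ℝ}
    (hf : DifferentiableAt ℝ f y) (α : Fin (m + 2)) :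
    HasDerivAt (fun h : ℝ => f (y + h • Pi.single α 1)) (pd α f y) 0 := by
  have h1 : HasDerivAt (fun h : ℝ => y + h • (Pi.single α 1 : Fin (m + 2) → ℝ))
      (Pi.single α 1) 0 := by
    simpa using ((hasDerivAt_id (0 : ℝ)).smul_const (Pi.single α 1 : Fin (m + 2) → ℝ)).const_add y
  have h2 : HasFDerivAt f (fderiv ℝ f y) (y + (0 : ℝ) • Pi.single α 1) := by
    simpa using hf.hasFDerivAt
  exact h2.comp_hasDerivAt 0 h1

theorem hasDerivAt_time {f : (Fin (m + 2) → ℝ) → ℝ} {t : ℝ} {x : EuclideanSpace ℝ (Fin m)} {z : ℝ}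
    (hf : DifferentiableAt ℝ f (coordPoint t x z)) :
    HasDerivAt (fun t => f (coordPoint t x z)) (pd 0 f (coordPoint t x z)) t := by
  have h := hasDerivAt_comp_line hf 0
  simp_rw [← coordPoint_add_time] at h
  rw [← sub_self t] at h
  simpa using h.comp_sub_const t t

theorem hasDerivAt_normal {f : (Fin (m + 2) → ℝ) → ℝ} {t : ℝ} {x : EuclideanSpace ℝ (Fin m)}
    {z : ℝ} (hf : DifferentiableAt ℝ f (coordPoint t x z)) :
    HasDerivAt (fun z => f (coordPoint t x z)) (pd (Fin.last (m + 1)) f (coordPoint t x z)) z := by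
  have h := hasDerivAt_comp_line hf (Fin.last (m + 1))
  simp_rw [← coordPoint_add_normal] at h
  rw [← sub_self z] at h
  simpa using h.comp_sub_const z z

theorem fderiv_middle_single {f : (Fin (m + 2) → ℝ) → ℝ} {t : ℝ} {x : EuclideanSpace ℝ (Fin m)}
    {z : ℝ} (hf : DifferentiableAt ℝ f (coordPoint t x z)) (j : Fin m) :
    fderiv ℝ (fun x => f (coordPoint t x z)) x (EuclideanSpace.single j 1)
      = pd j.succ.castSucc f (coordPoint t x z) := by
  have hd : DifferentiableAt ℝ (fun x => f (coordPoint t x z)) x := by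
    refine DifferentiableAt.comp (g := f) (f := fun x => coordPoint t x z) x hf ?_
    have := (contDiff_coordPoint (m := m) (n := 1)).differentiable (by norm_num)
    exact (this.comp (g := fun p : ℝ × EuclideanSpace ℝ (Fin m) × ℝ => coordPoint p.1 p.2.1 p.2.2)
      (f := fun x => (t, x, z)) (by fun_prop)) x
  have h1 := hasDerivAt_comp_line hf j.succ.castSucc
  simp_rw [← coordPoint_add_middle] at h1
  have h2 : HasDerivAt (fun h : ℝ => x + h • (EuclideanSpace.single j 1 : EuclideanSpace ℝ (Fin m)))
      (EuclideanSpace.single j 1) 0 := by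
    simpa using ((hasDerivAt_id (0 : ℝ)).smul_const
      (EuclideanSpace.single j 1 : EuclideanSpace ℝ (Fin m))).const_add x
  have h3 : HasFDerivAt (fun x => f (coordPoint t x z)) (fderiv ℝ (fun x => f (coordPoint t x z)) x)
      (x + (0 : ℝ) • EuclideanSpace.single j 1) := by simpa using hd.hasFDerivAt
  have h4 := h3.comp_hasDerivAt 0 h2
  exact h4.unique h1

variable {M : Type*} [TopologicalSpace M]

@[simp] theorem coordMap_coordPoint (e : Chart m M) (t : ℝ) (x : EuclideanSpace ℝ (Fin m)) (z : ℝ) :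
    coordMap e (coordPoint t x z) = (t, e.symm x, z) := by simp [coordMap]

theorem coords_eq (e : Chart m M) (p : ℝ × M × ℝ) :
    coords e p = coordPoint p.1 (e p.2.1) p.2.2 := rfl

theorem coordPoint_mem_coordDomain {e : Chart m M} {T r t : ℝ} {x : EuclideanSpace ℝ (Fin m)}
    {z : ℝ} : coordPoint t x z ∈ coordDomain e T r
      ↔ t ∈ Ioo (-T) T ∧ x ∈ e.target ∧ z ∈ Ioo (-r) r := by simp [coordDomain]

theorem isOpen_coordDomain (e : Chart m M) (T r : ℝ) : IsOpen (coordDomain e T r) :=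
  (isOpen_Ioo.preimage (continuous_apply 0)).inter
    ((e.open_target.preimage continuous_middle).inter
      (isOpen_Ioo.preimage (continuous_apply (Fin.last (m + 1)))))

theorem coordMap_coords {e : Chart m M} {p : ℝ × M × ℝ} (hp : p.2.1 ∈ e.source) :
    coordMap e (coords e p) = p := by
  simp [coords_eq, e.left_inv hp]

theorem coords_coordMap {e : Chart m M} {y : Fin (m + 2) → ℝ} (hy : middle y ∈ e.target) :
    coords e (coordMap e y) = y := by
  simp [coords_eq, coordMap, e.right_inv hy]

theorem coordMap_mem_slab {e : Chart m M} {T r : ℝ} {y : Fin (m + 2) → ℝ}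
    (hy : y ∈ coordDomain e T r) : coordMap e y ∈ slab M T r :=
  ⟨hy.1, mem_univ _, hy.2.2⟩

theorem coords_mem_coordDomain {e : Chart m M} {T r : ℝ} {p : ℝ × M × ℝ} (hp : p ∈ slab M T r)
    (he : p.2.1 ∈ e.source) : coords e p ∈ coordDomain e T r := by
  rw [coords_eq, coordPoint_mem_coordDomain]
  exact ⟨hp.1, e.map_source he, hp.2.2⟩

theorem middle_single_last : middle (m := m) (Pi.single (Fin.last (m + 1)) 1) = 0 := by
  ext i; simp [middle, Pi.single_apply, Fin.ext_iff]; omega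

end CoordPoint

/-! ### Smoothness of the coordinates and changes of coordinates -/

section Smooth

variable {m : ℕ} {M : Type*} [TopologicalSpace M]

theorem contMDiffOn_coordMap [ChartedSpace (EuclideanSpace ℝ (Fin m)) M] [IsManifold (𝓡 m) ∞ M] {e : Chart m M}
    (he : e ∈ IsManifold.maximalAtlas (𝓡 m) ∞ M) :
    ContMDiffOn 𝓘(ℝ, Fin (m + 2) → ℝ) (model m) ∞ (coordMap e) {y | middle y ∈ e.target} := by
  unfold coordMap
  refine ContMDiffOn.prodMk ?_ (ContMDiffOn.prodMk ?_ ?_)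
  · exact (contDiff_apply ℝ ℝ (0 : Fin (m + 2))).contMDiff.contMDiffOn
  · exact (contMDiffOn_symm_of_mem_maximalAtlas he).comp
      (contDiff_middle.contMDiff.contMDiffOn) fun y hy => hy
  · exact (contDiff_apply ℝ ℝ (Fin.last (m + 1))).contMDiff.contMDiffOn

theorem contMDiffOn_coords [ChartedSpace (EuclideanSpace ℝ (Fin m)) M] [IsManifold (𝓡 m) ∞ M] {e : Chart m M}
    (he : e ∈ IsManifold.maximalAtlas (𝓡 m) ∞ M) :
    ContMDiffOn (model m) 𝓘(ℝ, Fin (m + 2) → ℝ) ∞ (coords e)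
      {p : ℝ × M × ℝ | p.2.1 ∈ e.source} := by
  have h1 : ContMDiffOn (model m) 𝓘(ℝ, ℝ × EuclideanSpace ℝ (Fin m) × ℝ) ∞
      (fun p : ℝ × M × ℝ => (p.1, e p.2.1, p.2.2)) {p : ℝ × M × ℝ | p.2.1 ∈ e.source} := by
    refine ContMDiffOn.prodMk_space contMDiff_fst.contMDiffOn
      (ContMDiffOn.prodMk_space ?_ (contMDiff_snd.comp contMDiff_snd).contMDiffOn)
    exact (contMDiffOn_of_mem_maximalAtlas he).comp
      (contMDiff_fst.comp contMDiff_snd).contMDiffOn fun p hp => hp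
  exact (contDiff_coordPoint (m := m) (n := ∞)).contMDiff.comp_contMDiffOn h1

theorem isOpen_middle_target (e : Chart m M) : IsOpen {y | middle y ∈ e.target} :=
  e.open_target.preimage continuous_middle

theorem isOpen_source (e : Chart m M) : IsOpen {p : ℝ × M × ℝ | p.2.1 ∈ e.source} :=
  e.open_source.preimage (continuous_fst.comp continuous_snd)

theorem contDiffOn_comp_coordMap [ChartedSpace (EuclideanSpace ℝ (Fin m)) M] [IsManifold (𝓡 m) ∞ M] {e : Chart m M}
    (he : e ∈ IsManifold.maximalAtlas (𝓡 m) ∞ M) {v : ℝ × M × ℝ → ℝ} {T r : ℝ}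
    (hv : ContMDiffOn (model m) 𝓘(ℝ, ℝ) ∞ v (slab M T r)) :
    ContDiffOn ℝ ∞ (v ∘ coordMap e) (coordDomain e T r) := by
  rw [← contMDiffOn_iff_contDiffOn]
  exact hv.comp ((contMDiffOn_coordMap he).mono fun y hy => hy.2.1)
    fun y hy => coordMap_mem_slab hy

theorem mdifferentiableAt_coordMap [ChartedSpace (EuclideanSpace ℝ (Fin m)) M] [IsManifold (𝓡 m) ∞ M] {e : Chart m M}
    (he : e ∈ IsManifold.maximalAtlas (𝓡 m) ∞ M) {y : Fin (m + 2) → ℝ} (hy : middle y ∈ e.target) :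
    MDifferentiableAt 𝓘(ℝ, Fin (m + 2) → ℝ) (model m) (coordMap e) y :=
  ((contMDiffOn_coordMap he).contMDiffAt ((isOpen_middle_target e).mem_nhds hy)).mdifferentiableAt
    (by simp)

theorem mdifferentiableAt_coords [ChartedSpace (EuclideanSpace ℝ (Fin m)) M] [IsManifold (𝓡 m) ∞ M] {e : Chart m M}
    (he : e ∈ IsManifold.maximalAtlas (𝓡 m) ∞ M) {p : ℝ × M × ℝ} (hp : p.2.1 ∈ e.source) :
    MDifferentiableAt (model m) 𝓘(ℝ, Fin (m + 2) → ℝ) (coords e) p :=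
  ((contMDiffOn_coords he).contMDiffAt ((isOpen_source e).mem_nhds hp)).mdifferentiableAt
    (by simp)

/-- The change of coordinates from `e` to `e'`. -/
def transition (e e' : Chart m M) (y : Fin (m + 2) → ℝ) : Fin (m + 2) → ℝ :=
  coords e' (coordMap e y)

theorem transition_eq (e e' : Chart m M) (y : Fin (m + 2) → ℝ) :
    transition e e' y
      = coordPoint (y 0) (e' (e.symm (middle y))) (y (Fin.last (m + 1))) := rfl

/-- The points at which the change of coordinates is defined. -/
def overlap (e e' : Chart m M) : Set (Fin (m + 2) → ℝ) :=
  {y | middle y ∈ e.target ∧ e.symm (middle y) ∈ e'.source}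

theorem isOpen_overlap (e e' : Chart m M) : IsOpen (overlap e e') := by
  have := e.symm.isOpen_inter_preimage e'.open_source
  exact this.preimage continuous_middle

theorem coordMap_transition {e e' : Chart m M} {y : Fin (m + 2) → ℝ} (hy : y ∈ overlap e e') :
    coordMap e' (transition e e' y) = coordMap e y :=
  coordMap_coords (p := coordMap e y) hy.2

theorem differentiableAt_transition [ChartedSpace (EuclideanSpace ℝ (Fin m)) M] [IsManifold (𝓡 m) ∞ M] {e e' : Chart m M}
    (he : e ∈ IsManifold.maximalAtlas (𝓡 m) ∞ M) (he' : e' ∈ IsManifold.maximalAtlas (𝓡 m) ∞ M)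
    {y : Fin (m + 2) → ℝ} (hy : y ∈ overlap e e') : DifferentiableAt ℝ (transition e e') y := by
  rw [← mdifferentiableAt_iff_differentiableAt]
  exact (mdifferentiableAt_coords he' (p := coordMap e y) hy.2).comp y
    (mdifferentiableAt_coordMap he hy.1)

/-- The matrix of the derivative of the change of coordinates: `J β α = ∂ y'^β / ∂ y^α`. -/
def jacobian (e e' : Chart m M) (y : Fin (m + 2) → ℝ) : Matrix (Fin (m + 2)) (Fin (m + 2)) ℝ :=
  Matrix.of fun β α => fderiv ℝ (transition e e') y (Pi.single α 1) β

theorem fderiv_transition_single (e e' : Chart m M) (y : Fin (m + 2) → ℝ) (α : Fin (m + 2)) :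
    fderiv ℝ (transition e e') y (Pi.single α 1)
      = ∑ β, jacobian e e' y β α • (Pi.single β 1 : Fin (m + 2) → ℝ) := by
  conv_lhs => rw [← Finset.univ_sum_single (fderiv ℝ (transition e e') y (Pi.single α 1))]
  refine Finset.sum_congr rfl fun β _ => ?_
  rw [← Pi.single_smul']
  simp [jacobian]

/-- A change of chart on `M` fixes `y⁰` and `yⁿ` and acts on `y'` alone. The four lemmas on rows and
columns of the Jacobian record this block structure, which makes the splitting into time, tangential
and normal parts independent of the chart. -/
theorem jacobian_zero [ChartedSpace (EuclideanSpace ℝ (Fin m)) M] [IsManifold (𝓡 m) ∞ M] {e e' : Chart m M}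
    (he : e ∈ IsManifold.maximalAtlas (𝓡 m) ∞ M) (he' : e' ∈ IsManifold.maximalAtlas (𝓡 m) ∞ M)
    {y : Fin (m + 2) → ℝ} (hy : y ∈ overlap e e') (α : Fin (m + 2)) :
    jacobian e e' y 0 α = (Pi.single α 1 : Fin (m + 2) → ℝ) 0 := by
  have h := (hasFDerivAt_pi'.1 (differentiableAt_transition he he' hy).hasFDerivAt) 0
  have h2 : (fun y => transition e e' y 0) = fun y => y 0 := by
    funext y; rw [transition_eq, coordPoint_zero]
  rw [h2] at h
  have h3 := h.unique (hasFDerivAt_apply (0 : Fin (m + 2)) y)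
  exact congrArg (fun L => L (Pi.single α 1 : Fin (m + 2) → ℝ)) h3

theorem jacobian_last [ChartedSpace (EuclideanSpace ℝ (Fin m)) M] [IsManifold (𝓡 m) ∞ M] {e e' : Chart m M}
    (he : e ∈ IsManifold.maximalAtlas (𝓡 m) ∞ M) (he' : e' ∈ IsManifold.maximalAtlas (𝓡 m) ∞ M)
    {y : Fin (m + 2) → ℝ} (hy : y ∈ overlap e e') (α : Fin (m + 2)) :
    jacobian e e' y (Fin.last (m + 1)) α = (Pi.single α 1 : Fin (m + 2) → ℝ) (Fin.last (m + 1)) := by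
  have h := (hasFDerivAt_pi'.1 (differentiableAt_transition he he' hy).hasFDerivAt)
    (Fin.last (m + 1))
  have h2 : (fun y => transition e e' y (Fin.last (m + 1))) = fun y => y (Fin.last (m + 1)) := by
    funext y; rw [transition_eq, coordPoint_last]
  rw [h2] at h
  have h3 := h.unique (hasFDerivAt_apply (Fin.last (m + 1)) y)
  exact congrArg (fun L => L (Pi.single α 1 : Fin (m + 2) → ℝ)) h3

theorem jacobian_last' [ChartedSpace (EuclideanSpace ℝ (Fin m)) M] [IsManifold (𝓡 m) ∞ M] {e e' : Chart m M}
    (he : e ∈ IsManifold.maximalAtlas (𝓡 m) ∞ M) (he' : e' ∈ IsManifold.maximalAtlas (𝓡 m) ∞ M)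
    {y : Fin (m + 2) → ℝ} (hy : y ∈ overlap e e') (β : Fin (m + 2)) :
    jacobian e e' y β (Fin.last (m + 1)) = (Pi.single (Fin.last (m + 1)) 1 : Fin (m + 2) → ℝ) β := by
  have hd := differentiableAt_transition he he' hy
  have h1 : HasDerivAt (fun h : ℝ => y + h • (Pi.single (Fin.last (m + 1)) 1 : Fin (m + 2) → ℝ))
      (Pi.single (Fin.last (m + 1)) 1) 0 := by
    simpa using ((hasDerivAt_id (0 : ℝ)).smul_const
      (Pi.single (Fin.last (m + 1)) 1 : Fin (m + 2) → ℝ)).const_add y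
  have h2 : HasFDerivAt (transition e e') (fderiv ℝ (transition e e') y)
      (y + (0 : ℝ) • Pi.single (Fin.last (m + 1)) 1) := by simpa using hd.hasFDerivAt
  have h3 := h2.comp_hasDerivAt 0 h1
  -- The transition commutes with translations in `yⁿ`, so its derivative in that direction is read
  -- off from an affine function.
  have h4 : (transition e e' ∘ fun h : ℝ => y + h • Pi.single (Fin.last (m + 1)) 1)
      = fun h : ℝ => transition e e' y + h • Pi.single (Fin.last (m + 1)) 1 := by
    funext h
    conv_lhs => rw [Function.comp_apply, ← coordPoint_eta y, ← coordPoint_add_normal]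
    rw [transition_eq, transition_eq, ← coordPoint_add_normal]
    simp
  rw [h4] at h3
  have h5 : HasDerivAt (fun h : ℝ => transition e e' y
      + h • (Pi.single (Fin.last (m + 1)) 1 : Fin (m + 2) → ℝ))
      (Pi.single (Fin.last (m + 1)) 1) 0 := by
    simpa using ((hasDerivAt_id (0 : ℝ)).smul_const
      (Pi.single (Fin.last (m + 1)) 1 : Fin (m + 2) → ℝ)).const_add (transition e e' y)
  exact congrFun (h3.unique h5) β

theorem jacobian_zero' [ChartedSpace (EuclideanSpace ℝ (Fin m)) M] [IsManifold (𝓡 m) ∞ M] {e e' : Chart m M}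
    (he : e ∈ IsManifold.maximalAtlas (𝓡 m) ∞ M) (he' : e' ∈ IsManifold.maximalAtlas (𝓡 m) ∞ M)
    {y : Fin (m + 2) → ℝ} (hy : y ∈ overlap e e') (β : Fin (m + 2)) :
    jacobian e e' y β 0 = (Pi.single 0 1 : Fin (m + 2) → ℝ) β := by
  have hd := differentiableAt_transition he he' hy
  have h1 : HasDerivAt (fun h : ℝ => y + h • (Pi.single 0 1 : Fin (m + 2) → ℝ))
      (Pi.single 0 1) 0 := by
    simpa using ((hasDerivAt_id (0 : ℝ)).smul_const
      (Pi.single 0 1 : Fin (m + 2) → ℝ)).const_add y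
  have h2 : HasFDerivAt (transition e e') (fderiv ℝ (transition e e') y)
      (y + (0 : ℝ) • Pi.single 0 1) := by simpa using hd.hasFDerivAt
  have h3 := h2.comp_hasDerivAt 0 h1
  have h4 : (transition e e' ∘ fun h : ℝ => y + h • Pi.single 0 1)
      = fun h : ℝ => transition e e' y + h • Pi.single 0 1 := by
    funext h
    conv_lhs => rw [Function.comp_apply, ← coordPoint_eta y, ← coordPoint_add_time]
    rw [transition_eq, transition_eq, ← coordPoint_add_time]
    simp
  rw [h4] at h3
  have h5 : HasDerivAt (fun h : ℝ => transition e e' y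
      + h • (Pi.single 0 1 : Fin (m + 2) → ℝ))
      (Pi.single 0 1) 0 := by
    simpa using ((hasDerivAt_id (0 : ℝ)).smul_const
      (Pi.single 0 1 : Fin (m + 2) → ℝ)).const_add (transition e e' y)
  exact congrFun (h3.unique h5) β

end Smooth

/-! ### Linear algebra of Lorentzian matrices -/

section LinearAlgebra

open Matrix

variable {n : Type*} [Fintype n] [DecidableEq n]

/-- A symmetric matrix which is negative on a vector and positive definite on its orthogonal
complement has negative determinant. -/
theorem det_neg_of_lorentzian {L : Matrix n n ℝ} (hL : Lᵀ = L) {u : n → ℝ}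
    (hu : u ⬝ᵥ L *ᵥ u < 0) (h : ∀ w, u ⬝ᵥ L *ᵥ w = 0 → w ≠ 0 → 0 < w ⬝ᵥ L *ᵥ w) : L.det < 0 := by
  set b := u ⬝ᵥ L *ᵥ u with hb
  have hsymm : ∀ x y, x ⬝ᵥ L *ᵥ y = y ⬝ᵥ L *ᵥ x := fun x y => by
    rw [dotProduct_comm, ← vecMul_transpose, hL, dotProduct_mulVec]
  -- `R` is the reflection `x ↦ x - 2 ⟨u, x⟩/⟨u, u⟩ u` for the form `L`. It reverses the only
  -- negative direction, so `L R` is positive definite, while `det R = -1`.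
  set R : Matrix n n ℝ := 1 + replicateCol Unit (-(2 / b) • u) * replicateRow Unit (L *ᵥ u) with hR
  have hRdet : R.det = -1 := by
    rw [hR, det_one_add_replicateCol_mul_replicateRow, dotProduct_smul, dotProduct_comm, ← hb,
      smul_eq_mul]
    field_simp [hu.ne]; norm_num
  have hRv : ∀ x, R *ᵥ x = x - (2 / b * (u ⬝ᵥ L *ᵥ x)) • u := by
    intro x
    have h2 : (L *ᵥ u) ⬝ᵥ x = u ⬝ᵥ L *ᵥ x := by rw [dotProduct_comm, hsymm]
    rw [hR, add_mulVec, one_mulVec, ← mulVec_mulVec]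
    ext i
    simp only [Pi.add_apply, Pi.sub_apply, mulVec, dotProduct, replicateCol_apply,
      replicateRow_apply, Finset.univ_unique, Finset.sum_singleton, Pi.smul_apply, smul_eq_mul]
    simp only [dotProduct, mulVec] at h2
    rw [h2]; ring
  have hPv : ∀ x y, x ⬝ᵥ (L * R) *ᵥ y
      = x ⬝ᵥ L *ᵥ y - 2 / b * (u ⬝ᵥ L *ᵥ y) * (x ⬝ᵥ L *ᵥ u) := by
    intro x y
    rw [← mulVec_mulVec, hRv, mulVec_sub, mulVec_smul, dotProduct_sub, dotProduct_smul, smul_eq_mul]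
  have hP : (L * R).PosDef := by
    refine posDef_iff_dotProduct_mulVec.2 ⟨?_, fun x hx => ?_⟩
    · ext i j
      have h1 := hPv (Pi.single j 1) (Pi.single i 1)
      have h2 := hPv (Pi.single i 1) (Pi.single j 1)
      rw [hsymm (Pi.single j 1) (Pi.single i 1), hsymm (Pi.single j 1) u,
        hsymm u (Pi.single i 1)] at h1
      have h3 : (Pi.single j 1 : n → ℝ) ⬝ᵥ (L * R) *ᵥ Pi.single i 1
        = (Pi.single i 1 : n → ℝ) ⬝ᵥ (L * R) *ᵥ Pi.single j 1 := by rw [h1, h2]; ring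
      simpa using h3
    · simp only [star_trivial]
      rw [hPv]
      -- Splitting `x = w + s u` with `w` orthogonal to `u`, the form of `L R` at `x` becomes `⟨w,
      -- w⟩ - s² b`, and `b < 0`.
      set s := (u ⬝ᵥ L *ᵥ x) / b with hs
      have hsb : u ⬝ᵥ L *ᵥ x = s * b := by rw [hs]; field_simp [hu.ne]
      set w := x - s • u with hw
      have hxw : x = w + s • u := by rw [hw]; abel
      have huw : u ⬝ᵥ L *ᵥ w = 0 := by
        rw [hw, mulVec_sub, mulVec_smul, dotProduct_sub, dotProduct_smul, hsb, smul_eq_mul, ← hb,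
          sub_self]
      have hwu : w ⬝ᵥ L *ᵥ u = 0 := by rw [hsymm, huw]
      have hxx : x ⬝ᵥ L *ᵥ x = w ⬝ᵥ L *ᵥ w + s ^ 2 * b := by
        rw [hxw, mulVec_add, mulVec_smul, dotProduct_add, add_dotProduct, add_dotProduct,
          smul_dotProduct, smul_dotProduct, dotProduct_smul, dotProduct_smul, hwu, huw, ← hb]
        simp only [smul_eq_mul]; ring
      rw [hsymm x u, hxx, hsb]
      have e1 : w ⬝ᵥ L *ᵥ w + s ^ 2 * b - 2 / b * (s * b) * (s * b)
          = w ⬝ᵥ L *ᵥ w + s ^ 2 * (-b) := by field_simp [hu.ne]; ring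
      rw [e1]
      by_cases hw0 : w = 0
      · have hs0 : s ≠ 0 := by
          rintro h0
          apply hx
          rw [hxw, hw0, h0]; simp
        rw [hw0]
        have : 0 < s ^ 2 * (-b) := mul_pos (by positivity) (by linarith)
        simpa using this
      · have := h w huw hw0
        have : 0 ≤ s ^ 2 * (-b) := mul_nonneg (by positivity) (by linarith)
        linarith
  have := hP.det_pos
  rw [det_mul, hRdet] at this
  linarith

end LinearAlgebra

/-! ### Smooth dependence of determinants and inverse matrices -/

section MatrixSmooth

variable {X : Type*} [NormedAddCommGroup X] [NormedSpace ℝ X] {n : Type*} [Fintype n]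
  [DecidableEq n] {k : ℕ∞ω} {s : Set X} {A : X → Matrix n n ℝ}

theorem contDiffOn_det (hA : ∀ i j, ContDiffOn ℝ k (fun x => A x i j) s) :
    ContDiffOn ℝ k (fun x => (A x).det) s := by
  simp_rw [Matrix.det_apply]
  exact ContDiffOn.sum fun σ _ => (contDiffOn_prod fun i _ => hA _ _).const_smul _

theorem contDiffOn_inv_apply (hA : ∀ i j, ContDiffOn ℝ k (fun x => A x i j) s)
    (hd : ∀ x ∈ s, (A x).det ≠ 0) (i j : n) : ContDiffOn ℝ k (fun x => (A x)⁻¹ i j) s := by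
  simp_rw [Matrix.inv_def, Ring.inverse_eq_inv', Matrix.smul_apply, Matrix.adjugate_apply, smul_eq_mul]
  refine ((contDiffOn_det hA).inv hd).mul (contDiffOn_det fun a b => ?_)
  simp only [Matrix.updateRow_apply]
  split_ifs
  · exact contDiffOn_const
  · exact hA _ _

end MatrixSmooth

/-! ### The metric in local coordinates -/

section Metric

open Matrix

variable {m : ℕ} {M : Type*} [TopologicalSpace M] [ChartedSpace (EuclideanSpace ℝ (Fin m)) M]

/-- The bilinear form of the field at `p`, on the model space. -/
def metricAt (g : BilinField m M) (p : ℝ × M × ℝ) :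
    LinearMap.BilinForm ℝ (ℝ × EuclideanSpace ℝ (Fin m) × ℝ) := g p

/-- The derivative of the parametrization given by `e`, as a map of model spaces. -/
def frame (e : Chart m M) (y : Fin (m + 2) → ℝ) :
    (Fin (m + 2) → ℝ) →L[ℝ] ℝ × EuclideanSpace ℝ (Fin m) × ℝ :=
  mfderiv 𝓘(ℝ, Fin (m + 2) → ℝ) (model m) (coordMap e) y

theorem lower_apply (g : BilinField m M) (e : Chart m M) (y : Fin (m + 2) → ℝ)
    (α β : Fin (m + 2)) : lower g e y α β
      = metricAt g (coordMap e y) (frame e y (Pi.single α 1)) (frame e y (Pi.single β 1)) := rfl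

theorem dotProduct_lower_mulVec (g : BilinField m M) (e : Chart m M) (y x x' : Fin (m + 2) → ℝ) :
    x ⬝ᵥ lower g e y *ᵥ x' = metricAt g (coordMap e y) (frame e y x) (frame e y x') := by
  set b : LinearMap.BilinForm ℝ (Fin (m + 2) → ℝ) :=
    (metricAt g (coordMap e y)).comp (frame e y : (Fin (m + 2) → ℝ) →ₗ[ℝ] _) (frame e y) with hb
  have h1 : lower g e y = LinearMap.BilinForm.toMatrix' b := by
    ext α β
    rw [LinearMap.BilinForm.toMatrix'_apply, lower_apply]; rfl
  rw [h1, ← Matrix.toBilin'_apply', Matrix.toBilin'_toMatrix']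
  rfl

theorem lower_symm {g : BilinField m M} {e : Chart m M} {y : Fin (m + 2) → ℝ}
    (hg : IsLorentzian (g (coordMap e y))) : (lower g e y)ᵀ = lower g e y := by
  ext α β
  exact hg.1 _ _

theorem upper_symm {g : BilinField m M} {e : Chart m M} {y : Fin (m + 2) → ℝ}
    (hg : IsLorentzian (g (coordMap e y))) (α β : Fin (m + 2)) :
    upper g e y α β = upper g e y β α := by
  have : (upper g e y)ᵀ = upper g e y := by
    unfold upper
    rw [transpose_nonsing_inv]
    rw [lower_symm hg]
  exact congrFun (congrFun this β) α

variable [IsManifold (𝓡 m) ∞ M]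

theorem frame_transition {e e' : Chart m M}
    (he : e ∈ IsManifold.maximalAtlas (𝓡 m) ∞ M) (he' : e' ∈ IsManifold.maximalAtlas (𝓡 m) ∞ M)
    {y : Fin (m + 2) → ℝ} (hy : y ∈ overlap e e') (x : Fin (m + 2) → ℝ) :
    frame e y x = frame e' (transition e e' y) (fderiv ℝ (transition e e') y x) := by
  have h1 : coordMap e =ᶠ[nhds y] coordMap e' ∘ transition e e' :=
    Filter.eventuallyEq_of_mem ((isOpen_overlap e e').mem_nhds hy)
      fun z hz => (coordMap_transition hz).symm
  have hm : middle (transition e e' y) ∈ e'.target := by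
    rw [transition_eq, middle_coordPoint]; exact e'.map_source hy.2
  have h2 := ((mdifferentiableAt_coordMap he' hm).hasMFDerivAt.comp y
    (mdifferentiableAt_iff_differentiableAt.2
      (differentiableAt_transition he he' hy)).hasMFDerivAt).congr_of_eventuallyEq h1
  have h3 := h2.mfderiv
  rw [mfderiv_eq_fderiv] at h3
  unfold frame
  exact congrArg (fun L : (Fin (m + 2) → ℝ) →L[ℝ] ℝ × EuclideanSpace ℝ (Fin m) × ℝ => L x) h3

/-- The tensor law for the metric components: the two frames differ by the Jacobian, by the chain
rule. -/
theorem lower_transition (g : BilinField m M) {e e' : Chart m M}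
    (he : e ∈ IsManifold.maximalAtlas (𝓡 m) ∞ M) (he' : e' ∈ IsManifold.maximalAtlas (𝓡 m) ∞ M)
    {y : Fin (m + 2) → ℝ} (hy : y ∈ overlap e e') :
    lower g e y
      = (jacobian e e' y)ᵀ * lower g e' (transition e e' y) * jacobian e e' y := by
  ext α β
  have hJ : ∀ α, fderiv ℝ (transition e e') y (Pi.single α 1)
      = jacobian e e' y *ᵥ Pi.single α 1 := by
    intro α; ext i; simp [jacobian]
  rw [lower_apply, frame_transition he he' hy, frame_transition he he' hy, ← coordMap_transition hy,
    ← dotProduct_lower_mulVec, hJ, hJ]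
  have := single_one_dotProduct α
    (((jacobian e e' y)ᵀ * lower g e' (transition e e' y) * jacobian e e' y) *ᵥ Pi.single β 1)
  rw [mulVec_single_one, col_apply] at this
  rw [← this, ← mulVec_single_one, ← mulVec_mulVec, ← mulVec_mulVec, dotProduct_mulVec _ (_)ᵀ,
    vecMul_transpose]

theorem frame_injective {e : Chart m M} (he : e ∈ IsManifold.maximalAtlas (𝓡 m) ∞ M)
    {y : Fin (m + 2) → ℝ} (hy : middle y ∈ e.target) : Function.Injective (frame e y) := by
  have hs : (coordMap e y).2.1 ∈ e.source := e.map_target hy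
  have h2 := (mdifferentiableAt_coords he hs).hasMFDerivAt.comp y
    (mdifferentiableAt_coordMap he hy).hasMFDerivAt
  have h1 : coords e ∘ coordMap e =ᶠ[nhds y] id :=
    Filter.eventuallyEq_of_mem ((isOpen_middle_target e).mem_nhds hy)
      fun z hz => coords_coordMap hz
  have h3 := hasMFDerivAt_unique (h2.congr_of_eventuallyEq h1.symm) (hasMFDerivAt_id y)
  refine Function.LeftInverse.injective
    (g := (mfderiv (model m) 𝓘(ℝ, Fin (m + 2) → ℝ) (coords e) (coordMap e y) :
      ℝ × EuclideanSpace ℝ (Fin m) × ℝ →L[ℝ] (Fin (m + 2) → ℝ))) fun x => ?_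
  exact congrArg (fun L : (Fin (m + 2) → ℝ) →L[ℝ] (Fin (m + 2) → ℝ) => L x) h3

theorem frame_surjective {e : Chart m M} (he : e ∈ IsManifold.maximalAtlas (𝓡 m) ∞ M)
    {y : Fin (m + 2) → ℝ} (hy : middle y ∈ e.target) : Function.Surjective (frame e y) := by
  have hfin : Module.finrank ℝ (Fin (m + 2) → ℝ)
      = Module.finrank ℝ (ℝ × EuclideanSpace ℝ (Fin m) × ℝ) := by
    simp; omega
  exact (LinearMap.injective_iff_surjective_of_finrank_eq_finrank hfin
    (f := (frame e y : (Fin (m + 2) → ℝ) →ₗ[ℝ] _))).1 (frame_injective he hy)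

theorem det_lower_neg {g : BilinField m M} {e : Chart m M}
    (he : e ∈ IsManifold.maximalAtlas (𝓡 m) ∞ M) {y : Fin (m + 2) → ℝ} (hy : middle y ∈ e.target)
    (hg : IsLorentzian (g (coordMap e y))) : (lower g e y).det < 0 := by
  obtain ⟨-, u, hu, hpos⟩ := id hg
  obtain ⟨x, rfl⟩ := frame_surjective he hy u
  refine det_neg_of_lorentzian (lower_symm hg) (u := x) ?_ fun w hw hw0 => ?_
  · rw [dotProduct_lower_mulVec]; exact hu
  · rw [dotProduct_lower_mulVec] at hw ⊢
    refine hpos _ hw fun h0 => hw0 (frame_injective he hy ?_)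
    rw [map_zero]; exact h0

end Metric

/-! ### Invariance of the energy tensor -/

section Invariance

open Matrix

variable {m : ℕ} {M : Type*} [TopologicalSpace M] [ChartedSpace (EuclideanSpace ℝ (Fin m)) M]

/-- Subtracting `2 ξ₀ g^{0β} ξ_β` from `g^{αβ} ξ_α ξ_β` removes the mixed time terms and reverses
the sign of the `g^{00}` term. In this form the tensor `a` is built from the inverse metric and the
covector `dy⁰` only, hence invariant under changes of chart on `M`. The two subtracted terms are
kept apart because no symmetry of the metric is assumed here. -/
theorem aForm_eq (g : BilinField m M) (e : Chart m M) (y ξ : Fin (m + 2) → ℝ) :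
    aForm g e y ξ = ξ ⬝ᵥ upper g e y *ᵥ ξ - ξ 0 * (Pi.single 0 1 ⬝ᵥ upper g e y *ᵥ ξ)
      - ξ 0 * (ξ ⬝ᵥ upper g e y *ᵥ Pi.single 0 1) := by
  set U := upper g e y with hU
  have h1 : ∀ α β, aTensor g e y α β * ξ α * ξ β = ξ α * (U α β * ξ β)
      - (if α = 0 then ξ 0 * (U 0 β * ξ β) else 0)
      - (if β = 0 then ξ 0 * (ξ α * U α 0) else 0) := by
    intro α β
    simp only [aTensor, Matrix.of_apply, ← hU]
    by_cases ha : α = 0 <;> by_cases hb : β = 0 <;> simp [ha, hb] <;> ring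
  unfold aForm
  simp_rw [h1, Finset.sum_sub_distrib]
  congr 1
  · congr 1
    · simp only [dotProduct, mulVec, Finset.mul_sum]
    · rw [Finset.sum_comm]
      simp only [Finset.sum_ite_eq', Finset.mem_univ, if_true, single_one_dotProduct]
      simp only [mulVec, dotProduct, Finset.mul_sum]
  · simp only [Finset.sum_ite_eq', Finset.mem_univ, if_true, mulVec_single_one, col_apply,
      dotProduct, Finset.mul_sum]

/-- A covector with its normal component removed. -/
def tanPart (ξ : Fin (m + 2) → ℝ) : Fin (m + 2) → ℝ :=
  ξ - ξ (Fin.last (m + 1)) • Pi.single (Fin.last (m + 1)) 1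

/-- Reduces every statement about the tangential form to one about the full form. -/
theorem aFormTan_eq (g : BilinField m M) (e : Chart m M) (y ξ : Fin (m + 2) → ℝ) :
    aFormTan g e y ξ = aForm g e y (tanPart ξ) := by
  have h1 : tanPart ξ (Fin.last (m + 1)) = 0 := by simp [tanPart]
  have h2 : ∀ a : Fin (m + 1), tanPart ξ a.castSucc = ξ a.castSucc := by
    intro a; simp [tanPart, Fin.ext_iff, Pi.single_apply]; omega
  unfold aFormTan aForm
  conv_rhs => rw [Fin.sum_univ_castSucc]
  simp only [h1, mul_zero, zero_mul, Finset.sum_const_zero, add_zero]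
  refine Finset.sum_congr rfl fun a _ => ?_
  conv_rhs => rw [Fin.sum_univ_castSucc, h1]
  simp [h2]

variable [IsManifold (𝓡 m) ∞ M]

theorem aForm_transition {g : BilinField m M} {e e' : Chart m M}
    (he : e ∈ IsManifold.maximalAtlas (𝓡 m) ∞ M) (he' : e' ∈ IsManifold.maximalAtlas (𝓡 m) ∞ M)
    {y : Fin (m + 2) → ℝ} (hy : y ∈ overlap e e') (hg : IsLorentzian (g (coordMap e y)))
    (ξ : Fin (m + 2) → ℝ) :
    aForm g e y ((jacobian e e' y)ᵀ *ᵥ ξ) = aForm g e' (transition e e' y) ξ := by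
  set J := jacobian e e' y with hJ
  have hdet := det_lower_neg he hy.1 hg
  have hL := lower_transition g he he' hy
  have hJd : IsUnit J.det := by
    rw [isUnit_iff_ne_zero]
    intro h0
    rw [hL, det_mul, ← hJ, h0, mul_zero] at hdet
    exact lt_irrefl _ hdet
  have hB : ∀ ξ η, (Jᵀ *ᵥ ξ) ⬝ᵥ upper g e y *ᵥ (Jᵀ *ᵥ η)
      = ξ ⬝ᵥ upper g e' (transition e e' y) *ᵥ η := by
    intro ξ η
    have hJt : IsUnit (Jᵀ).det := by rwa [det_transpose]
    unfold upper
    rw [hL, Matrix.mul_inv_rev, Matrix.mul_inv_rev, ← hJ, mulVec_mulVec, Matrix.mul_assoc,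
      Matrix.mul_assoc, Matrix.nonsing_inv_mul _ hJt, Matrix.mul_one, mulVec_transpose,
      ← dotProduct_mulVec, mulVec_mulVec, ← Matrix.mul_assoc, Matrix.mul_nonsing_inv _ hJd,
      Matrix.one_mul]
  have h0 : Jᵀ *ᵥ Pi.single 0 1 = Pi.single 0 1 := by
    ext α
    rw [mulVec_single_one, col_apply, transpose_apply, hJ, jacobian_zero he he' hy]
    simp [Pi.single_apply, eq_comm]
  have h1 : (Jᵀ *ᵥ ξ) 0 = ξ 0 := by
    simp only [mulVec, dotProduct, transpose_apply, hJ, jacobian_zero' he he' hy, Pi.single_apply]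
    simp
  rw [aForm_eq, aForm_eq, hB, h1]
  have h3 := hB (Pi.single 0 1) ξ
  have h4 := hB ξ (Pi.single 0 1)
  rw [h0] at h3 h4
  rw [h3, h4]

theorem tanPart_transition {e e' : Chart m M}
    (he : e ∈ IsManifold.maximalAtlas (𝓡 m) ∞ M) (he' : e' ∈ IsManifold.maximalAtlas (𝓡 m) ∞ M)
    {y : Fin (m + 2) → ℝ} (hy : y ∈ overlap e e') (ξ : Fin (m + 2) → ℝ) :
    tanPart ((jacobian e e' y)ᵀ *ᵥ ξ) = (jacobian e e' y)ᵀ *ᵥ tanPart ξ := by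
  have h1 : ((jacobian e e' y)ᵀ *ᵥ ξ) (Fin.last (m + 1)) = ξ (Fin.last (m + 1)) := by
    simp only [mulVec, dotProduct, transpose_apply, jacobian_last' he he' hy, Pi.single_apply]
    simp
  have h0 : (jacobian e e' y)ᵀ *ᵥ Pi.single (Fin.last (m + 1)) 1
      = Pi.single (Fin.last (m + 1)) 1 := by
    ext α
    rw [mulVec_single_one, col_apply, transpose_apply, jacobian_last he he' hy]
    simp [Pi.single_apply, eq_comm]
  rw [tanPart, tanPart, h1, mulVec_sub, mulVec_smul, h0]

/-- The gradient of `v` in the coordinates given by `e`. -/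
def chartGrad (e : Chart m M) (v : ℝ × M × ℝ → ℝ) (y : Fin (m + 2) → ℝ) (α : Fin (m + 2)) : ℝ :=
  pd α (v ∘ coordMap e) y

theorem chartGrad_transition {e e' : Chart m M}
    (he : e ∈ IsManifold.maximalAtlas (𝓡 m) ∞ M) (he' : e' ∈ IsManifold.maximalAtlas (𝓡 m) ∞ M)
    {y : Fin (m + 2) → ℝ} (hy : y ∈ overlap e e') {v : ℝ × M × ℝ → ℝ}
    (hv : DifferentiableAt ℝ (v ∘ coordMap e') (transition e e' y)) :
    chartGrad e v y = (jacobian e e' y)ᵀ *ᵥ chartGrad e' v (transition e e' y) := by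
  have h1 : v ∘ coordMap e =ᶠ[nhds y] (v ∘ coordMap e') ∘ transition e e' :=
    Filter.eventuallyEq_of_mem ((isOpen_overlap e e').mem_nhds hy)
      fun z hz => by simp [coordMap_transition hz]
  have h2 := (hv.hasFDerivAt.comp y
    (differentiableAt_transition he he' hy).hasFDerivAt).congr_of_eventuallyEq h1
  ext α
  unfold chartGrad pd
  rw [h2.fderiv, ContinuousLinearMap.comp_apply, fderiv_transition_single, map_sum]
  simp [mulVec, dotProduct]

variable {g : BilinField m M} {v : ℝ × M × ℝ → ℝ} {T r : ℝ} {p : ℝ × M × ℝ} {e : Chart m M}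

/-- Densities are defined in the preferred chart at each point, whereas the hypotheses on the metric
concern the charts of a fixed cover. This independence of the chart links the two. -/
theorem aForm_chartGrad_eq {e' : Chart m M}
    (hv : ContMDiffOn (model m) 𝓘(ℝ, ℝ) ∞ v (slab M T r)) (hp : p ∈ slab M T r)
    (hg : IsLorentzian (g p)) (he : e ∈ IsManifold.maximalAtlas (𝓡 m) ∞ M)
    (hpe : p.2.1 ∈ e.source) (he' : e' ∈ IsManifold.maximalAtlas (𝓡 m) ∞ M)
    (hpe' : p.2.1 ∈ e'.source) :
    aForm g e (coords e p) (chartGrad e v (coords e p))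
        = aForm g e' (coords e' p) (chartGrad e' v (coords e' p)) ∧
      aFormTan g e (coords e p) (chartGrad e v (coords e p))
        = aFormTan g e' (coords e' p) (chartGrad e' v (coords e' p)) := by
  have hy : coords e p ∈ overlap e e' := by
    simp only [overlap, mem_ofPred_eq, coords_eq, middle_coordPoint, e.left_inv hpe]
    exact ⟨e.map_source hpe, hpe'⟩
  have ht : transition e e' (coords e p) = coords e' p := by
    rw [transition, coordMap_coords hpe]
  have hd : DifferentiableAt ℝ (v ∘ coordMap e') (transition e e' (coords e p)) := by
    rw [ht]
    exact ((contDiffOn_comp_coordMap he' hv).contDiffAt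
      ((isOpen_coordDomain e' T r).mem_nhds (coords_mem_coordDomain hp hpe'))).differentiableAt
      (by simp)
  have hg' : IsLorentzian (g (coordMap e (coords e p))) := by rwa [coordMap_coords hpe]
  rw [aFormTan_eq, aFormTan_eq, chartGrad_transition he he' hy hd, tanPart_transition he he' hy,
    aForm_transition he he' hy hg', aForm_transition he he' hy hg', ht]
  exact ⟨rfl, rfl⟩

theorem aGrad_eq (hv : ContMDiffOn (model m) 𝓘(ℝ, ℝ) ∞ v (slab M T r)) (hp : p ∈ slab M T r)
    (hg : IsLorentzian (g p)) (he : e ∈ IsManifold.maximalAtlas (𝓡 m) ∞ M)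
    (hpe : p.2.1 ∈ e.source) :
    aGrad g v p = aForm g e (coords e p) (chartGrad e v (coords e p)) :=
  (aForm_chartGrad_eq hv hp hg (IsManifold.chart_mem_maximalAtlas p.2.1) (mem_chart_source _ _)
    he hpe).1

theorem aGradTan_eq (hv : ContMDiffOn (model m) 𝓘(ℝ, ℝ) ∞ v (slab M T r)) (hp : p ∈ slab M T r)
    (hg : IsLorentzian (g p)) (he : e ∈ IsManifold.maximalAtlas (𝓡 m) ∞ M)
    (hpe : p.2.1 ∈ e.source) :
    aGradTan g v p = aFormTan g e (coords e p) (chartGrad e v (coords e p)) :=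
  (aForm_chartGrad_eq hv hp hg (IsManifold.chart_mem_maximalAtlas p.2.1) (mem_chart_source _ _)
    he hpe).2

/-- The time derivative of `v`. -/
def timeDeriv (v : ℝ × M × ℝ → ℝ) (p : ℝ × M × ℝ) : ℝ := deriv (fun t => v (t, p.2)) p.1

theorem hasDerivAt_chart_time (hv : ContMDiffOn (model m) 𝓘(ℝ, ℝ) ∞ v (slab M T r))
    (hp : p ∈ slab M T r) (he : e ∈ IsManifold.maximalAtlas (𝓡 m) ∞ M) (hpe : p.2.1 ∈ e.source) :
    HasDerivAt (fun t => v (t, p.2)) (chartGrad e v (coords e p) 0) p.1 := by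
  have hd : DifferentiableAt ℝ (v ∘ coordMap e) (coords e p) :=
    ((contDiffOn_comp_coordMap he hv).contDiffAt
      ((isOpen_coordDomain e T r).mem_nhds (coords_mem_coordDomain hp hpe))).differentiableAt
      (by simp)
  have := hasDerivAt_time (f := v ∘ coordMap e) hd
  simp only [Function.comp_apply, coordMap_coordPoint, e.left_inv hpe] at this
  exact this

theorem hasDerivAt_chart_normal (hv : ContMDiffOn (model m) 𝓘(ℝ, ℝ) ∞ v (slab M T r))
    (hp : p ∈ slab M T r) (he : e ∈ IsManifold.maximalAtlas (𝓡 m) ∞ M) (hpe : p.2.1 ∈ e.source) :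
    HasDerivAt (fun z => v (p.1, p.2.1, z)) (chartGrad e v (coords e p) (Fin.last (m + 1)))
      p.2.2 := by
  have hd : DifferentiableAt ℝ (v ∘ coordMap e) (coords e p) :=
    ((contDiffOn_comp_coordMap he hv).contDiffAt
      ((isOpen_coordDomain e T r).mem_nhds (coords_mem_coordDomain hp hpe))).differentiableAt
      (by simp)
  have := hasDerivAt_normal (f := v ∘ coordMap e) hd
  simp only [Function.comp_apply, coordMap_coordPoint, e.left_inv hpe] at this
  exact this

theorem timeDeriv_eq (hv : ContMDiffOn (model m) 𝓘(ℝ, ℝ) ∞ v (slab M T r))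
    (hp : p ∈ slab M T r) (he : e ∈ IsManifold.maximalAtlas (𝓡 m) ∞ M) (hpe : p.2.1 ∈ e.source) :
    timeDeriv v p = chartGrad e v (coords e p) 0 :=
  (hasDerivAt_chart_time hv hp he hpe).deriv

theorem normalDeriv_eq (hv : ContMDiffOn (model m) 𝓘(ℝ, ℝ) ∞ v (slab M T r))
    (hp : p ∈ slab M T r) (he : e ∈ IsManifold.maximalAtlas (𝓡 m) ∞ M) (hpe : p.2.1 ∈ e.source) :
    normalDeriv v p = chartGrad e v (coords e p) (Fin.last (m + 1)) :=
  (hasDerivAt_chart_normal hv hp he hpe).deriv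

end Invariance

/-! ### The energy inequality on a trapezoid -/

section Trapezoid

variable {m : ℕ}

/-- The coordinate vectors with time in `(-T, T)` and normal coordinate in `(-r, r)`. -/
def coordSlab (m : ℕ) (T r : ℝ) : Set (Fin (m + 2) → ℝ) :=
  {y | y 0 ∈ Ioo (-T) T ∧ y (Fin.last (m + 1)) ∈ Ioo (-r) r}

theorem isOpen_coordSlab (m : ℕ) (T r : ℝ) : IsOpen (coordSlab m T r) :=
  (isOpen_Ioo.preimage (continuous_apply 0)).inter
    (isOpen_Ioo.preimage (continuous_apply (Fin.last (m + 1))))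

theorem coordPoint_mem_coordSlab {T r t : ℝ} {x : EuclideanSpace ℝ (Fin m)} {z : ℝ} :
    coordPoint t x z ∈ coordSlab m T r ↔ t ∈ Ioo (-T) T ∧ z ∈ Ioo (-r) r := by
  simp [coordSlab]

/-- Vanishing off the compact set `K` reduces the claim to a continuous function on a compact box.
The middle factor may thus be a whole Euclidean space. -/
theorem integrable_box {E : Type*} [TopologicalSpace E] [MeasurableSpace E]
    [SecondCountableTopology E] [T2Space E]
    [BorelSpace E] {μ : Measure E} [SFinite μ] [IsFiniteMeasureOnCompacts μ] {K : Set E}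
    (hK : IsCompact K) {a b c d : ℝ} {f : (ℝ × E) × ℝ → ℝ}
    (hf : ContinuousOn f ((Icc a b ×ˢ univ) ×ˢ Icc c d))
    (h0 : ∀ t x w, t ∈ Icc a b → w ∈ Icc c d → x ∉ K → f ((t, x), w) = 0) :
    Integrable f (((volume.restrict (Ioc a b)).prod μ).prod (volume.restrict (Ioc c d))) := by
  have h1 : IntegrableOn f ((Icc a b ×ˢ K) ×ˢ Icc c d) ((volume.prod μ).prod volume) :=
    (hf.mono (by gcongr; exact subset_univ _)).integrableOn_compact
      ((isCompact_Icc.prod hK).prod isCompact_Icc)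
  have h2 : IntegrableOn f ((Icc a b ×ˢ univ) ×ˢ Icc c d) ((volume.prod μ).prod volume) := by
    refine h1.of_forall_sdiff_eq_zero
      ((measurableSet_Icc.prod MeasurableSet.univ).prod measurableSet_Icc) ?_
    rintro ⟨⟨t, x⟩, w⟩ ⟨⟨⟨ht, -⟩, hw⟩, hn⟩
    refine h0 t x w ht hw fun hx => hn ⟨⟨ht, hx⟩, hw⟩
  have h3 : ((volume.restrict (Ioc a b)).prod μ).prod (volume.restrict (Ioc c d))
      = ((volume.prod μ).prod volume).restrict ((Ioc a b ×ˢ univ) ×ˢ Ioc c d) := by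
    rw [← Measure.prod_restrict, ← Measure.prod_restrict, Measure.restrict_univ]
  rw [h3]
  exact h2.mono_set (by gcongr <;> exact Ioc_subset_Icc_self)

theorem integrable_slice {E : Type*} [TopologicalSpace E] [MeasurableSpace E]
    [SecondCountableTopology E] [T2Space E]
    [BorelSpace E] {μ : Measure E} [SFinite μ] [IsFiniteMeasureOnCompacts μ] {K : Set E}
    (hK : IsCompact K) {c d : ℝ} {f : E × ℝ → ℝ}
    (hf : ContinuousOn f (univ ×ˢ Icc c d))
    (h0 : ∀ x w, w ∈ Icc c d → x ∉ K → f (x, w) = 0) :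
    Integrable f (μ.prod (volume.restrict (Ioc c d))) := by
  have h1 : IntegrableOn f (K ×ˢ Icc c d) (μ.prod volume) :=
    (hf.mono (by gcongr; exact subset_univ _)).integrableOn_compact (hK.prod isCompact_Icc)
  have h2 : IntegrableOn f (univ ×ˢ Icc c d) (μ.prod volume) := by
    refine h1.of_forall_sdiff_eq_zero (MeasurableSet.univ.prod measurableSet_Icc) ?_
    rintro ⟨x, w⟩ ⟨⟨-, hw⟩, hn⟩
    exact h0 x w hw fun hx => hn ⟨hx, hw⟩
  have h3 : μ.prod (volume.restrict (Ioc c d))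
      = (μ.prod volume).restrict (univ ×ˢ Ioc c d) := by
    rw [← Measure.prod_restrict, Measure.restrict_univ]
  rw [h3]
  exact h2.mono_set (by gcongr; exact Ioc_subset_Icc_self)

/-- The trapezoid inequality in the variables `(y⁰, yⁿ)`, for fixed `y'`; the section at time `τ`
is parametrized by `[-1, 1]`. -/
theorem trapezoid_section_le {A B : (Fin (m + 2) → ℝ) → ℝ} {T r ρ c s : ℝ}
    (hA : ContDiffOn ℝ 1 A (coordSlab m T r)) (hB : ContDiffOn ℝ 1 B (coordSlab m T r))
    (hflux : ∀ y ∈ coordSlab m T r, |B y| ≤ c * A y) (hc : 0 ≤ c) (hs : 0 ≤ s) (hsT : s < T)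
    (hcs : c * s < ρ) (hρr : ρ < r) (x : EuclideanSpace ℝ (Fin m)) :
    (∫ w in (-1 : ℝ)..1, (ρ - c * s) * A (coordPoint s x ((ρ - c * s) * w)))
      ≤ (∫ w in (-1 : ℝ)..1, (ρ - c * 0) * A (coordPoint 0 x ((ρ - c * 0) * w)))
        + ∫ τ in (0 : ℝ)..s, ∫ w in (-1 : ℝ)..1, (ρ - c * τ) *
          (pd 0 A (coordPoint τ x ((ρ - c * τ) * w))
            - pd (Fin.last (m + 1)) B (coordPoint τ x ((ρ - c * τ) * w))) := by
  have hO := isOpen_coordSlab m T r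
  have hmem : ∀ τ ∈ Icc 0 s, ∀ w ∈ Icc (-1 : ℝ) 1,
      coordPoint τ x ((ρ - c * τ) * w) ∈ coordSlab m T r := by
    intro τ hτ w hw
    rw [coordPoint_mem_coordSlab]
    have h1 : c * τ ≤ c * s := by gcongr; exact hτ.2
    have h2 : 0 ≤ c * τ := mul_nonneg hc hτ.1
    refine ⟨⟨by linarith [hτ.1], by linarith [hτ.2]⟩, ?_⟩
    rw [mem_Ioo, ← abs_lt, abs_mul, abs_of_pos (by linarith)]
    have := abs_le.2 hw
    have h4 : (ρ - c * τ) * |w| ≤ (ρ - c * τ) * 1 := by gcongr; linarith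
    linarith
  have hcp : Continuous fun p : ℝ × ℝ => coordPoint p.1 x ((ρ - c * p.1) * p.2) :=
    continuous_coordPoint.comp (f := fun p : ℝ × ℝ => (p.1, x, (ρ - c * p.1) * p.2)) (by fun_prop)
  have hcomp : ∀ {f : (Fin (m + 2) → ℝ) → ℝ}, ContinuousOn f (coordSlab m T r) →
      ContinuousOn (fun p : ℝ × ℝ => f (coordPoint p.1 x ((ρ - c * p.1) * p.2)))
        (Icc 0 s ×ˢ Icc (-1) 1) := fun hf =>
    hf.comp hcp.continuousOn fun p hp => hmem p.1 hp.1 p.2 hp.2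
  have hpd : ∀ {f : (Fin (m + 2) → ℝ) → ℝ}, ContDiffOn ℝ 1 f (coordSlab m T r) → ∀ α,
      ContinuousOn (pd α f) (coordSlab m T r) := fun hf α =>
    (hf.continuousOn_fderiv_of_isOpen hO (by norm_num)).clm_apply continuousOn_const
  have hda : ∀ {f : (Fin (m + 2) → ℝ) → ℝ}, ContDiffOn ℝ 1 f (coordSlab m T r) →
      ∀ y ∈ coordSlab m T r, DifferentiableAt ℝ f y := fun hf y hy =>
    (hf.contDiffAt (hO.mem_nhds hy)).differentiableAt (by norm_num)
  set n := Fin.last (m + 1)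
  set P : ℝ × ℝ → Fin (m + 2) → ℝ := fun p => coordPoint p.1 x ((ρ - c * p.1) * p.2) with hP
  -- derivative in time
  set dτ : ℝ → ℝ → ℝ := fun τ w => -c * A (P (τ, w)) + (ρ - c * τ) *
    (pd 0 A (P (τ, w)) + pd n A (P (τ, w)) * (-c * w)) with hdτ
  -- `dw` is the `w`-derivative of `-c w A + B`, the flux relative to the moving slices. In the
  -- difference `dτ - dw` the normal derivatives of `A` cancel, and only the divergence `q` remains.
  set dw : ℝ → ℝ → ℝ := fun τ w => -c * A (P (τ, w)) - c * w * (pd n A (P (τ, w)) * (ρ - c * τ))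
    + pd n B (P (τ, w)) * (ρ - c * τ) with hdw
  set q : ℝ → ℝ → ℝ := fun τ w => (ρ - c * τ) * (pd 0 A (P (τ, w)) - pd n B (P (τ, w))) with hq
  have hsum : ∀ τ w, dτ τ w = dw τ w + q τ w := by intro τ w; simp only [hdτ, hdw, hq]; ring
  have cdτ : ContinuousOn (Function.uncurry dτ) (Icc 0 s ×ˢ Icc (-1) 1) := by
    have h1 := hcomp hA.continuousOn
    have h2 := hcomp (hpd hA 0)
    have h3 := hcomp (hpd hA n)
    exact (continuousOn_const.mul h1).add (ContinuousOn.mul (by fun_prop)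
      (h2.add (h3.mul (by fun_prop))))
  have cdw : ContinuousOn (Function.uncurry dw) (Icc 0 s ×ˢ Icc (-1) 1) := by
    have h1 := hcomp hA.continuousOn
    have h2 := hcomp (hpd hB n)
    have h3 := hcomp (hpd hA n)
    exact ((continuousOn_const.mul h1).sub (ContinuousOn.mul (by fun_prop)
      (h3.mul (by fun_prop)))).add (h2.mul (by fun_prop))
  have cq : ContinuousOn (Function.uncurry q) (Icc 0 s ×ˢ Icc (-1) 1) := by
    have h1 := hcomp (hpd hA 0)
    have h2 := hcomp (hpd hB n)
    simp only [hq, Function.uncurry_def, hP]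
    fun_prop
  have sec1 : ∀ {f : ℝ → ℝ → ℝ}, ContinuousOn (Function.uncurry f) (Icc 0 s ×ˢ Icc (-1) 1) →
      ∀ w ∈ Icc (-1 : ℝ) 1, ContinuousOn (fun τ => f τ w) (Icc 0 s) := fun hf w hw =>
    hf.comp (f := fun τ => (τ, w)) (by fun_prop) fun τ hτ => ⟨hτ, hw⟩
  have sec2 : ∀ {f : ℝ → ℝ → ℝ}, ContinuousOn (Function.uncurry f) (Icc 0 s ×ˢ Icc (-1) 1) →
      ∀ τ ∈ Icc 0 s, ContinuousOn (fun w => f τ w) (Icc (-1) 1) := fun hf τ hτ =>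
    hf.comp (f := fun w => (τ, w)) (by fun_prop) fun w hw => ⟨hτ, hw⟩
  have hder : ∀ τ ∈ Icc 0 s, ∀ w ∈ Icc (-1 : ℝ) 1,
      HasDerivAt (fun τ => (ρ - c * τ) * A (P (τ, w))) (dτ τ w) τ := by
    intro τ hτ w hw
    have hd := hda hA _ (hmem τ hτ w hw)
    have hR : HasDerivAt (fun τ => ρ - c * τ) (-c) τ := by
      simpa using ((hasDerivAt_id τ).const_mul c).const_sub ρ
    have hcurve : HasDerivAt (fun τ => P (τ, w))
        (Pi.single 0 1 + (-c * w) • (Pi.single n 1 : Fin (m + 2) → ℝ)) τ := by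
      have e1 : (fun τ => P (τ, w)) = fun t => P (τ, w) + (t - τ) • (Pi.single 0 1
          + (-c * w) • (Pi.single n 1 : Fin (m + 2) → ℝ)) := by
        funext t
        have : P (t, w) = coordPoint (τ + (t - τ)) x ((ρ - c * τ) * w + (t - τ) * (-c * w)) := by
          simp only [hP]; congr 1 <;> ring
        rw [this, coordPoint_add_time, coordPoint_add_normal, smul_add, smul_smul]
        abel
      rw [e1]
      have h0 := (((hasDerivAt_id τ).sub_const τ).smul_const (Pi.single 0 1
          + (-c * w) • (Pi.single n 1 : Fin (m + 2) → ℝ))).const_add (P (τ, w))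
      rw [one_smul] at h0
      exact h0
    have h2 := hR.mul (hd.hasFDerivAt.comp_hasDerivAt τ hcurve)
    convert! h2 using 1
    simp only [hdτ, pd, map_add, map_smul, smul_eq_mul, hP]
    simp only [Function.comp_apply]
    ring
  have hderw : ∀ τ ∈ Icc 0 s, ∀ w ∈ Icc (-1 : ℝ) 1,
      HasDerivAt (fun w => -c * w * A (P (τ, w)) + B (P (τ, w))) (dw τ w) w := by
    intro τ hτ w hw
    have hR : HasDerivAt (fun w => (ρ - c * τ) * w) (ρ - c * τ) w := by
      simpa using (hasDerivAt_id w).const_mul (ρ - c * τ)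
    have h1 := (hasDerivAt_normal (hda hA _ (hmem τ hτ w hw))).comp w hR
    have h2 := (hasDerivAt_normal (hda hB _ (hmem τ hτ w hw))).comp w hR
    have h3 := (((hasDerivAt_id w).const_mul (-c)).mul h1).add h2
    convert! h3 using 1
    simp only [hdw, hP, Function.comp_apply, id]
    ring
  -- fundamental theorem of calculus in time
  have e1 : (∫ w in (-1 : ℝ)..1, (ρ - c * s) * A (P (s, w)))
      - (∫ w in (-1 : ℝ)..1, (ρ - c * 0) * A (P (0, w)))
      = ∫ w in (-1 : ℝ)..1, ∫ τ in (0 : ℝ)..s, dτ τ w := by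
    have hcA := hcomp hA.continuousOn
    have hi : ∀ t ∈ Icc 0 s, IntervalIntegrable (fun w => (ρ - c * t) * A (P (t, w)))
        volume (-1) 1 := by
      intro t ht
      refine ContinuousOn.intervalIntegrable_of_Icc (by norm_num) ?_
      exact continuousOn_const.mul (hcA.comp (f := fun w => (t, w)) (by fun_prop)
        fun w hw => ⟨ht, hw⟩)
    rw [← intervalIntegral.integral_sub (hi s ⟨hs, le_rfl⟩) (hi 0 ⟨le_rfl, hs⟩)]
    refine intervalIntegral.integral_congr fun w hw => ?_
    rw [uIcc_of_le (by norm_num)] at hw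
    exact (intervalIntegral.integral_eq_sub_of_hasDerivAt (fun τ hτ => hder τ (by
      rwa [uIcc_of_le hs] at hτ) w hw) ((sec1 cdτ w hw).intervalIntegrable_of_Icc hs)).symm
  have e2 : ∫ w in (-1 : ℝ)..1, ∫ τ in (0 : ℝ)..s, dτ τ w
      = ∫ τ in (0 : ℝ)..s, ∫ w in (-1 : ℝ)..1, dτ τ w := by
    symm
    apply intervalIntegral_intervalIntegral_swap
    rw [uIoc_of_le hs, uIoc_of_le (by norm_num)]
    exact (cdτ.integrableOn_compact (isCompact_Icc.prod isCompact_Icc)).mono_set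
      (by gcongr <;> exact Ioc_subset_Icc_self)
  have e3 : ∀ τ ∈ Icc 0 s, ∫ w in (-1 : ℝ)..1, dτ τ w ≤ ∫ w in (-1 : ℝ)..1, q τ w := by
    intro τ hτ
    have i1 := (sec2 cdw τ hτ).intervalIntegrable_of_Icc (by norm_num : (-1 : ℝ) ≤ 1) (μ := volume)
    have i2 := (sec2 cq τ hτ).intervalIntegrable_of_Icc (by norm_num : (-1 : ℝ) ≤ 1) (μ := volume)
    simp_rw [hsum]
    rw [intervalIntegral.integral_add i1 i2,
      intervalIntegral.integral_eq_sub_of_hasDerivAt (fun w hw => hderw τ hτ w (by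
        rwa [uIcc_of_le (by norm_num)] at hw)) i1]
    -- At `w = ±1` the boundary contributions are `-c A ± B ≤ 0`, since the slope `c` of the sides
    -- dominates the ratio of flux to density.
    have f1 := hflux _ (hmem τ hτ 1 (by constructor <;> norm_num))
    have f2 := hflux _ (hmem τ hτ (-1) (by constructor <;> norm_num))
    have g1 := le_abs_self (B (P (τ, 1)))
    have g2 := neg_abs_le (B (P (τ, -1)))
    simp only [hP] at g1 g2 ⊢
    linarith
  have cI : ∀ {f : ℝ → ℝ → ℝ}, ContinuousOn (Function.uncurry f) (Icc 0 s ×ˢ Icc (-1) 1) →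
      IntervalIntegrable (fun τ => ∫ w in (-1 : ℝ)..1, f τ w) volume 0 s := by
    intro f hf
    have h1 : Integrable (Function.uncurry f)
        ((volume.restrict (Ioc 0 s)).prod (volume.restrict (Ioc (-1) 1))) := by
      rw [Measure.prod_restrict]
      exact (hf.integrableOn_compact (isCompact_Icc.prod isCompact_Icc)).mono_set
        (by gcongr <;> exact Ioc_subset_Icc_self)
    rw [intervalIntegrable_iff, uIoc_of_le hs]
    simp_rw [intervalIntegral.integral_of_le (by norm_num : (-1 : ℝ) ≤ 1)]
    exact h1.integral_prod_left
  have e4 : ∫ τ in (0 : ℝ)..s, ∫ w in (-1 : ℝ)..1, dτ τ w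
      ≤ ∫ τ in (0 : ℝ)..s, ∫ w in (-1 : ℝ)..1, q τ w :=
    intervalIntegral.integral_mono_on hs (cI cdτ) (cI cq) e3
  change (∫ w in (-1 : ℝ)..1, (ρ - c * s) * A (P (s, w)))
      ≤ (∫ w in (-1 : ℝ)..1, (ρ - c * 0) * A (P (0, w)))
        + ∫ τ in (0 : ℝ)..s, ∫ w in (-1 : ℝ)..1, q τ w
  linarith

/-- The energy inequality on a trapezoid with slopes at least as large as the ratio of the flux
`B` to the density `A`, when the sources are bounded by `N`. -/
theorem trapezoid_le {A B : (Fin (m + 2) → ℝ) → ℝ} {D : Fin m → (Fin (m + 2) → ℝ) → ℝ}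
    {K : Set (EuclideanSpace ℝ (Fin m))} {T r ρ c s : ℝ} (hK : IsCompact K)
    (hA : ContDiffOn ℝ 1 A (coordSlab m T r)) (hB : ContDiffOn ℝ 1 B (coordSlab m T r))
    (hD : ∀ i, ContDiffOn ℝ 1 (D i) (coordSlab m T r))
    (hA0 : ∀ y ∈ coordSlab m T r, middle y ∉ K → A y = 0)
    (hB0 : ∀ y ∈ coordSlab m T r, middle y ∉ K → B y = 0)
    (hD0 : ∀ i, ∀ y ∈ coordSlab m T r, middle y ∉ K → D i y = 0)
    (hflux : ∀ y ∈ coordSlab m T r, |B y| ≤ c * A y) (hc : 0 ≤ c) (hs : 0 ≤ s) (hsT : s < T)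
    (hcs : c * s < ρ) (hρr : ρ < r) {N : (Fin (m + 2) → ℝ) → ℝ}
    (hN : ContinuousOn N (coordSlab m T r ∩ middle ⁻¹' K))
    (hQN : ∀ y ∈ coordSlab m T r, middle y ∈ K → |y (Fin.last (m + 1))| ≤ ρ →
      pd 0 A y - pd (Fin.last (m + 1)) B y - ∑ i : Fin m, pd i.succ.castSucc (D i) y ≤ N y) :
    (∫ x, ∫ w in (-1 : ℝ)..1, (ρ - c * s) * A (coordPoint s x ((ρ - c * s) * w)))
      ≤ (∫ x, ∫ w in (-1 : ℝ)..1, (ρ - c * 0) * A (coordPoint 0 x ((ρ - c * 0) * w)))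
        + ∫ τ in (0 : ℝ)..s, ∫ x in K, ∫ w in (-1 : ℝ)..1,
          (ρ - c * τ) * N (coordPoint τ x ((ρ - c * τ) * w)) := by
  have hO := isOpen_coordSlab m T r
  have hmem : ∀ τ ∈ Icc 0 s, ∀ x, ∀ w ∈ Icc (-1 : ℝ) 1,
      coordPoint τ x ((ρ - c * τ) * w) ∈ coordSlab m T r := by
    intro τ hτ x w hw
    rw [coordPoint_mem_coordSlab]
    have h1 : c * τ ≤ c * s := by gcongr; exact hτ.2
    have h2 : 0 ≤ c * τ := mul_nonneg hc hτ.1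
    refine ⟨⟨by linarith [hτ.1], by linarith [hτ.2]⟩, ?_⟩
    rw [mem_Ioo, ← abs_lt, abs_mul, abs_of_pos (by linarith)]
    have := abs_le.2 hw
    have h4 : (ρ - c * τ) * |w| ≤ (ρ - c * τ) * 1 := by gcongr; linarith
    linarith
  have hpd : ∀ {f : (Fin (m + 2) → ℝ) → ℝ}, ContDiffOn ℝ 1 f (coordSlab m T r) → ∀ α,
      ContinuousOn (pd α f) (coordSlab m T r) := fun hf α =>
    (hf.continuousOn_fderiv_of_isOpen hO (by norm_num)).clm_apply continuousOn_const
  have hpd0 : ∀ {f : (Fin (m + 2) → ℝ) → ℝ}, (∀ y ∈ coordSlab m T r, middle y ∉ K → f y = 0) →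
      ∀ α, ∀ y ∈ coordSlab m T r, middle y ∉ K → pd α f y = 0 := by
    intro f hf α y hy hyK
    have h1 : f =ᶠ[nhds y] fun _ => 0 :=
      Filter.eventuallyEq_of_mem (Filter.inter_mem (hO.mem_nhds hy)
        ((hK.isClosed.isOpen_compl.preimage continuous_middle).mem_nhds hyK))
        fun z hz => hf z hz.1 hz.2
    unfold pd
    rw [h1.fderiv_eq]; simp
  set cut : ((Fin (m + 2) → ℝ) → ℝ) → (ℝ × EuclideanSpace ℝ (Fin m)) × ℝ → ℝ :=
    fun f p => (ρ - c * p.1.1) * f (coordPoint p.1.1 p.1.2 ((ρ - c * p.1.1) * p.2)) with hcut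
  have ccut : ∀ {f : (Fin (m + 2) → ℝ) → ℝ}, ContinuousOn f (coordSlab m T r) →
      ContinuousOn (cut f) ((Icc 0 s ×ˢ univ) ×ˢ Icc (-1) 1) := by
    intro f hf
    have h1 : Continuous fun p : (ℝ × EuclideanSpace ℝ (Fin m)) × ℝ =>
        coordPoint p.1.1 p.1.2 ((ρ - c * p.1.1) * p.2) :=
      continuous_coordPoint.comp (f := fun p : (ℝ × EuclideanSpace ℝ (Fin m)) × ℝ =>
        (p.1.1, p.1.2, (ρ - c * p.1.1) * p.2)) (by fun_prop)
    have h2 := hf.comp h1.continuousOn (s := (Icc 0 s ×ˢ univ) ×ˢ Icc (-1) 1)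
      fun p hp => hmem p.1.1 hp.1.1 p.1.2 p.2 hp.2
    exact ContinuousOn.mul (by fun_prop) h2
  have icut : ∀ {f : (Fin (m + 2) → ℝ) → ℝ}, ContinuousOn f (coordSlab m T r) →
      (∀ y ∈ coordSlab m T r, middle y ∉ K → f y = 0) →
      Integrable (cut f) (((volume.restrict (Ioc 0 s)).prod volume).prod
        (volume.restrict (Ioc (-1) 1))) := fun hf hf0 =>
    integrable_box hK (ccut hf) fun t x w ht hw hx => by
      simp only [hcut]
      rw [hf0 _ (hmem t ht x w hw) (by simpa using hx), mul_zero]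
  have icutx : ∀ {f : (Fin (m + 2) → ℝ) → ℝ}, ContinuousOn f (coordSlab m T r) →
      (∀ y ∈ coordSlab m T r, middle y ∉ K → f y = 0) → ∀ t ∈ Icc 0 s,
      Integrable (fun p : EuclideanSpace ℝ (Fin m) × ℝ => cut f ((t, p.1), p.2))
        (volume.prod (volume.restrict (Ioc (-1) 1))) := fun hf hf0 t ht =>
    integrable_slice hK ((ccut hf).comp (by fun_prop) fun p hp => ⟨⟨ht, mem_univ _⟩, hp.2⟩)
      fun x w hw hx => by
      simp only [hcut]
      rw [hf0 _ (hmem t ht x w hw) (by simpa using hx), mul_zero]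
  have hle : (-1 : ℝ) ≤ 1 := by norm_num
  set n := Fin.last (m + 1)
  set q : (Fin (m + 2) → ℝ) → ℝ := fun y => pd 0 A y - pd n B y with hq
  set Q : (Fin (m + 2) → ℝ) → ℝ := fun y => pd 0 A y - pd n B y
    - ∑ i : Fin m, pd i.succ.castSucc (D i) y with hQ
  have cq : ContinuousOn q (coordSlab m T r) := (hpd hA 0).sub (hpd hB n)
  have q0 : ∀ y ∈ coordSlab m T r, middle y ∉ K → q y = 0 := fun y hy hyK => by
    simp [hq, hpd0 hA0 0 y hy hyK, hpd0 hB0 n y hy hyK]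
  have cQ : ContinuousOn Q (coordSlab m T r) :=
    cq.sub (continuousOn_finsetSum _ fun i _ => hpd (hD i) _)
  have Q0 : ∀ y ∈ coordSlab m T r, middle y ∉ K → Q y = 0 := fun y hy hyK => by
    have : ∀ i, pd i.succ.castSucc (D i) y = 0 := fun i => hpd0 (hD0 i) _ y hy hyK
    simp only [hQ, this, Finset.sum_const_zero, sub_zero]
    exact q0 y hy hyK
  have step1 : (∫ x, ∫ w in (-1 : ℝ)..1, cut A ((s, x), w))
      ≤ (∫ x, ∫ w in (-1 : ℝ)..1, cut A ((0, x), w))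
        + ∫ x, ∫ τ in (0 : ℝ)..s, ∫ w in (-1 : ℝ)..1, cut q ((τ, x), w) := by
    have j1 : ∀ t ∈ Icc 0 s, Integrable fun x => ∫ w in (-1 : ℝ)..1, cut A ((t, x), w) := by
      intro t ht
      simp_rw [intervalIntegral.integral_of_le hle]
      exact (icutx hA.continuousOn hA0 t ht).integral_prod_left
    have j2 : Integrable fun x => ∫ τ in (0 : ℝ)..s, ∫ w in (-1 : ℝ)..1, cut q ((τ, x), w) := by
      simp_rw [intervalIntegral.integral_of_le hle, intervalIntegral.integral_of_le hs]
      exact (icut cq q0).integral_prod_left.integral_prod_right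
    rw [← integral_add (j1 0 ⟨le_rfl, hs⟩) j2]
    refine integral_mono (j1 s ⟨hs, le_rfl⟩) ((j1 0 ⟨le_rfl, hs⟩).add j2) fun x => ?_
    exact trapezoid_section_le hA hB hflux hc hs hsT hcs hρr x
  have step2 : ∫ x, ∫ τ in (0 : ℝ)..s, ∫ w in (-1 : ℝ)..1, cut q ((τ, x), w)
      = ∫ τ in (0 : ℝ)..s, ∫ x, ∫ w in (-1 : ℝ)..1, cut q ((τ, x), w) := by
    simp_rw [intervalIntegral.integral_of_le hle, intervalIntegral.integral_of_le hs]
    exact (integral_integral_swap (icut cq q0).integral_prod_left).symm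
  -- For fixed time and normal coordinate, `D i` is compactly supported in `y'`, so its derivative
  -- integrates to zero; this is integration by parts against the constant `1`. The tangential
  -- fluxes can therefore be inserted into the source at no cost, turning `q` into `Q`.
  have hdiv : ∀ i, ∀ t ∈ Icc 0 s,
      ∫ x, ∫ w in (-1 : ℝ)..1, cut (pd i.succ.castSucc (D i)) ((t, x), w) = 0 := by
    intro i t ht
    simp_rw [intervalIntegral.integral_of_le hle]
    have h1 := icutx (hpd (hD i) i.succ.castSucc) (hpd0 (hD0 i) _) t ht
    rw [integral_integral_swap h1]
    refine setIntegral_eq_zero_of_forall_eq_zero fun w hw => ?_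
    have hw' : w ∈ Icc (-1 : ℝ) 1 := Ioc_subset_Icc_self hw
    simp only [hcut]
    rw [integral_const_mul]
    set z := (ρ - c * t) * w
    have hm : ∀ x, coordPoint t x z ∈ coordSlab m T r := fun x => hmem t ht x w hw'
    have hcp : ContDiff ℝ 1 fun x : EuclideanSpace ℝ (Fin m) => coordPoint t x z :=
      contDiff_coordPoint.comp (f := fun x : EuclideanSpace ℝ (Fin m) => (t, x, z)) (by fun_prop)
    have hf : ContDiff ℝ 1 fun x => D i (coordPoint t x z) := by
      rw [← contDiffOn_univ]
      exact (hD i).comp hcp.contDiffOn fun x _ => hm x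
    have hsupp : HasCompactSupport fun x => D i (coordPoint t x z) :=
      HasCompactSupport.intro hK fun x hx => hD0 i _ (hm x) (by simpa using hx)
    have h2 : ∀ x, pd i.succ.castSucc (D i) (coordPoint t x z)
        = fderiv ℝ (fun x => D i (coordPoint t x z)) x (EuclideanSpace.single i 1) := fun x =>
      (fderiv_middle_single ((((hD i).contDiffAt (hO.mem_nhds (hm x)))).differentiableAt
        (by norm_num)) i).symm
    have hcf : Continuous fun x =>
        fderiv ℝ (fun x => D i (coordPoint t x z)) x (EuclideanSpace.single i 1) :=
      (hf.continuous_fderiv (by norm_num)).clm_apply continuous_const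
    have hsf : HasCompactSupport fun x =>
        fderiv ℝ (fun x => D i (coordPoint t x z)) x (EuclideanSpace.single i 1) :=
      hsupp.fderiv_apply ℝ _
    have h3 := integral_mul_fderiv_eq_neg_fderiv_mul_of_integrable (μ := volume)
      (f := fun _ : EuclideanSpace ℝ (Fin m) => (1 : ℝ)) (g := fun x => D i (coordPoint t x z))
      (v := EuclideanSpace.single i 1) (by simp)
      (by simpa using hcf.integrable_of_hasCompactSupport hsf)
      (by simpa using hf.continuous.integrable_of_hasCompactSupport hsupp)
      (fun x _ => by fun_prop) (fun x _ => (hf.differentiable (by norm_num)) x)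
    simp_rw [h2]
    simp only [one_mul] at h3
    rw [h3]; simp
  have step3 : ∀ t ∈ Icc 0 s, ∫ x, ∫ w in (-1 : ℝ)..1, cut q ((t, x), w)
      = ∫ x, ∫ w in (-1 : ℝ)..1, cut Q ((t, x), w) := by
    intro t ht
    have e1 : ∀ x w, cut Q ((t, x), w) = cut q ((t, x), w)
        - ∑ i, cut (pd i.succ.castSucc (D i)) ((t, x), w) := by
      intro x w
      simp only [hcut, hQ, hq, mul_sub, Finset.mul_sum]
    have k1 := icutx cq q0 t ht
    have k2 := fun i => icutx (hpd (hD i) i.succ.castSucc) (hpd0 (hD0 i) _) t ht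
    have hd := fun i => hdiv i t ht
    simp_rw [intervalIntegral.integral_of_le hle] at hd ⊢
    have l1 := integral_prod _ k1
    have l2 := fun i => integral_prod _ (k2 i)
    have l3 := integral_prod _ (icutx cQ Q0 t ht)
    simp only at l1 l2 l3
    rw [← l1, ← l3]
    simp_rw [e1]
    rw [integral_sub k1 (integrable_finsetSum _ fun i _ => k2 i), integral_finsetSum _ fun i _ => k2 i]
    simp_rw [l2, hd]
    simp
  have step4 : ∫ τ in (0 : ℝ)..s, ∫ x, ∫ w in (-1 : ℝ)..1, cut q ((τ, x), w)
      = ∫ τ in (0 : ℝ)..s, ∫ x, ∫ w in (-1 : ℝ)..1, cut Q ((τ, x), w) := by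
    refine intervalIntegral.integral_congr fun t ht => ?_
    rw [uIcc_of_le hs] at ht
    exact step3 t ht
  have iN : Integrable (cut N) (((volume.restrict (Ioc 0 s)).prod (volume.restrict K)).prod
      (volume.restrict (Ioc (-1) 1))) := by
    have h1 : Continuous fun p : (ℝ × EuclideanSpace ℝ (Fin m)) × ℝ =>
        coordPoint p.1.1 p.1.2 ((ρ - c * p.1.1) * p.2) :=
      continuous_coordPoint.comp (f := fun p : (ℝ × EuclideanSpace ℝ (Fin m)) × ℝ =>
        (p.1.1, p.1.2, (ρ - c * p.1.1) * p.2)) (by fun_prop)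
    have h2 : ContinuousOn (cut N) ((Icc 0 s ×ˢ K) ×ˢ Icc (-1) 1) :=
      ContinuousOn.mul (by fun_prop) (hN.comp h1.continuousOn fun p hp =>
        ⟨hmem p.1.1 hp.1.1 p.1.2 p.2 hp.2, by simpa using hp.1.2⟩)
    rw [Measure.prod_restrict, Measure.prod_restrict]
    exact (h2.integrableOn_compact ((isCompact_Icc.prod hK).prod isCompact_Icc)).mono_set
      (by gcongr <;> exact Ioc_subset_Icc_self)
  have hR : ∀ t ∈ Icc 0 s, 0 < ρ - c * t := fun t ht => by
    have : c * t ≤ c * s := by gcongr; exact ht.2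
    linarith
  have cNx : ∀ t ∈ Icc 0 s, ∀ x ∈ K,
      ContinuousOn (fun w => cut N ((t, x), w)) (Icc (-1) 1) := fun t ht x hx =>
    ContinuousOn.mul (by fun_prop) (hN.comp (Continuous.continuousOn (continuous_coordPoint.comp
      (f := fun w : ℝ => (t, x, (ρ - c * t) * w)) (by fun_prop)))
      fun w hw => ⟨hmem t ht x w hw, by simpa using hx⟩)
  have iNx : ∀ t ∈ Icc 0 s, Integrable (fun p : EuclideanSpace ℝ (Fin m) × ℝ =>
      cut N ((t, p.1), p.2)) ((volume.restrict K).prod (volume.restrict (Ioc (-1) 1))) := by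
    intro t ht
    have h1 : Continuous fun p : EuclideanSpace ℝ (Fin m) × ℝ =>
        coordPoint t p.1 ((ρ - c * t) * p.2) :=
      continuous_coordPoint.comp (f := fun p : EuclideanSpace ℝ (Fin m) × ℝ =>
        (t, p.1, (ρ - c * t) * p.2)) (by fun_prop)
    have h2 : ContinuousOn (fun p : EuclideanSpace ℝ (Fin m) × ℝ =>
        cut N ((t, p.1), p.2)) (K ×ˢ Icc (-1) 1) :=
      ContinuousOn.mul (by fun_prop) (hN.comp h1.continuousOn fun p hp =>
        ⟨hmem t ht p.1 p.2 hp.2, by simpa using hp.1⟩)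
    rw [Measure.prod_restrict]
    exact (h2.integrableOn_compact (hK.prod isCompact_Icc)).mono_set
      (by gcongr; exact Ioc_subset_Icc_self)
  -- The bound `N` is only available over `K`. This suffices because `Q` vanishes elsewhere.
  have step5 : ∀ t ∈ Icc 0 s, ∫ x, ∫ w in (-1 : ℝ)..1, cut Q ((t, x), w)
      ≤ ∫ x in K, ∫ w in (-1 : ℝ)..1, cut N ((t, x), w) := by
    intro t ht
    have k1 : Integrable fun x => ∫ w in (-1 : ℝ)..1, cut Q ((t, x), w) := by
      simp_rw [intervalIntegral.integral_of_le hle]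
      exact (icutx cQ Q0 t ht).integral_prod_left
    have k2 : IntegrableOn (fun x => ∫ w in (-1 : ℝ)..1, cut N ((t, x), w)) K := by
      simp_rw [intervalIntegral.integral_of_le hle]
      exact (iNx t ht).integral_prod_left
    have k3 : ∀ x ∉ K, ∫ w in (-1 : ℝ)..1, cut Q ((t, x), w) = 0 := by
      intro x hx
      refine intervalIntegral.integral_zero_ae (Filter.Eventually.of_forall fun w hw => ?_)
      rw [uIoc_of_le hle] at hw
      simp only [hcut]
      rw [Q0 _ (hmem t ht x w (Ioc_subset_Icc_self hw)) (by simpa using hx), mul_zero]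
    rw [← setIntegral_eq_integral_of_forall_compl_eq_zero k3]
    refine setIntegral_mono_on k1.integrableOn k2 hK.measurableSet fun x hx => ?_
    refine intervalIntegral.integral_mono_on hle ?_ ((cNx t ht x hx).intervalIntegrable_of_Icc hle)
      fun w hw => ?_
    · refine ContinuousOn.intervalIntegrable_of_Icc hle ((ccut cQ).comp (f := fun w => ((t, x), w))
        (by fun_prop) fun w hw => ⟨⟨ht, mem_univ _⟩, hw⟩)
    · refine mul_le_mul_of_nonneg_left (hQN _ (hmem t ht x w hw) (by simpa using hx) ?_)
        (hR t ht).le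
      rw [coordPoint_last, abs_mul, abs_of_pos (hR t ht)]
      have h1 : 0 ≤ c * t := mul_nonneg hc ht.1
      have h4 : (ρ - c * t) * |w| ≤ (ρ - c * t) * 1 :=
        mul_le_mul_of_nonneg_left (abs_le.2 hw) (hR t ht).le
      linarith
  have step6 : ∫ τ in (0 : ℝ)..s, ∫ x, ∫ w in (-1 : ℝ)..1, cut Q ((τ, x), w)
      ≤ ∫ τ in (0 : ℝ)..s, ∫ x in K, ∫ w in (-1 : ℝ)..1, cut N ((τ, x), w) := by
    refine intervalIntegral.integral_mono_on hs ?_ ?_ step5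
    · rw [intervalIntegrable_iff, uIoc_of_le hs]
      simp_rw [intervalIntegral.integral_of_le hle]
      exact (icut cQ Q0).integral_prod_left.integral_prod_left
    · rw [intervalIntegrable_iff, uIoc_of_le hs]
      simp_rw [intervalIntegral.integral_of_le hle]
      exact iN.integral_prod_left.integral_prod_left
  rw [step2, step4] at step1
  exact step1.trans (add_le_add_right step6 _)

end Trapezoid

/-! ### Calculus of partial derivatives -/

section PartialDerivatives

variable {m : ℕ} {f h : (Fin (m + 2) → ℝ) → ℝ} {y : Fin (m + 2) → ℝ} {α : Fin (m + 2)}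

theorem pd_mul (hf : DifferentiableAt ℝ f y) (hh : DifferentiableAt ℝ h y) :
    pd α (fun z => f z * h z) y = pd α f y * h y + f y * pd α h y := by
  unfold pd
  rw [fderiv_fun_mul hf hh]
  simp; ring

theorem pd_add (hf : DifferentiableAt ℝ f y) (hh : DifferentiableAt ℝ h y) :
    pd α (fun z => f z + h z) y = pd α f y + pd α h y := by
  unfold pd
  rw [fderiv_fun_add hf hh]
  simp

theorem pd_const_mul (c : ℝ) (hf : DifferentiableAt ℝ f y) :
    pd α (fun z => c * f z) y = c * pd α f y := by
  unfold pd
  rw [fderiv_const_mul hf]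
  simp

theorem pd_sum {ι : Type*} {s : Finset ι} {f : ι → (Fin (m + 2) → ℝ) → ℝ}
    (hf : ∀ i ∈ s, DifferentiableAt ℝ (f i) y) :
    pd α (fun z => ∑ i ∈ s, f i z) y = ∑ i ∈ s, pd α (f i) y := by
  unfold pd
  rw [fderiv_fun_sum hf]
  simp

theorem pd_congr (hfh : f =ᶠ[nhds y] h) : pd α f y = pd α h y := by
  unfold pd
  rw [hfh.fderiv_eq]

theorem pd_comp {F : ℝ → ℝ} (hF : DifferentiableAt ℝ F (f y)) (hf : DifferentiableAt ℝ f y) :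
    pd α (fun z => F (f z)) y = deriv F (f y) * pd α f y := by
  unfold pd
  have := hF.hasDerivAt.comp_hasFDerivAt y hf.hasFDerivAt
  have h2 : HasFDerivAt (fun z => F (f z)) (deriv F (f y) • fderiv ℝ f y) y := this
  rw [h2.fderiv]
  simp

theorem contDiffOn_pd {s : Set (Fin (m + 2) → ℝ)} (hs : IsOpen s) (hf : ContDiffOn ℝ ∞ f s)
    (α : Fin (m + 2)) : ContDiffOn ℝ ∞ (pd α f) s :=
  (hf.fderiv_of_isOpen hs (by simp)).clm_apply contDiffOn_const

theorem pd_comm (hf : ContDiffAt ℝ ∞ f y) (α β : Fin (m + 2)) :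
    pd α (pd β f) y = pd β (pd α f) y := by
  have hs : IsSymmSndFDerivAt ℝ f y := hf.isSymmSndFDerivAt (by
    rw [minSmoothness_of_isRCLikeNormedField]
    exact ENat.LEInfty.out)
  have hd : DifferentiableAt ℝ (fderiv ℝ f) y :=
    ((hf.fderiv_right (m := 1) (by norm_cast)).differentiableAt (by norm_num))
  have h1 : ∀ α β : Fin (m + 2), pd α (pd β f) y
      = fderiv ℝ (fderiv ℝ f) y (Pi.single α 1) (Pi.single β 1) := by
    intro α β
    change fderiv ℝ (fun z => fderiv ℝ f z (Pi.single β 1)) y (Pi.single α 1) = _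
    rw [fderiv_clm_apply hd (differentiableAt_const _)]
    simp
  rw [h1, h1, hs.eq]

/-- The divergence form of the wave operator multiplied by `∂_0 u`. -/
theorem half_pd_quadratic_eq {U : Fin (m + 2) → Fin (m + 2) → (Fin (m + 2) → ℝ) → ℝ}
    {u S : (Fin (m + 2) → ℝ) → ℝ} (hU : ∀ α β, DifferentiableAt ℝ (U α β) y)
    (hsymm : ∀ α β, U α β y = U β α y) (hu : ContDiffAt ℝ ∞ u y) (hS : DifferentiableAt ℝ S y)
    (hS0 : S y ≠ 0) :
    1 / 2 * pd 0 (fun z => ∑ α, ∑ β, U α β z * pd α u z * pd β u z) y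
      = ∑ α, pd α (fun z => (∑ β, U α β z * pd β u z) * pd 0 u z) y
        + 1 / 2 * ∑ α, ∑ β, pd 0 (U α β) y * pd α u y * pd β u y
        + pd 0 u y * ((∑ α, pd α S y / S y * ∑ β, U α β y * pd β u y)
          + -(1 / S y) * ∑ α, pd α (fun z => S z * ∑ β, U α β z * pd β u z) y) := by
  have hdu : ∀ α, DifferentiableAt ℝ (pd α u) y := fun α =>
    DifferentiableAt.clm_apply ((hu.fderiv_right (m := 1) (by norm_cast)).differentiableAt
      (by norm_num)) (differentiableAt_const _)
  have hW : ∀ α, DifferentiableAt ℝ (fun z => ∑ β, U α β z * pd β u z) y := fun α =>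
    DifferentiableAt.fun_sum fun β _ => (hU α β).mul (hdu β)
  have e1 : pd 0 (fun z => ∑ α, ∑ β, U α β z * pd α u z * pd β u z) y
      = ∑ α, ∑ β, (pd 0 (U α β) y * pd α u y * pd β u y
        + U α β y * pd 0 (pd α u) y * pd β u y + U α β y * pd α u y * pd 0 (pd β u) y) := by
    rw [pd_sum fun α _ => DifferentiableAt.fun_sum fun β _ => ((hU α β).fun_mul (hdu α)).fun_mul (hdu β)]
    refine Finset.sum_congr rfl fun α _ => ?_
    rw [pd_sum fun β _ => ((hU α β).fun_mul (hdu α)).fun_mul (hdu β)]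
    refine Finset.sum_congr rfl fun β _ => ?_
    rw [pd_mul ((hU α β).fun_mul (hdu α)) (hdu β), pd_mul (hU α β) (hdu α)]; ring
  have e2 : ∀ α, pd α (fun z => (∑ β, U α β z * pd β u z) * pd 0 u z) y
      = pd α (fun z => ∑ β, U α β z * pd β u z) y * pd 0 u y
        + ∑ β, U α β y * pd β u y * pd 0 (pd α u) y := by
    intro α
    rw [pd_mul (hW α) (hdu 0), pd_comm hu α 0, Finset.sum_mul]
  have e3 : ∀ α, pd α (fun z => S z * ∑ β, U α β z * pd β u z) y
      = pd α S y * (∑ β, U α β y * pd β u y)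
        + S y * pd α (fun z => ∑ β, U α β z * pd β u z) y := fun α => pd_mul hS (hW α)
  -- Symmetry of `U` makes the two terms with second derivatives of `u` equal. The factor `1/2` then
  -- matches them with the one produced by the divergence of the flux.
  have e4 : ∑ α, ∑ β, U α β y * pd α u y * pd 0 (pd β u) y
      = ∑ α, ∑ β, U α β y * pd β u y * pd 0 (pd α u) y := by
    rw [Finset.sum_comm]
    refine Finset.sum_congr rfl fun α _ => Finset.sum_congr rfl fun β _ => ?_
    rw [hsymm β α]
  have e5 : ∑ α, ∑ β, U α β y * pd 0 (pd α u) y * pd β u y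
      = ∑ α, ∑ β, U α β y * pd β u y * pd 0 (pd α u) y := by
    refine Finset.sum_congr rfl fun α _ => Finset.sum_congr rfl fun β _ => ?_
    ring
  have e6 : -(1 / S y) * ∑ α, (pd α S y * (∑ β, U α β y * pd β u y)
        + S y * pd α (fun z => ∑ β, U α β z * pd β u z) y)
      = -(∑ α, pd α S y / S y * ∑ β, U α β y * pd β u y)
        - ∑ α, pd α (fun z => ∑ β, U α β z * pd β u z) y := by
    rw [Finset.mul_sum, ← Finset.sum_neg_distrib, ← Finset.sum_sub_distrib]
    refine Finset.sum_congr rfl fun α _ => ?_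
    field_simp; ring
  simp_rw [e1, e2, e3]
  rw [e6]
  simp_rw [Finset.sum_add_distrib]
  rw [e4, e5, ← Finset.sum_mul]
  ring

end PartialDerivatives

/-! ### The local energy identity -/

section EnergyIdentity

open Matrix

variable {m : ℕ} {M : Type*} [TopologicalSpace M] [ChartedSpace (EuclideanSpace ℝ (Fin m)) M]
  [IsManifold (𝓡 m) ∞ M] {g : BilinField m M} {κ : ℝ × M × ℝ → ℝ} {F : ℝ → ℝ}
  {v : ℝ × M × ℝ → ℝ} {T r ε : ℝ} {e : Chart m M}

/-- The flux `g^{αβ} ∂_β v ∂_0 v`. -/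
def energyFlux (g : BilinField m M) (e : Chart m M) (v : ℝ × M × ℝ → ℝ) (α : Fin (m + 2))
    (y : Fin (m + 2) → ℝ) : ℝ :=
  (∑ β, upper g e y α β * chartGrad e v y β) * chartGrad e v y 0

/-- The logarithmic gradient of the volume density, with raised index. -/
def logDensityGrad (g : BilinField m M) (e : Chart m M) (y : Fin (m + 2) → ℝ) (β : Fin (m + 2)) :
    ℝ :=
  ∑ α, pd α (sqrtDet g e) y / sqrtDet g e y * upper g e y α β

theorem contDiffOn_upper (he : e ∈ IsManifold.maximalAtlas (𝓡 m) ∞ M)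
    (hg : SmoothFieldOn g T r) (hL : ∀ p ∈ slab M T r, IsLorentzian (g p)) (α β : Fin (m + 2)) :
    ContDiffOn ℝ ∞ (fun y => upper g e y α β) (coordDomain e T r) :=
  contDiffOn_inv_apply (hg e he)
    (fun _ hy => (det_lower_neg he hy.2.1 (hL _ (coordMap_mem_slab hy))).ne) α β

theorem contDiffOn_sqrtDet (he : e ∈ IsManifold.maximalAtlas (𝓡 m) ∞ M)
    (hg : SmoothFieldOn g T r) (hL : ∀ p ∈ slab M T r, IsLorentzian (g p)) :
    ContDiffOn ℝ ∞ (sqrtDet g e) (coordDomain e T r) :=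
  (contDiffOn_det (hg e he)).neg.sqrt fun _ hy =>
    (neg_pos.2 (det_lower_neg he hy.2.1 (hL _ (coordMap_mem_slab hy)))).ne'

theorem sqrtDet_pos (he : e ∈ IsManifold.maximalAtlas (𝓡 m) ∞ M)
    (hL : ∀ p ∈ slab M T r, IsLorentzian (g p)) {y : Fin (m + 2) → ℝ}
    (hy : y ∈ coordDomain e T r) : 0 < sqrtDet g e y :=
  Real.sqrt_pos.2 (neg_pos.2 (det_lower_neg he hy.2.1 (hL _ (coordMap_mem_slab hy))))

theorem contDiffOn_chartGrad (he : e ∈ IsManifold.maximalAtlas (𝓡 m) ∞ M)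
    (hv : ContMDiffOn (model m) 𝓘(ℝ, ℝ) ∞ v (slab M T r)) (α : Fin (m + 2)) :
    ContDiffOn ℝ ∞ (fun y => chartGrad e v y α) (coordDomain e T r) :=
  contDiffOn_pd (isOpen_coordDomain e T r) (contDiffOn_comp_coordMap he hv) α

theorem contDiffOn_energyFlux (he : e ∈ IsManifold.maximalAtlas (𝓡 m) ∞ M)
    (hg : SmoothFieldOn g T r) (hL : ∀ p ∈ slab M T r, IsLorentzian (g p))
    (hv : ContMDiffOn (model m) 𝓘(ℝ, ℝ) ∞ v (slab M T r)) (α : Fin (m + 2)) :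
    ContDiffOn ℝ ∞ (energyFlux g e v α) (coordDomain e T r) :=
  (ContDiffOn.sum fun β _ => (contDiffOn_upper he hg hL α β).mul
    (contDiffOn_chartGrad he hv β)).mul (contDiffOn_chartGrad he hv 0)

/-- Half the invariant quadratic form minus the time component of the flux is half the energy form.
Differentiating in time thus cancels the time component of the divergence in `half_pd_quadratic_eq`
and leaves a purely spatial one. -/
theorem aForm_chartGrad (hL : ∀ p ∈ slab M T r, IsLorentzian (g p)) {y : Fin (m + 2) → ℝ}
    (hy : y ∈ coordDomain e T r) :
    aForm g e y (chartGrad e v y)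
      = (∑ α, ∑ β, upper g e y α β * chartGrad e v y α * chartGrad e v y β)
        - 2 * energyFlux g e v 0 y := by
  have hs := upper_symm (hL _ (coordMap_mem_slab hy))
  rw [aForm_eq]
  have h1 : Pi.single 0 1 ⬝ᵥ upper g e y *ᵥ chartGrad e v y
      = ∑ β, upper g e y 0 β * chartGrad e v y β := by
    rw [single_one_dotProduct]; rfl
  have h2 : chartGrad e v y ⬝ᵥ upper g e y *ᵥ Pi.single 0 1
      = ∑ β, upper g e y 0 β * chartGrad e v y β := by
    rw [mulVec_single_one]
    refine Finset.sum_congr rfl fun β _ => ?_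
    rw [col_apply, hs β 0, mul_comm]
  rw [h1, h2, energyFlux]
  have h3 : chartGrad e v y ⬝ᵥ upper g e y *ᵥ chartGrad e v y
      = ∑ α, ∑ β, upper g e y α β * chartGrad e v y α * chartGrad e v y β := by
    simp only [dotProduct, mulVec, Finset.mul_sum]
    exact Finset.sum_congr rfl fun α _ => Finset.sum_congr rfl fun β _ => by ring
  rw [h3]; ring

theorem contDiffOn_aForm (he : e ∈ IsManifold.maximalAtlas (𝓡 m) ∞ M)
    (hg : SmoothFieldOn g T r) (hL : ∀ p ∈ slab M T r, IsLorentzian (g p))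
    {ξ : (Fin (m + 2) → ℝ) → Fin (m + 2) → ℝ}
    (hξ : ∀ α, ContDiffOn ℝ ∞ (fun y => ξ y α) (coordDomain e T r)) :
    ContDiffOn ℝ ∞ (fun y => aForm g e y (ξ y)) (coordDomain e T r) := by
  unfold aForm
  refine ContDiffOn.sum fun α _ => ContDiffOn.sum fun β _ => ContDiffOn.mul
    (ContDiffOn.mul ?_ (hξ α)) (hξ β)
  simp only [aTensor, of_apply]
  split_ifs
  · exact (contDiffOn_upper he hg hL 0 0).neg
  · exact contDiffOn_const
  · exact contDiffOn_upper he hg hL α β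

/-- The energy density in the coordinates given by `e`. -/
def chartEnergy (g : BilinField m M) (F : ℝ → ℝ) (ε : ℝ) (e : Chart m M) (v : ℝ × M × ℝ → ℝ)
    (y : Fin (m + 2) → ℝ) : ℝ :=
  ε / 2 * aForm g e y (chartGrad e v y) + 1 / ε * F (v (coordMap e y))

theorem contDiffOn_chartEnergy (hF : IsDoubleWell F) (he : e ∈ IsManifold.maximalAtlas (𝓡 m) ∞ M)
    (hg : SmoothFieldOn g T r) (hL : ∀ p ∈ slab M T r, IsLorentzian (g p))
    (hv : ContMDiffOn (model m) 𝓘(ℝ, ℝ) ∞ v (slab M T r)) :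
    ContDiffOn ℝ ∞ (chartEnergy g F ε e v) (coordDomain e T r) := by
  refine (contDiffOn_const.mul (contDiffOn_aForm he hg hL fun α =>
    contDiffOn_chartGrad he hv α)).add (contDiffOn_const.mul ?_)
  exact hF.smooth.comp_contDiffOn (contDiffOn_comp_coordMap he hv)

/-- The local energy identity. -/
theorem pd_chartEnergy (hF : IsDoubleWell F) (he : e ∈ IsManifold.maximalAtlas (𝓡 m) ∞ M)
    (hg : SmoothFieldOn g T r) (hL : ∀ p ∈ slab M T r, IsLorentzian (g p))
    (hv : IsSmoothSolution g κ F ε T r v) {y : Fin (m + 2) → ℝ} (hy : y ∈ coordDomain e T r) :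
    pd 0 (chartEnergy g F ε e v) y
      = ε * (pd (Fin.last (m + 1)) (energyFlux g e v (Fin.last (m + 1))) y
          + ∑ i : Fin m, pd i.succ.castSucc (energyFlux g e v i.succ.castSucc) y)
        + ε / 2 * ∑ α, ∑ β, pd 0 (fun z => upper g e z α β) y * chartGrad e v y α
          * chartGrad e v y β
        + chartGrad e v y 0 * (ε * ∑ β, logDensityGrad g e y β * chartGrad e v y β
          - κ (coordMap e y) * f1 F (v (coordMap e y))) := by
  have hO := isOpen_coordDomain e T r
  have hn := hO.mem_nhds hy
  have hda : ∀ {f : (Fin (m + 2) → ℝ) → ℝ}, ContDiffOn ℝ ∞ f (coordDomain e T r) →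
      DifferentiableAt ℝ f y := fun hf => (hf.contDiffAt hn).differentiableAt (by simp)
  have hu := contDiffOn_comp_coordMap he hv.smooth
  have hid := half_pd_quadratic_eq (U := fun α β z => upper g e z α β) (u := v ∘ coordMap e)
    (S := sqrtDet g e) (fun α β => hda (contDiffOn_upper he hg hL α β))
    (upper_symm (hL _ (coordMap_mem_slab hy))) (hu.contDiffAt hn)
    (hda (contDiffOn_sqrtDet he hg hL)) (sqrtDet_pos he hL hy).ne'
  have heqn := hv.eqn e he y hy
  have hquad : DifferentiableAt ℝ (fun z => ∑ α, ∑ β, upper g e z α β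
      * pd α (v ∘ coordMap e) z * pd β (v ∘ coordMap e) z) y :=
    hda (ContDiffOn.sum fun α _ => ContDiffOn.sum fun β _ =>
      ((contDiffOn_upper he hg hL α β).mul (contDiffOn_chartGrad he hv.smooth α)).mul
        (contDiffOn_chartGrad he hv.smooth β))
  have hflux := fun α => hda (contDiffOn_energyFlux he hg hL hv.smooth α)
  have e0 : chartEnergy g F ε e v =ᶠ[nhds y] fun z =>
      ε / 2 * ((∑ α, ∑ β, upper g e z α β * pd α (v ∘ coordMap e) z * pd β (v ∘ coordMap e) z)
        + -2 * energyFlux g e v 0 z) + 1 / ε * F ((v ∘ coordMap e) z) :=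
    Filter.eventuallyEq_of_mem hn fun z hz => by
      rw [chartEnergy, aForm_chartGrad hL hz]
      simp only [chartGrad, Function.comp_apply]; ring
  have hFd : DifferentiableAt ℝ F ((v ∘ coordMap e) y) :=
    (hF.smooth.differentiable (by simp)) _
  have hud := hda hu
  have e1 : pd 0 (chartEnergy g F ε e v) y
      = ε / 2 * (pd 0 (fun z => ∑ α, ∑ β, upper g e z α β * pd α (v ∘ coordMap e) z
          * pd β (v ∘ coordMap e) z) y + -2 * pd 0 (energyFlux g e v 0) y)
        + 1 / ε * (deriv F ((v ∘ coordMap e) y) * pd 0 (v ∘ coordMap e) y) := by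
    have hFu : DifferentiableAt ℝ (fun z => F ((v ∘ coordMap e) z)) y := hFd.comp y hud
    rw [pd_congr e0, pd_add ((hquad.fun_add ((hflux 0).const_mul (-2))).const_mul _)
      (hFu.const_mul _), pd_const_mul _ (hquad.fun_add ((hflux 0).const_mul (-2))),
      pd_add hquad ((hflux 0).const_mul (-2)), pd_const_mul _ (hflux 0),
      pd_const_mul _ hFu, pd_comp hFd hud]
  have e2 : ∑ α, pd α (energyFlux g e v α) y = pd 0 (energyFlux g e v 0) y
      + (∑ i : Fin m, pd i.succ.castSucc (energyFlux g e v i.succ.castSucc) y)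
      + pd (Fin.last (m + 1)) (energyFlux g e v (Fin.last (m + 1))) y := by
    rw [Fin.sum_univ_castSucc, Fin.sum_univ_succ]; rfl
  have e3 : ∑ α, pd α (sqrtDet g e) y / sqrtDet g e y
        * ∑ β, upper g e y α β * pd β (v ∘ coordMap e) y
      = ∑ β, logDensityGrad g e y β * chartGrad e v y β := by
    simp only [logDensityGrad, Finset.sum_mul, Finset.mul_sum]
    rw [Finset.sum_comm]
    exact Finset.sum_congr rfl fun α _ => Finset.sum_congr rfl fun β _ => by
      rw [chartGrad]; ring
  have e4 : -(1 / sqrtDet g e y) * ∑ α, pd α (fun z => sqrtDet g e z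
      * ∑ β, upper g e z α β * pd β (v ∘ coordMap e) z) y = box g v e y := rfl
  have e5 : ∀ α, (fun z => (∑ β, upper g e z α β * pd β (v ∘ coordMap e) z)
      * pd 0 (v ∘ coordMap e) z) = energyFlux g e v α := fun α => rfl
  simp only [e5] at hid
  rw [e2, e3, e4] at hid
  rw [e1]
  have h0 : pd 0 (v ∘ coordMap e) y = chartGrad e v y 0 := rfl
  have h1 : ∀ α, pd α (v ∘ coordMap e) y = chartGrad e v y α := fun α => rfl
  simp only [h1, Function.comp_apply] at hid ⊢
  simp only [f0] at heqn
  linear_combination ε * hid + chartGrad e v y 0 * heqn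

end EnergyIdentity

/-! ### Uniform bounds for the coefficients -/

section CoefficientBounds

variable {m : ℕ} {M : Type*} [TopologicalSpace M] [ChartedSpace (EuclideanSpace ℝ (Fin m)) M]
  {𝒰 : Set (Chart m M)} {g : BilinField m M} {κ : ℝ × M × ℝ → ℝ} {T ρ Λ : ℝ} {e : Chart m M}

/-- The order of vanishing in `yⁿ` attached to an index: `|yⁿ|` for the normal index, `1` for the
tangential ones. -/
def vanishing (y : Fin (m + 2) → ℝ) (α : Fin (m + 2)) : ℝ :=
  if α = Fin.last (m + 1) then |y (Fin.last (m + 1))| else 1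

theorem vanishing_nonneg (y : Fin (m + 2) → ℝ) (α : Fin (m + 2)) : 0 ≤ vanishing y α := by
  unfold vanishing; split_ifs <;> positivity

@[simp] theorem vanishing_last (y : Fin (m + 2) → ℝ) :
    vanishing y (Fin.last (m + 1)) = |y (Fin.last (m + 1))| := by simp [vanishing]

theorem vanishing_castSucc (y : Fin (m + 2) → ℝ) (a : Fin (m + 1)) :
    vanishing y a.castSucc = 1 := by
  have : a.castSucc ≠ Fin.last (m + 1) := (Fin.castSucc_lt_last a).ne
  simp [vanishing, this]

@[simp] theorem vanishing_zero (y : Fin (m + 2) → ℝ) : vanishing y 0 = 1 :=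
  vanishing_castSucc y 0

/-- The bounds on the coefficients of the equation at a point `y` which enter the energy
estimate. -/
structure CoefficientBound (g : BilinField m M) (κ : ℝ × M × ℝ → ℝ) (e : Chart m M) (Λ : ℝ)
    (y : Fin (m + 2) → ℝ) : Prop where
  upper : ∀ a : Fin (m + 1), ∀ β, |upper g e y a.castSucc β| ≤ Λ * vanishing y β
  upper_normal : ∀ β, |y (Fin.last (m + 1)) * AcceleratingFronts.upper g e y (Fin.last (m + 1)) β|
    ≤ Λ * vanishing y β
  dt_upper : ∀ α β, |pd 0 (fun z => AcceleratingFronts.upper g e z α β) y|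
    ≤ Λ * (vanishing y α * vanishing y β)
  logDensity : ∀ a : Fin (m + 1), |logDensityGrad g e y a.castSucc| ≤ Λ
  logDensity_normal : |logDensityGrad g e y (Fin.last (m + 1)) - κ (coordMap e y)|
    ≤ Λ * |y (Fin.last (m + 1))|
  curvature : |κ (coordMap e y)| ≤ Λ

theorem toHypersurface_coordPoint (t : ℝ) (x : EuclideanSpace ℝ (Fin m)) (z : ℝ) :
    toHypersurface (coordPoint t x z) = coordPoint t x 0 := by
  funext α
  refine index_cases (P := fun α => toHypersurface (coordPoint t x z) α = coordPoint t x 0 α)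
    ?_ (fun i => ?_) ?_ α
  · simp [toHypersurface, Fin.ext_iff]
  · rw [toHypersurface, Function.update_of_ne (Fin.castSucc_lt_last _).ne, coordPoint_succ,
      coordPoint_succ]
  · simp [toHypersurface]

/-- The coordinate vectors with time in `[-T, T]`, middle part in `K` and normal coordinate
in `[-ρ, ρ]`. -/
def coordBox (K : Set (EuclideanSpace ℝ (Fin m))) (T ρ : ℝ) : Set (Fin (m + 2) → ℝ) :=
  (fun p : ℝ × EuclideanSpace ℝ (Fin m) × ℝ => coordPoint p.1 p.2.1 p.2.2) ''
    (Icc (-T) T ×ˢ K ×ˢ Icc (-ρ) ρ)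

theorem isCompact_coordBox {K : Set (EuclideanSpace ℝ (Fin m))} (hK : IsCompact K) (T ρ : ℝ) :
    IsCompact (coordBox K T ρ) :=
  (isCompact_Icc.prod (hK.prod isCompact_Icc)).image continuous_coordPoint

theorem coordPoint_mem_coordBox {K : Set (EuclideanSpace ℝ (Fin m))} {t : ℝ}
    {x : EuclideanSpace ℝ (Fin m)} {z : ℝ} (ht : t ∈ Icc (-T) T) (hx : x ∈ K)
    (hz : z ∈ Icc (-ρ) ρ) : coordPoint t x z ∈ coordBox K T ρ :=
  ⟨(t, x, z), ⟨ht, hx, hz⟩, rfl⟩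

theorem coordBox_subset {K : Set (EuclideanSpace ℝ (Fin m))} (hK : K ⊆ e.target) {T' r : ℝ}
    (hT : T < T') (hr : ρ < r) : coordBox K T ρ ⊆ coordDomain e T' r := by
  rintro _ ⟨⟨t, x, z⟩, ⟨ht, hx, hz⟩, rfl⟩
  rw [coordPoint_mem_coordDomain]
  exact ⟨⟨by linarith [ht.1], by linarith [ht.2]⟩, hK hx, by linarith [hz.1], by linarith [hz.2]⟩

theorem exists_bound_on_coordBox {K : Set (EuclideanSpace ℝ (Fin m))} (hKc : IsCompact K)
    (hK : K ⊆ e.target) {T' r : ℝ} (hT : T < T') (hr : ρ < r) {ι : Type*} [Finite ι]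
    {f : ι → (Fin (m + 2) → ℝ) → ℝ} (hf : ∀ i, ContinuousOn (f i) (coordDomain e T' r)) :
    ∃ C, 0 ≤ C ∧ ∀ i, ∀ y ∈ coordBox K T ρ, |f i y| ≤ C := by
  have h1 : ∀ i, ∃ C, ∀ y ∈ coordBox K T ρ, ‖f i y‖ ≤ C := fun i =>
    (isCompact_coordBox hKc T ρ).exists_bound_of_continuousOn
      ((hf i).mono (coordBox_subset hK hT hr))
  choose C hC using h1
  cases nonempty_fintype ι
  refine ⟨∑ i, |C i|, by positivity, fun i y hy => (hC i y hy).trans ((le_abs_self _).trans ?_)⟩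
  exact Finset.single_le_sum (f := fun i => |C i|) (fun i _ => abs_nonneg _) (Finset.mem_univ i)

/-- Puts the three estimates on `∂₀ g^{αβ}` in one form: each normal index is worth a factor `|yⁿ|`.
-/
theorem IsAdapted.dt_upper_le (hg : IsAdapted 𝒰 g κ T ρ Λ) (he : e ∈ 𝒰) {y : Fin (m + 2) → ℝ}
    (hy : y ∈ coordDomain e T (2 * ρ)) (α β : Fin (m + 2)) :
    |pd 0 (fun z => upper g e z α β) y| ≤ |Λ| * (vanishing y α * vanishing y β) := by
  have hle := le_abs_self Λ
  have hO := (isOpen_coordDomain e T (2 * ρ)).mem_nhds hy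
  have hsymm : pd 0 (fun z => upper g e z α β) y = pd 0 (fun z => upper g e z β α) y :=
    pd_congr (Filter.eventuallyEq_of_mem hO fun z hz =>
      upper_symm (hg.lorentzian _ (coordMap_mem_slab hz)) α β)
  induction α using Fin.lastCases with
  | last =>
    induction β using Fin.lastCases with
    | last =>
      rw [vanishing_last, abs_mul_abs_self, ← sq]
      exact (hg.dt_upper_normal e he y hy).trans (by gcongr)
    | cast b =>
      rw [hsymm, vanishing_last, vanishing_castSucc, mul_one]
      exact (hg.dt_upper_mixed e he y hy b).trans (by gcongr)
  | cast a =>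
    induction β using Fin.lastCases with
    | last =>
      rw [vanishing_last, vanishing_castSucc, one_mul]
      exact (hg.dt_upper_mixed e he y hy a).trans (by gcongr)
    | cast b =>
      rw [vanishing_castSucc, vanishing_castSucc, mul_one, mul_one]
      exact (hg.dt_upper_tan e he y hy a b).trans hle

variable [IsManifold (𝓡 m) ∞ M]

theorem IsAdapted.smoothFieldOn (hg : IsAdapted 𝒰 g κ T ρ Λ) : SmoothFieldOn g T (2 * ρ) := by
  obtain ⟨T', hT', hs, -⟩ := hg.smooth
  intro e he α β
  refine (hs e he α β).mono fun y hy => ⟨⟨by linarith [hy.1.1], by linarith [hy.1.2]⟩, hy.2⟩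

/-- The inverse metric is bounded up to `|y⁰| = T`. -/
theorem IsAdapted.exists_upper_bound (hg : IsAdapted 𝒰 g κ T ρ Λ) (h𝒰 : IsFiniteCover 𝒰)
    (he : e ∈ 𝒰) (hT : 0 < T) (hρ : 0 < ρ) {K : Set (EuclideanSpace ℝ (Fin m))}
    (hKc : IsCompact K) (hK : K ⊆ e.target) :
    ∃ C, 0 ≤ C ∧ ∀ t ∈ Ioo (-T) T, ∀ x ∈ K, ∀ z ∈ Icc (-ρ) ρ, ∀ α β,
      |upper g e (coordPoint t x z) α β| ≤ C := by
  have hem := h𝒰.smooth he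
  have hU := contDiffOn_upper hem hg.smoothFieldOn hg.lorentzian
  -- The metric is only known to be nondegenerate for `|y⁰| < T`, so compactness bounds its inverse
  -- at time `0`, and the bound on `∂₀ g^{αβ}` carries the estimate to all other times.
  obtain ⟨C, hC, hb⟩ := exists_bound_on_coordBox (T := 0) (ρ := ρ) hKc hK hT
    (by linarith : ρ < 2 * ρ) (f := fun i : Fin (m + 2) × Fin (m + 2) => fun y => upper g e y i.1 i.2)
    fun i => (hU i.1 i.2).continuousOn
  refine ⟨C + |Λ| * ((1 + ρ) * (1 + ρ)) * T, by positivity, fun t ht x hx z hz α β => ?_⟩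
  have hmem : ∀ s ∈ Ioo (-T) T, coordPoint s x z ∈ coordDomain e T (2 * ρ) := fun s hs =>
    coordPoint_mem_coordDomain.2 ⟨hs, hK hx, by linarith [hz.1], by linarith [hz.2]⟩
  have hv : ∀ s, ∀ α, vanishing (coordPoint s x z) α ≤ 1 + ρ := by
    intro s α
    unfold vanishing
    rw [coordPoint_last]
    split_ifs
    · have := abs_le.2 hz; linarith
    · linarith
  have hmv := (convex_Ioo (-T) T).norm_image_sub_le_of_norm_hasDerivWithin_le
    (f := fun s => upper g e (coordPoint s x z) α β) (x := 0) (y := t)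
    (C := |Λ| * ((1 + ρ) * (1 + ρ)))
    (fun s hs => (hasDerivAt_time (((hU α β).contDiffAt
      ((isOpen_coordDomain e T (2 * ρ)).mem_nhds (hmem s hs))).differentiableAt
        (by simp))).hasDerivWithinAt)
    (fun s hs => by
      refine (hg.dt_upper_le he (hmem s hs) α β).trans ?_
      have h1 := hv s α
      have h2 := hv s β
      have h3 := vanishing_nonneg (coordPoint s x z) β
      gcongr)
    ⟨by linarith, hT⟩ ht
  have h0 := hb (α, β) _ (coordPoint_mem_coordBox (T := 0) (t := 0) (by simp) hx hz)
  rw [Real.norm_eq_abs, Real.norm_eq_abs, sub_zero] at hmv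
  have ht' : |t| ≤ T := (abs_lt.2 ht).le
  have h3 : |Λ| * ((1 + ρ) * (1 + ρ)) * |t| ≤ |Λ| * ((1 + ρ) * (1 + ρ)) * T := by gcongr
  have h4 := abs_sub_abs_le_abs_sub (upper g e (coordPoint t x z) α β)
    (upper g e (coordPoint 0 x z) α β)
  simp only at h0
  linarith

/-- The coefficients of the equation are bounded, uniformly up to `|y⁰| = T`. -/
theorem IsAdapted.exists_coefficientBound (hg : IsAdapted 𝒰 g κ T ρ Λ) (h𝒰 : IsFiniteCover 𝒰)
    (he : e ∈ 𝒰) (hT : 0 < T) (hρ : 0 < ρ) {K : Set (EuclideanSpace ℝ (Fin m))}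
    (hKc : IsCompact K) (hK : K ⊆ e.target) :
    ∃ C, 0 ≤ C ∧ ∀ t ∈ Ioo (-T) T, ∀ x ∈ K, ∀ z ∈ Icc (-ρ) ρ,
      CoefficientBound g κ e C (coordPoint t x z) := by
  have hem := h𝒰.smooth he
  obtain ⟨C₁, hC₁, hb₁⟩ := hg.exists_upper_bound h𝒰 he hT hρ hKc hK
  obtain ⟨T', hT', hs, hκs⟩ := hg.smooth
  obtain ⟨B, hB⟩ := hg.bounded
  have hO' := isOpen_coordDomain e T' (2 * ρ)
  have hρ2 : ρ < 2 * ρ := by linarith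
  have hdetc := contDiffOn_det (hs e hem)
  -- The components `g_{αβ}` and `κ` are smooth past `|y⁰| = T`, so compactness bounds their
  -- derivatives on the closed box.
  obtain ⟨C₂, hC₂, hb₂⟩ := exists_bound_on_coordBox (T := T) (ρ := ρ) hKc hK hT' hρ2
    (f := fun α => pd α fun y => (lower g e y).det) fun α =>
      (contDiffOn_pd hO' hdetc α).continuousOn
  have hκc := contDiffOn_comp_coordMap hem hκs
  obtain ⟨C₃, hC₃, hb₃⟩ := exists_bound_on_coordBox (T := T) (ρ := ρ) hKc hK hT' hρ2
    (f := fun _ : Unit => pd (Fin.last (m + 1)) (κ ∘ coordMap e)) fun _ =>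
      (contDiffOn_pd hO' hκc _).continuousOn
  -- The Leibniz expansion of the determinant of the inverse metric, an `(m + 2) × (m + 2)` matrix
  -- with entries at most `C₁`.
  set C₄ : ℝ := (Nat.factorial (m + 2)) * C₁ ^ (m + 2) with hC₄
  set C₅ : ℝ := (m + 2) * (C₂ * C₄ / 2 * C₁) with hC₅
  have hC₄' : 0 ≤ C₄ := by positivity
  have hC₅' : 0 ≤ C₅ := by positivity
  have hl := le_abs_self Λ
  have hΛ := abs_nonneg Λ
  have hBa := le_abs_self B
  have hBn := abs_nonneg B
  have hΛρ : 0 ≤ |Λ| * ρ ^ 2 := by positivity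
  refine ⟨C₁ + |Λ| + |Λ| * ρ ^ 2 + C₅ + C₃ + |B|, by positivity, fun t ht x hx z hz => ?_⟩
  set C := C₁ + |Λ| + |Λ| * ρ ^ 2 + C₅ + C₃ + |B| with hC
  have hzρ : |z| ≤ ρ := abs_le.2 hz
  have hmem : ∀ w ∈ Icc (-ρ) ρ, coordPoint t x w ∈ coordDomain e T (2 * ρ) := fun w hw =>
    coordPoint_mem_coordDomain.2 ⟨ht, hK hx, by linarith [hw.1], by linarith [hw.2]⟩
  have hbox : ∀ w ∈ Icc (-ρ) ρ, coordPoint t x w ∈ coordBox K T ρ := fun w hw =>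
    coordPoint_mem_coordBox ⟨ht.1.le, ht.2.le⟩ hx hw
  have hmem' : ∀ w ∈ Icc (-ρ) ρ, coordPoint t x w ∈ coordDomain e T' (2 * ρ) := fun w hw =>
    coordBox_subset hK hT' hρ2 (hbox w hw)
  set y := coordPoint t x z with hy
  have hyn : y (Fin.last (m + 1)) = z := coordPoint_last _ _ _
  have hyd := hmem z hz
  have hL := hg.lorentzian _ (coordMap_mem_slab hyd)
  have hsymm := upper_symm hL
  have hub := hb₁ t ht x hx z hz
  -- the density
  have hdet := det_lower_neg hem hyd.2.1 hL
  have hSpos := sqrtDet_pos hem hg.lorentzian hyd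
  have hdS : ∀ α, |pd α (sqrtDet g e) y / sqrtDet g e y| ≤ C₂ * C₄ / 2 := by
    intro α
    have hda : DifferentiableAt ℝ (fun y => (lower g e y).det) y :=
      (hdetc.contDiffAt (hO'.mem_nhds (hmem' z hz))).differentiableAt (by simp)
    have h1 : HasFDerivAt (sqrtDet g e)
        ((1 / (2 * √(-(lower g e y).det))) • -fderiv ℝ (fun y => (lower g e y).det) y) y :=
      hda.hasFDerivAt.neg.sqrt (neg_pos.2 hdet).ne'
    have h2 : pd α (sqrtDet g e) y
        = -(1 / (2 * sqrtDet g e y)) * pd α (fun y => (lower g e y).det) y := by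
      unfold pd
      rw [h1.fderiv]
      simp [sqrtDet]
    have h3 : sqrtDet g e y ^ 2 = -(lower g e y).det := Real.sq_sqrt (by linarith)
    have h4 : pd α (sqrtDet g e) y / sqrtDet g e y
        = pd α (fun y => (lower g e y).det) y * (upper g e y).det / 2 := by
      have h5 : (upper g e y).det = ((lower g e y).det)⁻¹ := by
        rw [upper, Matrix.det_nonsing_inv, Ring.inverse_eq_inv']
      have h6 : (lower g e y).det = -sqrtDet g e y ^ 2 := by linarith
      rw [h2, h5, h6]
      field_simp
    rw [h4, abs_div, abs_mul, abs_of_pos (by norm_num : (0 : ℝ) < 2)]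
    have h7 := hb₂ α y (hbox z hz)
    have h8 : |(upper g e y).det| ≤ C₄ := by
      have := Matrix.det_le (A := upper g e y) (abv := IsAbsoluteValue.toAbsoluteValue (abs : ℝ → ℝ))
        (x := C₁) hub
      simpa [hC₄] using this
    gcongr
  have hlog : ∀ β, |logDensityGrad g e y β| ≤ C₅ := by
    intro β
    refine (Finset.abs_sum_le_sum_abs _ _).trans ?_
    calc ∑ α, |pd α (sqrtDet g e) y / sqrtDet g e y * upper g e y α β|
        ≤ ∑ _α : Fin (m + 2), C₂ * C₄ / 2 * C₁ := by
          refine Finset.sum_le_sum fun α _ => ?_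
          rw [abs_mul]
          exact mul_le_mul (hdS α) (hub α β) (abs_nonneg _) (by positivity)
      _ = C₅ := by simp [hC₅]
  constructor
  · intro a β
    induction β using Fin.lastCases with
    | last =>
      rw [vanishing_last]
      exact (hg.upper_mixed e he y hyd a).trans (by gcongr; linarith)
    | cast b =>
      rw [vanishing_castSucc, mul_one]
      exact (hub _ _).trans (by linarith)
  · intro β
    rw [abs_mul]
    induction β using Fin.lastCases with
    | last =>
      rw [vanishing_last, mul_comm]
      exact mul_le_mul_of_nonneg_right ((hub _ _).trans (by linarith)) (abs_nonneg _)
    | cast b =>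
      rw [vanishing_castSucc, hsymm]
      have h1 := hg.upper_mixed e he y hyd b
      rw [hyn] at h1 ⊢
      calc |z| * |upper g e y b.castSucc (Fin.last (m + 1))| ≤ ρ * (|Λ| * ρ) := by
            refine mul_le_mul hzρ (h1.trans ?_) (abs_nonneg _) hρ.le
            exact mul_le_mul hl hzρ (abs_nonneg _) hΛ
        _ = |Λ| * ρ ^ 2 := by ring
        _ ≤ C * 1 := by linarith
  · intro α β
    refine (hg.dt_upper_le he hyd α β).trans ?_
    have h1 := vanishing_nonneg y α
    have h2 := vanishing_nonneg y β
    gcongr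
    linarith
  · intro a
    exact (hlog _).trans (by linarith)
  · have h1 := hg.curvature₂ e he y hyd
    have h2 : -1 / sqrtDet g e y * (∑ α, upper g e y (Fin.last (m + 1)) α * pd α (sqrtDet g e) y)
        = -logDensityGrad g e y (Fin.last (m + 1)) := by
      rw [logDensityGrad, Finset.mul_sum, ← Finset.sum_neg_distrib]
      refine Finset.sum_congr rfl fun α _ => ?_
      rw [hsymm]; ring
    rw [h2, hy, toHypersurface_coordPoint, ← hy, hyn] at h1
    -- The hypothesis involves `κ` at the projection to `{yⁿ = 0}`. The mean value theorem moves it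
    -- to the point itself at the price of another `O(|yⁿ|)`.
    have hmv := (convex_Icc (-ρ) ρ).norm_image_sub_le_of_norm_hasDerivWithin_le
      (f := fun w => (κ ∘ coordMap e) (coordPoint t x w)) (x := 0) (y := z) (C := C₃)
      (fun w hw => (hasDerivAt_normal ((hκc.contDiffAt
        (hO'.mem_nhds (hmem' w hw))).differentiableAt (by simp))).hasDerivWithinAt)
      (fun w hw => hb₃ () _ (hbox w hw)) ⟨by linarith, hρ.le⟩ hz
    rw [Real.norm_eq_abs, Real.norm_eq_abs, sub_zero] at hmv
    simp only [Function.comp_apply] at hmv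
    rw [← hy] at hmv
    rw [hyn]
    have h5 : logDensityGrad g e y (Fin.last (m + 1)) - κ (coordMap e y)
        = -(-logDensityGrad g e y (Fin.last (m + 1)) - -κ (coordMap e (coordPoint t x 0)))
          - (κ (coordMap e y) - κ (coordMap e (coordPoint t x 0))) := by ring
    rw [h5]
    refine (abs_sub _ _).trans ?_
    rw [abs_neg]
    have h6 : Λ * |z| ≤ |Λ| * |z| := by gcongr
    have h7 : 0 ≤ (C - |Λ| - C₃) * |z| := mul_nonneg (by linarith) (abs_nonneg _)
    linarith
  · exact (hB _ (coordMap_mem_slab hyd)).trans (by linarith)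

end CoefficientBounds

/-! ### The energy inequality in a chart -/

section ChartEnergy

variable {m : ℕ} {M : Type*} [TopologicalSpace M] [ChartedSpace (EuclideanSpace ℝ (Fin m)) M]
  {𝒰 : Set (Chart m M)} {g : BilinField m M} {κ : ℝ × M × ℝ → ℝ} {F : ℝ → ℝ}
  {v : ℝ × M × ℝ → ℝ} {T r ρ Λ ε c₂ c₃ c₄ c₅ : ℝ} {e : Chart m M}

/-- The density of the part of the energy which measures the deviation of `v` from an optimal
profile in the normal direction. -/
def excessDensity (g : BilinField m M) (F : ℝ → ℝ) (ε : ℝ) (v : ℝ × M × ℝ → ℝ)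
    (p : ℝ × M × ℝ) : ℝ :=
  ε / 2 * aGradTan g v p + p.2.2 ^ 2 * (ε / 2 * |normalDeriv v p| ^ 2 + 1 / ε * F (v p))
    + (ε * normalDeriv v p - f1 F (v p)) ^ 2 / ε

/-- The excess density in the coordinates given by `e`. -/
def chartExcess (g : BilinField m M) (F : ℝ → ℝ) (ε : ℝ) (e : Chart m M) (v : ℝ × M × ℝ → ℝ)
    (y : Fin (m + 2) → ℝ) : ℝ :=
  ε / 2 * aFormTan g e y (chartGrad e v y)
    + y (Fin.last (m + 1)) ^ 2 * (ε / 2 * chartGrad e v y (Fin.last (m + 1)) ^ 2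
      + 1 / ε * F (v (coordMap e y)))
    + (ε * chartGrad e v y (Fin.last (m + 1)) - f1 F (v (coordMap e y))) ^ 2 / ε

theorem abs_mul_le_sum_sq {n : Type*} [Fintype n] (a : n → ℝ) (i j : n) :
    |a i * a j| ≤ ∑ k, a k ^ 2 := by
  have hi := Finset.single_le_sum (f := fun k => a k ^ 2) (fun k _ => sq_nonneg _)
    (Finset.mem_univ i)
  have hj := Finset.single_le_sum (f := fun k => a k ^ 2) (fun k _ => sq_nonneg _)
    (Finset.mem_univ j)
  rw [abs_le]
  constructor <;> nlinarith [sq_nonneg (a i + a j), sq_nonneg (a i - a j)]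

/-- The sum of the squares of the components of `∇v`, the normal one being weighted by `yⁿ`. -/
def weightedGradSq (e : Chart m M) (v : ℝ × M × ℝ → ℝ) (y : Fin (m + 2) → ℝ) : ℝ :=
  ∑ α, (vanishing y α * chartGrad e v y α) ^ 2

theorem weightedGradSq_nonneg (y : Fin (m + 2) → ℝ) : 0 ≤ weightedGradSq e v y :=
  Finset.sum_nonneg fun _ _ => sq_nonneg _

theorem abs_grad_mul_le (y : Fin (m + 2) → ℝ) (α β : Fin (m + 2)) :
    vanishing y α * vanishing y β * |chartGrad e v y α * chartGrad e v y β|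
      ≤ weightedGradSq e v y := by
  have := abs_mul_le_sum_sq (fun α => vanishing y α * chartGrad e v y α) α β
  refine le_trans (le_of_eq ?_) this
  rw [abs_mul, abs_mul, abs_mul, abs_mul, abs_of_nonneg (vanishing_nonneg y α),
    abs_of_nonneg (vanishing_nonneg y β)]
  ring

/-- The mechanism behind all error estimates: a coefficient with one factor `|yⁿ|` per normal index,
applied to two derivatives of `v`, is bounded by the weighted gradient. -/
theorem abs_coeff_mul_le {y : Fin (m + 2) → ℝ} {α β : Fin (m + 2)} {b : ℝ} (hΛ : 0 ≤ Λ)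
    (hb : |b| ≤ Λ * (vanishing y α * vanishing y β)) :
    |b * (chartGrad e v y α * chartGrad e v y β)| ≤ Λ * weightedGradSq e v y := by
  rw [abs_mul]
  calc |b| * |chartGrad e v y α * chartGrad e v y β|
      ≤ Λ * (vanishing y α * vanishing y β) * |chartGrad e v y α * chartGrad e v y β| := by gcongr
    _ = Λ * (vanishing y α * vanishing y β * |chartGrad e v y α * chartGrad e v y β|) := by ring
    _ ≤ _ := by gcongr; exact abs_grad_mul_le y α β

theorem CoefficientBound.abs_energyFlux_le {y : Fin (m + 2) → ℝ}
    (hy : CoefficientBound g κ e Λ y) (hΛ : 0 ≤ Λ) (a : Fin (m + 1)) :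
    |energyFlux g e v a.castSucc y| ≤ (m + 2) * (Λ * weightedGradSq e v y) := by
  rw [energyFlux, Finset.sum_mul]
  refine (Finset.abs_sum_le_sum_abs _ _).trans ?_
  refine (Finset.sum_le_sum (g := fun _ => Λ * weightedGradSq e v y) fun β _ => ?_).trans
    (by simp)
  rw [mul_assoc]
  refine abs_coeff_mul_le hΛ ?_
  rw [vanishing_zero, mul_one]
  exact hy.upper a β

/-- Without the factor `yⁿ` this would fail, since `g^{nn}` is close to `1` and `∂ₙv ∂₀v` is not
small. The factor is supplied by the derivative of the weight `1 + c₂ (yⁿ)²`. -/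
theorem CoefficientBound.abs_mul_energyFlux_le {y : Fin (m + 2) → ℝ}
    (hy : CoefficientBound g κ e Λ y) (hΛ : 0 ≤ Λ) :
    |y (Fin.last (m + 1)) * energyFlux g e v (Fin.last (m + 1)) y|
      ≤ (m + 2) * (Λ * weightedGradSq e v y) := by
  rw [energyFlux, Finset.sum_mul, Finset.mul_sum]
  refine (Finset.abs_sum_le_sum_abs _ _).trans ?_
  refine (Finset.sum_le_sum (g := fun _ => Λ * weightedGradSq e v y) fun β _ => ?_).trans
    (by simp)
  rw [mul_assoc, ← mul_assoc]
  refine abs_coeff_mul_le hΛ ?_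
  rw [vanishing_zero, mul_one]
  exact hy.upper_normal β

theorem CoefficientBound.abs_dt_upper_le {y : Fin (m + 2) → ℝ}
    (hy : CoefficientBound g κ e Λ y) (hΛ : 0 ≤ Λ) :
    |∑ α, ∑ β, pd 0 (fun z => AcceleratingFronts.upper g e z α β) y * chartGrad e v y α
      * chartGrad e v y β| ≤ (m + 2) * ((m + 2) * (Λ * weightedGradSq e v y)) := by
  refine (Finset.abs_sum_le_sum_abs _ _).trans ?_
  refine (Finset.sum_le_sum (g := fun _ => (m + 2) * (Λ * weightedGradSq e v y))
    fun α _ => ?_).trans (by simp)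
  refine (Finset.abs_sum_le_sum_abs _ _).trans ?_
  refine (Finset.sum_le_sum (g := fun _ => Λ * weightedGradSq e v y) fun β _ => ?_).trans
    (by simp)
  rw [mul_assoc]
  exact abs_coeff_mul_le hΛ (hy.dt_upper α β)

/-- The key cancellation. The normal logarithmic derivative of the density is `κ + O(|yⁿ|)`. Its
leading part combines with the forcing into `κ ∂₀v (ε ∂ₙv - f₁(v))`, a product of two quantities
whose squares are controlled; the rest is covered by the weighted gradient. The count `m + 3` is `m
+ 1` tangential terms, the remainder of the normal one, and the combined term. -/
theorem CoefficientBound.abs_forcing_le {y : Fin (m + 2) → ℝ}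
    (hy : CoefficientBound g κ e Λ y) (hΛ : 0 ≤ Λ) (hε : 0 < ε) :
    |chartGrad e v y 0 * (ε * ∑ β, logDensityGrad g e y β * chartGrad e v y β
        - κ (coordMap e y) * f1 F (v (coordMap e y)))|
      ≤ (m + 3) * Λ * (ε * weightedGradSq e v y
        + (ε * chartGrad e v y (Fin.last (m + 1)) - f1 F (v (coordMap e y))) ^ 2 / ε) := by
  set n := Fin.last (m + 1)
  set X := weightedGradSq e v y with hX
  set f := f1 F (v (coordMap e y))
  set ξ := chartGrad e v y with hξ
  set k := κ (coordMap e y)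
  set G := (ε * ξ n - f) ^ 2 / ε with hG
  have hX0 : 0 ≤ X := weightedGradSq_nonneg y
  have hG0 : 0 ≤ G := by positivity
  have h1 : |∑ a : Fin (m + 1), logDensityGrad g e y a.castSucc * (ξ a.castSucc * ξ 0)|
      ≤ (m + 1) * (Λ * X) := by
    refine (Finset.abs_sum_le_sum_abs _ _).trans ?_
    refine (Finset.sum_le_sum (g := fun _ => Λ * X) fun a _ => ?_).trans (by simp)
    refine abs_coeff_mul_le hΛ ?_
    rw [vanishing_zero, vanishing_castSucc, mul_one, mul_one]
    exact hy.logDensity a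
  have h2 : |(logDensityGrad g e y n - k) * (ξ n * ξ 0)| ≤ Λ * X := by
    refine abs_coeff_mul_le hΛ ?_
    rw [vanishing_zero, vanishing_last, mul_one]
    exact hy.logDensity_normal
  have h3 : |k * (ξ 0 * (ε * ξ n - f))| ≤ Λ * (ε * X + G) := by
    rw [abs_mul]
    refine mul_le_mul hy.curvature ?_ (abs_nonneg _) hΛ
    have h4 : ξ 0 ^ 2 ≤ X := by
      have := abs_grad_mul_le (e := e) (v := v) y 0 0
      rw [vanishing_zero, one_mul, one_mul, ← sq, abs_of_nonneg (sq_nonneg _)] at this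
      exact this
    have h5 : ε * ξ 0 ^ 2 ≤ ε * X := by gcongr
    -- Young's inequality with the scale `ε`: writing the defect as `ε q`, both squares carry
    -- exactly one factor `ε`.
    have h6 : |ξ 0 * (ε * ξ n - f)| ≤ ε * ξ 0 ^ 2 + G := by
      have e1 : (ε * ξ n - f) = (ε * ξ n - f) / ε * ε := by field_simp
      set q := (ε * ξ n - f) / ε with hq
      have e2 : G = ε * q ^ 2 := by rw [hG, e1]; field_simp
      rw [e2, e1, abs_le]
      constructor <;> nlinarith [mul_nonneg hε.le (sq_nonneg (ξ 0 + q)),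
        mul_nonneg hε.le (sq_nonneg (ξ 0 - q)), mul_nonneg hε.le (sq_nonneg (ξ 0)),
        mul_nonneg hε.le (sq_nonneg q)]
    linarith
  have e1 : ξ 0 * (ε * ∑ β, logDensityGrad g e y β * ξ β - k * f)
      = ε * (∑ a : Fin (m + 1), logDensityGrad g e y a.castSucc * (ξ a.castSucc * ξ 0))
        + ε * ((logDensityGrad g e y n - k) * (ξ n * ξ 0)) + k * (ξ 0 * (ε * ξ n - f)) := by
    rw [Fin.sum_univ_castSucc]
    have : ∑ a : Fin (m + 1), logDensityGrad g e y a.castSucc * (ξ a.castSucc * ξ 0)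
        = (∑ a : Fin (m + 1), logDensityGrad g e y a.castSucc * ξ a.castSucc) * ξ 0 := by
      rw [Finset.sum_mul]
      exact Finset.sum_congr rfl fun a _ => by ring
    rw [this]; ring
  rw [e1]
  refine (abs_add_three _ _ _).trans ?_
  rw [abs_mul ε, abs_mul ε, abs_of_pos hε]
  have k1 := mul_le_mul_of_nonneg_left h1 hε.le
  have k2 := mul_le_mul_of_nonneg_left h2 hε.le
  have k3 : 0 ≤ (m + 2) * Λ * G := by positivity
  linarith

/-- Coercivity of the tangential form handles the tangential squares at the cost of `c₄`. The
weighted normal square and the defect already occur in the excess. -/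
theorem weightedGradSq_le (hF : IsDoubleWell F) (hc : AreEnergyConstants 𝒰 g T ρ c₂ c₃ c₄ c₅)
    (he : e ∈ 𝒰) (hε : 0 < ε) {y : Fin (m + 2) → ℝ} (hy : y ∈ coordDomain e T (2 * ρ)) :
    ε * weightedGradSq e v y
        + (ε * chartGrad e v y (Fin.last (m + 1)) - f1 F (v (coordMap e y))) ^ 2 / ε
      ≤ (2 * c₄ + 3) * chartExcess g F ε e v y := by
  have h1 := hc.coercive e he y hy (chartGrad e v y)
  have h2 : weightedGradSq e v y = (∑ a : Fin (m + 1), chartGrad e v y a.castSucc ^ 2)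
      + y (Fin.last (m + 1)) ^ 2 * chartGrad e v y (Fin.last (m + 1)) ^ 2 := by
    rw [weightedGradSq, Fin.sum_univ_castSucc]
    simp only [vanishing_castSucc, one_mul, vanishing_last, mul_pow, sq_abs]
  have hFn := hF.nonneg (v (coordMap e y))
  have h4 := hc.pos₄
  have ha : 0 ≤ aFormTan g e y (chartGrad e v y) := by
    have : 0 ≤ ∑ a : Fin (m + 1), chartGrad e v y a.castSucc ^ 2 :=
      Finset.sum_nonneg fun _ _ => sq_nonneg _
    by_contra hneg
    push Not at hneg
    nlinarith
  rw [h2]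
  unfold chartExcess
  set A := aFormTan g e y (chartGrad e v y)
  set D := ∑ a : Fin (m + 1), chartGrad e v y a.castSucc ^ 2
  set p := chartGrad e v y (Fin.last (m + 1))
  set z := y (Fin.last (m + 1))
  set G := (ε * p - f1 F (v (coordMap e y))) ^ 2 / ε with hG
  have hG0 : 0 ≤ G := by positivity
  have k1 : ε * D ≤ ε * (c₄ * A) := by gcongr
  have k2 : 0 ≤ z ^ 2 * (1 / ε * F (v (coordMap e y))) := by positivity
  have k3 : 0 ≤ z ^ 2 * (ε * p ^ 2) := by positivity
  have k4 : 0 ≤ ε * A := by positivity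
  have k5 : 0 ≤ c₄ * (z ^ 2 * (1 / ε * F (v (coordMap e y)))) := by positivity
  have k6 : 0 ≤ c₄ * (z ^ 2 * (ε * p ^ 2)) := by positivity
  have k7 : 0 ≤ c₄ * G := by positivity
  nlinarith

/-- Collects the sources of the localized energy: `a` stands for the cutoff, `W` for the weight and
`d` for the derivatives of the cutoff. The constant has one summand for each of interior source,
derivative of the weight, and derivative of the cutoff. -/
theorem CoefficientBound.source_le {y : Fin (m + 2) → ℝ} (hcb : CoefficientBound g κ e Λ y)
    (hΛ : 0 ≤ Λ) (hε0 : 0 < ε) {a Φ Φ' W Wm c : ℝ} {d : Fin m → ℝ} (ha : |a| ≤ Φ) (hΦ0 : 0 ≤ Φ)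
    (hd : ∀ i, |d i| ≤ Φ') (hΦ'0 : 0 ≤ Φ') (hW0 : 0 ≤ W) (hW : W ≤ Wm) (hc : 0 ≤ c) :
    a * (W * (ε / 2 * (∑ α, ∑ β, pd 0 (fun z => AcceleratingFronts.upper g e z α β) y
        * chartGrad e v y α * chartGrad e v y β)
      + chartGrad e v y 0 * (ε * ∑ β, logDensityGrad g e y β * chartGrad e v y β
          - κ (coordMap e y) * f1 F (v (coordMap e y)))))
        - a * c * (ε * (y (Fin.last (m + 1)) * energyFlux g e v (Fin.last (m + 1)) y))
        - W * ∑ i : Fin m, d i * (ε * energyFlux g e v i.succ.castSucc y)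
      ≤ (Φ * Wm * ((m + 2) * ((m + 2) * Λ) + (m + 3) * Λ)
    + Φ * c * ((m + 2) * Λ) + Wm * (m * (Φ' * ((m + 2) * Λ)))) * (ε * weightedGradSq e v y
        + (ε * chartGrad e v y (Fin.last (m + 1)) - f1 F (v (coordMap e y))) ^ 2 / ε) := by
  have hWm0 : 0 ≤ Wm := hW0.trans hW
  set n := Fin.last (m + 1) with hn
  set R := ε / 2 * (∑ α, ∑ β, pd 0 (fun z => AcceleratingFronts.upper g e z α β) y
        * chartGrad e v y α * chartGrad e v y β)
      + chartGrad e v y 0 * (ε * ∑ β, logDensityGrad g e y β * chartGrad e v y β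
          - κ (coordMap e y) * f1 F (v (coordMap e y))) with hR
  set G := (ε * chartGrad e v y n - f1 F (v (coordMap e y))) ^ 2 / ε with hG
  set X := weightedGradSq e v y with hX
  set Y := ε * X + G with hY
  have hX0 : 0 ≤ X := weightedGradSq_nonneg y
  have hG0 : 0 ≤ G := by positivity
  have hXY : ε * X ≤ Y := by linarith
  have hY0 : 0 ≤ Y := by positivity
  have b1 : |R| ≤ ((m + 2) * ((m + 2) * Λ) + (m + 3) * Λ) * Y := by
    have h1 := hcb.abs_dt_upper_le (v := v) hΛ
    have h2 := hcb.abs_forcing_le (F := F) (v := v) hΛ hε0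
    rw [← hn, ← hG, ← hX, ← hY] at h2
    rw [← hX] at h1
    have h3 : |ε / 2 * (∑ α, ∑ β, pd 0 (fun z => AcceleratingFronts.upper g e z α β) y
        * chartGrad e v y α * chartGrad e v y β)| ≤ (m + 2) * ((m + 2) * Λ) * Y := by
      rw [abs_mul, abs_of_pos (by positivity : 0 < ε / 2)]
      calc _ ≤ ε / 2 * ((m + 2) * ((m + 2) * (Λ * X))) := by gcongr
        _ ≤ ε * ((m + 2) * ((m + 2) * (Λ * X))) := by gcongr; linarith
        _ = (m + 2) * ((m + 2) * Λ) * (ε * X) := by ring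
        _ ≤ _ := by gcongr
    calc |R| ≤ _ := abs_add_le _ _
      _ ≤ (m + 2) * ((m + 2) * Λ) * Y + (m + 3) * Λ * Y := add_le_add h3 h2
      _ = _ := by ring
  have b2 : |a * (W * R)|
      ≤ Φ * Wm * ((m + 2) * ((m + 2) * Λ) + (m + 3) * Λ) * Y := by
    rw [abs_mul, abs_mul, abs_of_nonneg hW0]
    calc _ ≤ Φ * (Wm * (((m + 2) * ((m + 2) * Λ) + (m + 3) * Λ) * Y)) := by
          refine mul_le_mul ha (mul_le_mul hW b1 (abs_nonneg _) hWm0) (by positivity) hΦ0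
      _ = _ := by ring
  have b3 : |a * c * (ε * (y n * energyFlux g e v n y))|
      ≤ Φ * c * ((m + 2) * Λ) * Y := by
    have h1 := hcb.abs_mul_energyFlux_le (v := v) hΛ
    rw [← hn, ← hX] at h1
    rw [abs_mul, abs_mul, abs_mul ε, abs_of_pos hε0, abs_of_nonneg hc]
    calc _ ≤ Φ * c * (ε * ((m + 2) * (Λ * X))) := by
          gcongr
      _ = Φ * c * ((m + 2) * Λ) * (ε * X) := by ring
      _ ≤ _ := by gcongr
  have b4 : |W * ∑ i : Fin m, d i
          * (ε * energyFlux g e v i.succ.castSucc y)|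
      ≤ Wm * (m * (Φ' * ((m + 2) * Λ))) * Y := by
    have h1 : |∑ i : Fin m, d i
          * (ε * energyFlux g e v i.succ.castSucc y)| ≤ m * (Φ' * ((m + 2) * Λ) * Y) := by
      refine (Finset.abs_sum_le_sum_abs _ _).trans ?_
      refine (Finset.sum_le_sum (g := fun _ => Φ' * ((m + 2) * Λ) * Y) fun i _ => ?_).trans
        (by simp)
      have h2 := hcb.abs_energyFlux_le (v := v) hΛ i.succ
      rw [← hX] at h2
      have h3 := hd i
      rw [abs_mul, abs_mul ε, abs_of_pos hε0]
      calc _ ≤ Φ' * (ε * ((m + 2) * (Λ * X))) := by gcongr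
        _ = Φ' * ((m + 2) * Λ) * (ε * X) := by ring
        _ ≤ _ := by gcongr
    rw [abs_mul, abs_of_nonneg hW0]
    calc _ ≤ Wm * (m * (Φ' * ((m + 2) * Λ) * Y)) :=
          mul_le_mul hW h1 (abs_nonneg _) hWm0
      _ = _ := by ring
  have c1 := (abs_le.1 b2).2
  have c2' := (abs_le.1 b3).1
  have c3' := (abs_le.1 b4).1
  linarith

theorem pd_comp_middle {φ : EuclideanSpace ℝ (Fin m) → ℝ} (hφ : ContDiff ℝ ∞ φ)
    (y : Fin (m + 2) → ℝ) (α : Fin (m + 2)) :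
    pd α (fun y : Fin (m + 2) → ℝ => φ (middle y)) y
      = fderiv ℝ φ (middle y) (middle (Pi.single α 1)) := by
  have hlin : HasFDerivAt (middle (m := m)) (fderiv ℝ (middle (m := m)) y) y :=
    ((contDiff_middle (n := 1)).differentiable (by norm_num) y).hasFDerivAt
  have h1 : fderiv ℝ (middle (m := m)) y (Pi.single α 1) = middle (Pi.single α 1) := by
    have h2 : HasDerivAt (fun h : ℝ => y + h • (Pi.single α 1 : Fin (m + 2) → ℝ))
        (Pi.single α 1) 0 := by
      simpa using ((hasDerivAt_id (0 : ℝ)).smul_const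
        (Pi.single α 1 : Fin (m + 2) → ℝ)).const_add y
    have h3 : HasFDerivAt (middle (m := m)) (fderiv ℝ (middle (m := m)) y)
        (y + (0 : ℝ) • (Pi.single α 1 : Fin (m + 2) → ℝ)) := by simpa using hlin
    have h4 := h3.comp_hasDerivAt 0 h2
    have h5 : HasDerivAt (middle (m := m) ∘ fun h : ℝ =>
        y + h • (Pi.single α 1 : Fin (m + 2) → ℝ)) (middle (Pi.single α 1)) 0 := by
      have e1 : (middle (m := m) ∘ fun h : ℝ => y + h • (Pi.single α 1 : Fin (m + 2) → ℝ))
          = fun h : ℝ => middle y + h • middle (Pi.single α 1) := by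
        funext h; ext i; simp [middle]
      rw [e1]
      simpa using ((hasDerivAt_id (0 : ℝ)).smul_const
        (middle (m := m) (Pi.single α 1))).const_add (middle y)
    exact h4.unique h5
  have h2 := (((hφ.differentiable (by simp)) (middle y)).hasFDerivAt).comp y hlin
  unfold pd
  have h3 : HasFDerivAt (fun y : Fin (m + 2) → ℝ => φ (middle y)) _ y := h2
  rw [h3.fderiv, ContinuousLinearMap.comp_apply, h1]

theorem pd_weight (c : ℝ) (y : Fin (m + 2) → ℝ) (α : Fin (m + 2)) :
    pd α (fun y : Fin (m + 2) → ℝ => 1 + c * y (Fin.last (m + 1)) ^ 2) y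
      = c * (2 * y (Fin.last (m + 1))) * (Pi.single α 1 : Fin (m + 2) → ℝ) (Fin.last (m + 1)) := by
  set n := Fin.last (m + 1)
  have h1 : HasFDerivAt (fun y : Fin (m + 2) → ℝ => 1 + c * y n ^ 2)
      (c • ((2 * y n ^ (2 - 1)) • ContinuousLinearMap.proj (R := ℝ) (φ := fun _ => ℝ) n)) y := by
    have := (((hasFDerivAt_apply (𝕜 := ℝ) n y).pow 2).const_mul c).const_add 1
    convert! this using 1
    simp
  unfold pd
  rw [h1.fderiv]
  simp; ring

variable [IsManifold (𝓡 m) ∞ M]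

/-- The product vanishes near every point outside the chart, so it extends smoothly to all middle
coordinates, whatever the values of `f` there. -/
theorem contDiffOn_cutoff_mul {φ : EuclideanSpace ℝ (Fin m) → ℝ} (hφ : ContDiff ℝ ∞ φ)
    (hφt : tsupport φ ⊆ e.target) {f : (Fin (m + 2) → ℝ) → ℝ}
    (hf : ContDiffOn ℝ ∞ f (coordDomain e T r)) :
    ContDiffOn ℝ ∞ (fun y => φ (middle y) * f y) (coordSlab m T r) := by
  intro y hy
  apply ContDiffAt.contDiffWithinAt
  by_cases hm : middle y ∈ e.target
  · exact (hφ.comp contDiff_middle).contDiffAt.mul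
      (hf.contDiffAt ((isOpen_coordDomain e T r).mem_nhds ⟨hy.1, hm, hy.2⟩))
  · have h0 : (fun y => φ (middle y) * f y) =ᶠ[nhds y] fun _ => 0 := by
      have hn : middle ⁻¹' (tsupport φ)ᶜ ∈ nhds y :=
        ((isClosed_tsupport φ).isOpen_compl.preimage continuous_middle).mem_nhds
          fun h => hm (hφt h)
      filter_upwards [hn] with z hz
      rw [image_eq_zero_of_notMem_tsupport hz, zero_mul]
    exact contDiffAt_const.congr_of_eventuallyEq h0

theorem continuousOn_chartExcess (hF : IsDoubleWell F)
    (he : e ∈ IsManifold.maximalAtlas (𝓡 m) ∞ M) (hg : SmoothFieldOn g T r)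
    (hL : ∀ p ∈ slab M T r, IsLorentzian (g p))
    (hv : ContMDiffOn (model m) 𝓘(ℝ, ℝ) ∞ v (slab M T r)) :
    ContinuousOn (chartExcess g F ε e v) (coordDomain e T r) := by
  have h1 : ContinuousOn (fun y => aFormTan g e y (chartGrad e v y)) (coordDomain e T r) := by
    simp_rw [aFormTan_eq]
    refine (contDiffOn_aForm he hg hL fun α => ?_).continuousOn
    exact (contDiffOn_chartGrad he hv α).sub
      ((contDiffOn_chartGrad he hv _).mul contDiffOn_const)
  have h2 := (contDiffOn_chartGrad he hv (Fin.last (m + 1))).continuousOn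
  have h3 := (contDiffOn_comp_coordMap he hv).continuousOn
  have h4 : ContinuousOn (fun y => F (v (coordMap e y))) (coordDomain e T r) :=
    hF.smooth.continuous.comp_continuousOn h3
  have h5 : ContinuousOn (fun y => f1 F (v (coordMap e y))) (coordDomain e T r) :=
    hF.continuous_f1.comp_continuousOn h3
  have h6 : ContinuousOn (fun y : Fin (m + 2) → ℝ => y (Fin.last (m + 1))) (coordDomain e T r) :=
    (continuous_apply _).continuousOn
  exact ((continuousOn_const.mul h1).add ((h6.pow 2).mul ((continuousOn_const.mul (h2.pow 2)).add
    (continuousOn_const.mul h4)))).add ((((continuousOn_const.mul h2).sub h5).pow 2).div_const ε)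

/-- The energy inequality localized by a cutoff in a chart. -/
theorem exists_chart_energy_le (hF : IsDoubleWell F) (h𝒰 : IsFiniteCover 𝒰)
    (hg : IsAdapted 𝒰 g κ T ρ Λ) (hc : AreEnergyConstants 𝒰 g T ρ c₂ c₃ c₄ c₅) (hT : 0 < T)
    (hρ : 0 < ρ) (he : e ∈ 𝒰) {φ : EuclideanSpace ℝ (Fin m) → ℝ} (hφ : ContDiff ℝ ∞ φ)
    (hφc : HasCompactSupport φ) (hφt : tsupport φ ⊆ e.target) (hφ0 : ∀ x, 0 ≤ φ x) :
    ∃ C, 0 ≤ C ∧ ∀ ε ∈ Ioc (0 : ℝ) 1, ∀ v, IsSmoothSolution g κ F ε T (2 * ρ) v →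
      ∀ s, 0 ≤ s → s < T → c₅ * s < ρ →
      (∫ x, ∫ w in (-1 : ℝ)..1, (ρ - c₅ * s) * (φ x * ((1 + c₂ * ((ρ - c₅ * s) * w) ^ 2)
          * chartEnergy g F ε e v (coordPoint s x ((ρ - c₅ * s) * w)))))
        ≤ (∫ x, ∫ w in (-1 : ℝ)..1, (ρ - c₅ * 0) * (φ x * ((1 + c₂ * ((ρ - c₅ * 0) * w) ^ 2)
          * chartEnergy g F ε e v (coordPoint 0 x ((ρ - c₅ * 0) * w)))))
          + ∫ τ in (0 : ℝ)..s, ∫ x in tsupport φ, ∫ w in (-1 : ℝ)..1, (ρ - c₅ * τ) *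
            (C * chartExcess g F ε e v (coordPoint τ x ((ρ - c₅ * τ) * w))) := by
  have hem := h𝒰.smooth he
  have hsm := hg.smoothFieldOn
  have hL := hg.lorentzian
  obtain ⟨L, hL0, hLb⟩ := hg.exists_coefficientBound h𝒰 he hT hρ hφc hφt
  obtain ⟨Φ, hΦ⟩ := hφ.continuous.bounded_above_of_compact_support hφc
  obtain ⟨Φ', hΦ'⟩ := (hφ.continuous_fderiv (by simp)).bounded_above_of_compact_support
    (hφc.fderiv ℝ)
  have hΦ0 : 0 ≤ Φ := (norm_nonneg _).trans (hΦ 0)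
  have hΦ'0 : 0 ≤ Φ' := (norm_nonneg _).trans (hΦ' 0)
  have p2 := hc.pos₂
  have p4 := hc.pos₄
  have p5 := hc.pos₅
  set n := Fin.last (m + 1) with hn
  set Wm : ℝ := 1 + c₂ * ρ ^ 2 with hWm
  set C₀ : ℝ := Φ * Wm * ((m + 2) * ((m + 2) * L) + (m + 3) * L)
    + Φ * (2 * c₂) * ((m + 2) * L) + Wm * (m * (Φ' * ((m + 2) * L))) with hC₀
  have hWm0 : 0 ≤ Wm := by positivity
  have hC₀0 : 0 ≤ C₀ := by positivity
  refine ⟨C₀ * (2 * c₄ + 3), by positivity, fun ε hε v hv s hs hsT hcs => ?_⟩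
  have hε0 := hε.1
  have hO := isOpen_coordDomain e T (2 * ρ)
  have hwt : ContDiff ℝ ∞ fun y : Fin (m + 2) → ℝ => 1 + c₂ * y n ^ 2 := by fun_prop
  have hen := contDiffOn_chartEnergy (ε := ε) hF hem hsm hL hv.smooth
  have hfl := contDiffOn_energyFlux hem hsm hL hv.smooth
  set A : (Fin (m + 2) → ℝ) → ℝ := fun y => φ (middle y) *
    ((1 + c₂ * y n ^ 2) * chartEnergy g F ε e v y) with hA
  set B : (Fin (m + 2) → ℝ) → ℝ := fun y => φ (middle y) *
    ((1 + c₂ * y n ^ 2) * (ε * energyFlux g e v n y)) with hB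
  set D : Fin m → (Fin (m + 2) → ℝ) → ℝ := fun i y => φ (middle y) *
    ((1 + c₂ * y n ^ 2) * (ε * energyFlux g e v i.succ.castSucc y)) with hD
  have cA : ContDiffOn ℝ ∞ A (coordSlab m T (2 * ρ)) :=
    contDiffOn_cutoff_mul hφ hφt (hwt.contDiffOn.mul hen)
  have cB : ContDiffOn ℝ ∞ B (coordSlab m T (2 * ρ)) :=
    contDiffOn_cutoff_mul hφ hφt (hwt.contDiffOn.mul (contDiffOn_const.mul (hfl n)))
  have cD : ∀ i, ContDiffOn ℝ ∞ (D i) (coordSlab m T (2 * ρ)) := fun i =>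
    contDiffOn_cutoff_mul hφ hφt (hwt.contDiffOn.mul (contDiffOn_const.mul (hfl _)))
  have hz : ∀ y : Fin (m + 2) → ℝ, middle y ∉ tsupport φ → φ (middle y) = 0 := fun y hy =>
    image_eq_zero_of_notMem_tsupport hy
  -- The defining inequality of `c₅`, halved as the energy is. The potential and the common factors
  -- `φ` and `1 + c₂ (yⁿ)²` only help.
  have hflux : ∀ y ∈ coordSlab m T (2 * ρ), |B y| ≤ c₅ * A y := by
    intro y hy
    by_cases hm : middle y ∈ tsupport φ
    · have hyd : y ∈ coordDomain e T (2 * ρ) := ⟨hy.1, hφt hm, hy.2⟩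
      have h1 := hc.flux e he y hyd (chartGrad e v y)
      have h2 : ∑ α, AcceleratingFronts.upper g e y n α * chartGrad e v y α * chartGrad e v y 0
          = energyFlux g e v n y := by rw [energyFlux, Finset.sum_mul]
      rw [← hn, h2] at h1
      have h3 : ε * |energyFlux g e v n y| ≤ c₅ * chartEnergy g F ε e v y := by
        have h4 : 0 ≤ c₅ * (1 / ε * F (v (coordMap e y))) := by
          have := hF.nonneg (v (coordMap e y))
          positivity
        unfold chartEnergy
        nlinarith [mul_le_mul_of_nonneg_left h1 hε0.le]
      simp only [hA, hB]
      rw [abs_mul, abs_mul, abs_mul, abs_of_nonneg (hφ0 _), abs_of_pos hε0,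
        abs_of_nonneg (by positivity : 0 ≤ 1 + c₂ * y n ^ 2)]
      calc φ (middle y) * ((1 + c₂ * y n ^ 2) * (ε * |energyFlux g e v n y|))
          ≤ φ (middle y) * ((1 + c₂ * y n ^ 2) * (c₅ * chartEnergy g F ε e v y)) := by
            have := hφ0 (middle y)
            gcongr
        _ = _ := by ring
    · simp [hA, hB, hz y hm]
  have hone : (1 : ℕ∞ω) ≤ ∞ := by simp
  have key := trapezoid_le (K := tsupport φ) (N := fun y => C₀ * (2 * c₄ + 3) * chartExcess g F ε e v y)
    hφc (cA.of_le hone) (cB.of_le hone) (fun i => (cD i).of_le hone)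
    (fun y _ hy => by simp [hA, hz y hy]) (fun y _ hy => by simp [hB, hz y hy])
    (fun i y _ hy => by simp [hD, hz y hy]) hflux p5.le hs hsT hcs (by linarith : ρ < 2 * ρ)
    (continuousOn_const.mul ((continuousOn_chartExcess hF hem hsm hL hv.smooth).mono
      fun y hy => ⟨hy.1.1, hφt hy.2, hy.1.2⟩)) ?_
  · simpa only [hA, middle_coordPoint, hn, coordPoint_last] using key
  intro y hy hm hyρ
  have hyd : y ∈ coordDomain e T (2 * ρ) := ⟨hy.1, hφt hm, hy.2⟩
  have hcb : CoefficientBound g κ e L y := by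
    rw [← coordPoint_eta y]
    exact hLb _ hy.1 _ hm _ (abs_le.1 hyρ)
  have hnh := hO.mem_nhds hyd
  have dfl : ∀ α, DifferentiableAt ℝ (energyFlux g e v α) y := fun α =>
    ((hfl α).contDiffAt hnh).differentiableAt (by simp)
  have den : DifferentiableAt ℝ (chartEnergy g F ε e v) y :=
    (hen.contDiffAt hnh).differentiableAt (by simp)
  have dφ : DifferentiableAt ℝ (fun y : Fin (m + 2) → ℝ => φ (middle y)) y :=
    (((hφ.comp contDiff_middle).contDiffAt (x := y)).differentiableAt (by simp) :)
  have dwt : DifferentiableAt ℝ (fun y : Fin (m + 2) → ℝ => 1 + c₂ * y n ^ 2) y :=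
    (hwt.contDiffAt).differentiableAt (by simp)
  have pφ := pd_comp_middle hφ y
  have m0 : middle (m := m) (Pi.single 0 1) = 0 := by
    ext i; simp [middle]
  have mi : ∀ i : Fin m, middle (m := m) (Pi.single i.succ.castSucc 1)
      = EuclideanSpace.single i 1 := by
    intro i; ext j; simp [middle, Pi.single_apply, Fin.ext_iff]
  have pwt := pd_weight c₂ y
  have s0 : (Pi.single 0 1 : Fin (m + 2) → ℝ) n = 0 := by
    simp [hn, Fin.ext_iff]
  have si : ∀ i : Fin m, (Pi.single i.succ.castSucc 1 : Fin (m + 2) → ℝ) n = 0 := by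
    intro i
    rw [Pi.single_apply, if_neg]
    exact (Fin.castSucc_lt_last _).ne'
  have pA : pd 0 A y = φ (middle y) * ((1 + c₂ * y n ^ 2) * pd 0 (chartEnergy g F ε e v) y) := by
    rw [hA, pd_mul dφ (dwt.fun_mul den), pd_mul dwt den, pφ, pwt, m0, s0]
    simp
  have pB : pd n B y = φ (middle y) * (c₂ * (2 * y n) * (ε * energyFlux g e v n y)
      + (1 + c₂ * y n ^ 2) * (ε * pd n (energyFlux g e v n) y)) := by
    rw [hB, pd_mul dφ (dwt.fun_mul ((dfl n).const_mul ε)), pd_mul dwt ((dfl n).const_mul ε),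
      pd_const_mul _ (dfl n), pφ, pwt, hn, middle_single_last]
    simp
  have pD : ∀ i, pd i.succ.castSucc (D i) y
      = fderiv ℝ φ (middle y) (EuclideanSpace.single i 1) * ((1 + c₂ * y n ^ 2)
          * (ε * energyFlux g e v i.succ.castSucc y))
        + φ (middle y) * ((1 + c₂ * y n ^ 2)
          * (ε * pd i.succ.castSucc (energyFlux g e v i.succ.castSucc) y)) := by
    intro i
    simp only [hD]
    rw [pd_mul dφ (dwt.fun_mul ((dfl _).const_mul ε)), pd_mul dwt ((dfl _).const_mul ε),
      pd_const_mul _ (dfl _), pφ, pwt, mi, si]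
    simp
  have hid := pd_chartEnergy hF hem hsm hL hv hyd
  rw [← hn] at hid
  set R := ε / 2 * (∑ α, ∑ β, pd 0 (fun z => AcceleratingFronts.upper g e z α β) y
        * chartGrad e v y α * chartGrad e v y β)
      + chartGrad e v y 0 * (ε * ∑ β, logDensityGrad g e y β * chartGrad e v y β
          - κ (coordMap e y) * f1 F (v (coordMap e y))) with hR
  -- All second derivatives of `v` have cancelled. What remains is the source of the energy identity
  -- and the terms in which a derivative falls on the weight or on the cutoff.
  have eQ : pd 0 A y - pd n B y - ∑ i : Fin m, pd i.succ.castSucc (D i) y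
      = φ (middle y) * ((1 + c₂ * y n ^ 2) * R)
        - φ (middle y) * (2 * c₂) * (ε * (y n * energyFlux g e v n y))
        - (1 + c₂ * y n ^ 2) * ∑ i : Fin m, fderiv ℝ φ (middle y) (EuclideanSpace.single i 1)
          * (ε * energyFlux g e v i.succ.castSucc y) := by
    simp_rw [pD]
    rw [Finset.sum_add_distrib, pA, pB, hid]
    have e1 : ∑ i : Fin m, fderiv ℝ φ (middle y) (EuclideanSpace.single i 1)
          * ((1 + c₂ * y n ^ 2) * (ε * energyFlux g e v i.succ.castSucc y))
        = (1 + c₂ * y n ^ 2) * ∑ i : Fin m, fderiv ℝ φ (middle y) (EuclideanSpace.single i 1)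
          * (ε * energyFlux g e v i.succ.castSucc y) := by
      rw [Finset.mul_sum]
      exact Finset.sum_congr rfl fun i _ => by ring
    have e2 : ∑ i : Fin m, φ (middle y) * ((1 + c₂ * y n ^ 2)
          * (ε * pd i.succ.castSucc (energyFlux g e v i.succ.castSucc) y))
        = φ (middle y) * ((1 + c₂ * y n ^ 2) * (ε * ∑ i : Fin m,
          pd i.succ.castSucc (energyFlux g e v i.succ.castSucc) y)) := by
      simp only [Finset.mul_sum]
    rw [e1, e2, hR]; ring
  rw [eQ]
  have hW : 1 + c₂ * y n ^ 2 ≤ Wm := by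
    have : y n ^ 2 ≤ ρ ^ 2 := sq_le_sq' (by linarith [abs_le.1 hyρ]) (abs_le.1 hyρ).2
    simp only [hWm]; gcongr
  have hW0 : 0 ≤ 1 + c₂ * y n ^ 2 := by positivity
  refine (hcb.source_le (v := v) (F := F) hL0 hε0 (a := φ (middle y)) (hΦ _) hΦ0
    (d := fun i => fderiv ℝ φ (middle y) (EuclideanSpace.single i 1)) (fun i => ?_) hΦ'0
    hW0 hW (c := 2 * c₂) (by positivity)).trans ?_
  · have := (fderiv ℝ φ (middle y)).le_of_opNorm_le (hΦ' (middle y)) (EuclideanSpace.single i 1)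
    simpa using this
  · calc _ ≤ C₀ * ((2 * c₄ + 3) * chartExcess g F ε e v y) :=
          mul_le_mul_of_nonneg_left (weightedGradSq_le hF hc he hε0 hyd) hC₀0
      _ = _ := by ring

end ChartEnergy

/-! ### Densities on the slab -/

theorem mem_slab {M : Type*} {T r t z : ℝ} {q : M} :
    (t, q, z) ∈ slab M T r ↔ t ∈ Ioo (-T) T ∧ z ∈ Ioo (-r) r := by
  simp [slab]

theorem mem_slab_of_mem_Icc {M : Type*} {T r R s z : ℝ} {q : M} (hs : s ∈ Ioo (-T) T) (hR : R < r)
    (hz : z ∈ Icc (-R) R) : (s, q, z) ∈ slab M T r :=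
  mem_slab.2 ⟨hs, by linarith [hz.1], by linarith [hz.2]⟩

theorem isOpen_slab (M : Type*) [TopologicalSpace M] (T r : ℝ) : IsOpen (slab M T r) :=
  isOpen_Ioo.prod (isOpen_univ.prod isOpen_Ioo)

section Densities

variable {m : ℕ} {M : Type*} [TopologicalSpace M] [ChartedSpace (EuclideanSpace ℝ (Fin m)) M]
  [IsManifold (𝓡 m) ∞ M] {𝒰 : Set (Chart m M)} {g : BilinField m M} {κ : ℝ × M × ℝ → ℝ}
  {F : ℝ → ℝ} {v : ℝ × M × ℝ → ℝ} {T r ρ Λ ε c₂ c₃ c₄ c₅ : ℝ} {e : Chart m M} {p : ℝ × M × ℝ}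

/-- The preferred chart jumps from point to point, so continuity of the densities is not visible
from their definition. It is checked in the charts of the cover. -/
theorem IsFiniteCover.continuousOn_slab (h𝒰 : IsFiniteCover 𝒰) {h : ℝ × M × ℝ → ℝ}
    {k : Chart m M → (Fin (m + 2) → ℝ) → ℝ}
    (hk : ∀ e ∈ 𝒰, ContinuousOn (k e) (coordDomain e T r))
    (heq : ∀ e ∈ 𝒰, ∀ p ∈ slab M T r, p.2.1 ∈ e.source → h p = k e (coords e p)) :
    ContinuousOn h (slab M T r) := by
  intro p hp
  obtain ⟨e, he, hpe⟩ := h𝒰.cover p.2.1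
  have h1 : ContinuousAt (coords e) p :=
    ((contMDiffOn_coords (h𝒰.smooth he)).continuousOn).continuousAt
      ((isOpen_source e).mem_nhds hpe)
  have h2 : ContinuousAt (k e ∘ coords e) p :=
    ((hk e he).continuousAt
      ((isOpen_coordDomain e T r).mem_nhds (coords_mem_coordDomain hp hpe))).comp h1
  refine (h2.congr ?_).continuousWithinAt
  filter_upwards [(isOpen_source e).mem_nhds hpe, (isOpen_slab M T r).mem_nhds hp] with x h3 h4
  exact (heq e he x h4 h3).symm

theorem energyDensity_eq (hv : ContMDiffOn (model m) 𝓘(ℝ, ℝ) ∞ v (slab M T r))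
    (hp : p ∈ slab M T r) (hg : IsLorentzian (g p)) (he : e ∈ IsManifold.maximalAtlas (𝓡 m) ∞ M)
    (hpe : p.2.1 ∈ e.source) : energyDensity g F ε v p = chartEnergy g F ε e v (coords e p) := by
  rw [energyDensity, chartEnergy, aGrad_eq hv hp hg he hpe, coordMap_coords hpe]

theorem excessDensity_eq (hv : ContMDiffOn (model m) 𝓘(ℝ, ℝ) ∞ v (slab M T r))
    (hp : p ∈ slab M T r) (hg : IsLorentzian (g p)) (he : e ∈ IsManifold.maximalAtlas (𝓡 m) ∞ M)
    (hpe : p.2.1 ∈ e.source) : excessDensity g F ε v p = chartExcess g F ε e v (coords e p) := by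
  rw [excessDensity, chartExcess, aGradTan_eq hv hp hg he hpe, coordMap_coords hpe,
    normalDeriv_eq hv hp he hpe, sq_abs]
  simp [coords]

theorem continuousOn_energyDensity (h𝒰 : IsFiniteCover 𝒰) (hF : IsDoubleWell F)
    (hg : SmoothFieldOn g T r) (hL : ∀ p ∈ slab M T r, IsLorentzian (g p))
    (hv : ContMDiffOn (model m) 𝓘(ℝ, ℝ) ∞ v (slab M T r)) :
    ContinuousOn (energyDensity g F ε v) (slab M T r) :=
  h𝒰.continuousOn_slab (k := fun e => chartEnergy g F ε e v)
    (fun _ he => (contDiffOn_chartEnergy hF (h𝒰.smooth he) hg hL hv).continuousOn)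
    fun _ he p hp hpe => energyDensity_eq hv hp (hL p hp) (h𝒰.smooth he) hpe

theorem continuousOn_excessDensity (h𝒰 : IsFiniteCover 𝒰) (hF : IsDoubleWell F)
    (hg : SmoothFieldOn g T r) (hL : ∀ p ∈ slab M T r, IsLorentzian (g p))
    (hv : ContMDiffOn (model m) 𝓘(ℝ, ℝ) ∞ v (slab M T r)) :
    ContinuousOn (excessDensity g F ε v) (slab M T r) :=
  h𝒰.continuousOn_slab (k := fun e => chartExcess g F ε e v)
    (fun _ he => continuousOn_chartExcess hF (h𝒰.smooth he) hg hL hv)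
    fun _ he p hp hpe => excessDensity_eq hv hp (hL p hp) (h𝒰.smooth he) hpe

theorem continuousOn_timeDeriv (h𝒰 : IsFiniteCover 𝒰)
    (hv : ContMDiffOn (model m) 𝓘(ℝ, ℝ) ∞ v (slab M T r)) :
    ContinuousOn (timeDeriv v) (slab M T r) :=
  h𝒰.continuousOn_slab (k := fun e y => chartGrad e v y 0)
    (fun _ he => (contDiffOn_chartGrad (h𝒰.smooth he) hv 0).continuousOn)
    fun _ he _ hp hpe => timeDeriv_eq hv hp (h𝒰.smooth he) hpe

theorem continuousOn_normalDeriv (h𝒰 : IsFiniteCover 𝒰)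
    (hv : ContMDiffOn (model m) 𝓘(ℝ, ℝ) ∞ v (slab M T r)) :
    ContinuousOn (normalDeriv v) (slab M T r) :=
  h𝒰.continuousOn_slab (k := fun e y => chartGrad e v y (Fin.last (m + 1)))
    (fun _ he => (contDiffOn_chartGrad (h𝒰.smooth he) hv _).continuousOn)
    fun _ he _ hp hpe => normalDeriv_eq hv hp (h𝒰.smooth he) hpe

theorem hasDerivAt_time_slab (hv : ContMDiffOn (model m) 𝓘(ℝ, ℝ) ∞ v (slab M T r))
    (hp : p ∈ slab M T r) : HasDerivAt (fun t => v (t, p.2)) (timeDeriv v p) p.1 := by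
  have he := IsManifold.chart_mem_maximalAtlas (I := 𝓡 m) (n := ∞) p.2.1
  have hs := mem_chart_source (EuclideanSpace ℝ (Fin m)) p.2.1
  rw [timeDeriv_eq hv hp he hs]
  exact hasDerivAt_chart_time hv hp he hs

theorem hasDerivAt_normal_slab (hv : ContMDiffOn (model m) 𝓘(ℝ, ℝ) ∞ v (slab M T r))
    (hp : p ∈ slab M T r) :
    HasDerivAt (fun z => v (p.1, p.2.1, z)) (normalDeriv v p) p.2.2 := by
  have he := IsManifold.chart_mem_maximalAtlas (I := 𝓡 m) (n := ∞) p.2.1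
  have hs := mem_chart_source (EuclideanSpace ℝ (Fin m)) p.2.1
  rw [normalDeriv_eq hv hp he hs]
  exact hasDerivAt_chart_normal hv hp he hs

theorem timeDeriv_sq_le (h𝒰 : IsFiniteCover 𝒰) (hL : ∀ p ∈ slab M T (2 * ρ), IsLorentzian (g p))
    (hc : AreEnergyConstants 𝒰 g T ρ c₂ c₃ c₄ c₅)
    (hv : ContMDiffOn (model m) 𝓘(ℝ, ℝ) ∞ v (slab M T (2 * ρ))) (hp : p ∈ slab M T (2 * ρ)) :
    timeDeriv v p ^ 2 ≤ c₄ * aGradTan g v p := by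
  obtain ⟨e, he, hpe⟩ := h𝒰.cover p.2.1
  rw [timeDeriv_eq hv hp (h𝒰.smooth he) hpe, aGradTan_eq hv hp (hL p hp) (h𝒰.smooth he) hpe]
  refine le_trans ?_ (hc.coercive e he _ (coords_mem_coordDomain hp hpe) _)
  exact Finset.single_le_sum (f := fun a : Fin (m + 1) => chartGrad e v (coords e p) a.castSucc ^ 2)
    (fun _ _ => sq_nonneg _) (Finset.mem_univ 0)

theorem aGradTan_nonneg (h𝒰 : IsFiniteCover 𝒰) (hL : ∀ p ∈ slab M T (2 * ρ), IsLorentzian (g p))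
    (hc : AreEnergyConstants 𝒰 g T ρ c₂ c₃ c₄ c₅)
    (hv : ContMDiffOn (model m) 𝓘(ℝ, ℝ) ∞ v (slab M T (2 * ρ))) (hp : p ∈ slab M T (2 * ρ)) :
    0 ≤ aGradTan g v p :=
  nonneg_of_mul_nonneg_right ((sq_nonneg _).trans (timeDeriv_sq_le h𝒰 hL hc hv hp)) hc.pos₄

theorem excessDensity_nonneg (h𝒰 : IsFiniteCover 𝒰)
    (hL : ∀ p ∈ slab M T (2 * ρ), IsLorentzian (g p)) (hF : IsDoubleWell F)
    (hc : AreEnergyConstants 𝒰 g T ρ c₂ c₃ c₄ c₅) (hε : 0 < ε)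
    (hv : ContMDiffOn (model m) 𝓘(ℝ, ℝ) ∞ v (slab M T (2 * ρ))) (hp : p ∈ slab M T (2 * ρ)) :
    0 ≤ excessDensity g F ε v p := by
  have h1 := aGradTan_nonneg h𝒰 hL hc hv hp
  have h2 := hF.nonneg (v p)
  unfold excessDensity
  positivity

/-- The weighted energy density controls the energy density of the profile in the normal direction
and the excess. -/
theorem excessDensity_le (h𝒰 : IsFiniteCover 𝒰)
    (hL : ∀ p ∈ slab M T (2 * ρ), IsLorentzian (g p)) (hF : IsDoubleWell F)
    (hc : AreEnergyConstants 𝒰 g T ρ c₂ c₃ c₄ c₅) (hε : 0 < ε)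
    (hv : ContMDiffOn (model m) 𝓘(ℝ, ℝ) ∞ v (slab M T (2 * ρ))) (hp : p ∈ slab M T (2 * ρ)) :
    min (1 / 4) c₂ * excessDensity g F ε v p
        + (ε / 2 * normalDeriv v p ^ 2 + 1 / ε * F (v p))
      ≤ (1 + c₂ * p.2.2 ^ 2) * energyDensity g F ε v p
        + (ε * normalDeriv v p - f1 F (v p)) ^ 2 / (4 * ε) := by
  obtain ⟨e, he, hpe⟩ := h𝒰.cover p.2.1
  have h1 := hc.form_lower e he _ (coords_mem_coordDomain hp hpe) (chartGrad e v (coords e p))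
  rw [← aGradTan_eq hv hp (hL p hp) (h𝒰.smooth he) hpe,
    ← aGrad_eq hv hp (hL p hp) (h𝒰.smooth he) hpe, ← normalDeriv_eq hv hp (h𝒰.smooth he) hpe] at h1
  have hz : coords e p (Fin.last (m + 1)) = p.2.2 := by simp [coords]
  rw [hz] at h1
  have h2 := aGradTan_nonneg h𝒰 hL hc hv hp
  have h3 := hF.nonneg (v p)
  unfold excessDensity energyDensity
  rw [sq_abs]
  set δ := min (1 / 4) c₂
  -- The bound `1/4` is needed for the defect, which occurs here as a quarter of the one in the
  -- excess, and also suffices for the tangential part. The bound `c₂` is what the weight supplies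
  -- for the potential.
  have hδ : 0 < δ := lt_min (by norm_num) hc.pos₂
  have hδ1 : δ ≤ 1 / 4 := min_le_left _ _
  have hδ2 : δ ≤ c₂ := min_le_right _ _
  set A := aGradTan g v p
  set d := normalDeriv v p
  set z := p.2.2
  set Fv := 1 / ε * F (v p)
  have hFv : 0 ≤ Fv := by positivity
  have k1 := mul_le_mul_of_nonneg_left h1 (by positivity : 0 ≤ ε / 2)
  have k2 : δ * (ε / 2 * A) ≤ 1 / 2 * (ε / 2 * A) := by gcongr; linarith
  have k3 : δ * (z ^ 2 * (ε / 2 * d ^ 2)) ≤ 1 * (z ^ 2 * (ε / 2 * d ^ 2)) := by gcongr; linarith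
  have k4 : δ * (z ^ 2 * Fv) ≤ c₂ * (z ^ 2 * Fv) := by gcongr
  have k5 : δ * ((ε * d - f1 F (v p)) ^ 2 / ε) ≤ 1 / 4 * ((ε * d - f1 F (v p)) ^ 2 / ε) := by
    gcongr
  have k6 : (ε * d - f1 F (v p)) ^ 2 / (4 * ε) = 1 / 4 * ((ε * d - f1 F (v p)) ^ 2 / ε) := by
    field_simp
  rw [k6]
  linarith

/-- The rate of change of the distance to the sign of `yⁿ` is controlled by the excess. -/
theorem exists_signDistDeriv_mul_le (h𝒰 : IsFiniteCover 𝒰)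
    (hL : ∀ p ∈ slab M T (2 * ρ), IsLorentzian (g p)) (hF : IsDoubleWell F)
    (hc : AreEnergyConstants 𝒰 g T ρ c₂ c₃ c₄ c₅) :
    ∃ C, 0 ≤ C ∧ ∀ ε > 0, ∀ v, ContMDiffOn (model m) 𝓘(ℝ, ℝ) ∞ v (slab M T (2 * ρ)) →
      ∀ p ∈ slab M T (2 * ρ),
        signDistDeriv p.2.2 (v p) * timeDeriv v p ≤ C * excessDensity g F ε v p := by
  obtain ⟨c, hc0, hcF⟩ := hF.lower
  have p4 := hc.pos₄
  refine ⟨c⁻¹ + c₄, by positivity, fun ε hε v hv p hp => ?_⟩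
  have h1 := timeDeriv_sq_le h𝒰 hL hc hv hp
  have h2 := aGradTan_nonneg h𝒰 hL hc hv hp
  have h3 := hF.nonneg (v p)
  have h4 : (1 - |v p|) ^ 2 ≤ c⁻¹ * F (v p) := by
    rw [inv_mul_eq_div, le_div_iff₀ hc0]
    linarith [hcF (v p)]
  have h5 := signDistDeriv_sq p.2.2 (v p)
  set S := signDistDeriv p.2.2 (v p)
  set V := timeDeriv v p
  -- Young's inequality with scale `ε`, so that `S²/ε` is compared with `F/ε` and `ε V²` with the
  -- tangential energy.
  have h6 : S * V ≤ 1 / 2 * (1 / ε * S ^ 2 + ε * V ^ 2) := by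
    have : 1 / 2 * (1 / ε * S ^ 2 + ε * V ^ 2) - S * V = 1 / (2 * ε) * (S - ε * V) ^ 2 := by
      field_simp; ring
    have h7 : 0 ≤ 1 / (2 * ε) * (S - ε * V) ^ 2 := by positivity
    linarith
  set A := aGradTan g v p
  set z := p.2.2
  have k1 : 1 / ε * S ^ 2 ≤ c⁻¹ * (z ^ 2 * (1 / ε * F (v p))) := by
    rw [h5]
    calc 1 / ε * (z ^ 2 * (1 - |v p|) ^ 2) ≤ 1 / ε * (z ^ 2 * (c⁻¹ * F (v p))) := by gcongr
      _ = _ := by ring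
  have k2 : ε * V ^ 2 ≤ ε * (c₄ * A) := by gcongr
  unfold excessDensity
  set G := (ε * normalDeriv v p - f1 F (v p)) ^ 2 / ε
  have hG : 0 ≤ G := by positivity
  set Fv := 1 / ε * F (v p)
  have hFv : 0 ≤ Fv := by positivity
  set D := ε / 2 * |normalDeriv v p| ^ 2
  have hD : 0 ≤ D := by positivity
  have e1 : (c⁻¹ + c₄) * (ε / 2 * A + z ^ 2 * (D + Fv) + G)
      = c⁻¹ * (z ^ 2 * Fv) + 1 / 2 * (ε * (c₄ * A))
        + (c⁻¹ * (ε / 2 * A + z ^ 2 * D + G) + c₄ * (z ^ 2 * (D + Fv) + G)) := by ring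
  have h8 : 0 ≤ c⁻¹ * (ε / 2 * A + z ^ 2 * D + G) + c₄ * (z ^ 2 * (D + Fv) + G) := by positivity
  have h9 : 0 ≤ c⁻¹ * (z ^ 2 * Fv) := by positivity
  rw [e1]
  linarith

end Densities

/-! ### Integrals over slices -/

theorem sliceIntegral_const_mul {M : Type*} [MeasurableSpace M] {μ : Measure M} (c : ℝ)
    (h : ℝ × M × ℝ → ℝ) (R s : ℝ) :
    sliceIntegral μ (fun p => c * h p) R s = c * sliceIntegral μ h R s :=
  integral_const_mul _ _

section Slices

variable {M : Type*} [TopologicalSpace M] [CompactSpace M] [T2Space M] [SecondCountableTopology M]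
  [MeasurableSpace M] [BorelSpace M] {μ : Measure M} [IsFiniteMeasure μ]
  {h k : ℝ × M × ℝ → ℝ} {T r R s : ℝ}

theorem integrable_slab_slice (hh : ContinuousOn h (slab M T r)) (hs : s ∈ Ioo (-T) T)
    (hR : R < r) :
    Integrable (fun q : M × ℝ => h (s, q.1, q.2)) (μ.prod (volume.restrict (Ioc (-R) R))) :=
  integrable_slice isCompact_univ
    (hh.comp (by fun_prop) fun _ hq => mem_slab_of_mem_Icc hs hR hq.2)
    fun x _ _ hx => absurd (mem_univ x) hx

theorem integrableOn_slab_slice (hh : ContinuousOn h (slab M T r)) (hs : s ∈ Ioo (-T) T)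
    (hR : R < r) :
    IntegrableOn (fun q : M × ℝ => h (s, q.1, q.2)) (univ ×ˢ Ioo (-R) R)
      (μ.prod (volume : Measure ℝ)) := by
  have h1 := integrable_slab_slice (μ := μ) hh hs hR
  rw [← Measure.restrict_congr_set (Ioo_ae_eq_Ioc (a := -R) (b := R)),
    ← Measure.restrict_univ (μ := μ), Measure.prod_restrict] at h1
  exact h1

theorem sliceIntegral_eq (hh : ContinuousOn h (slab M T r)) (hs : s ∈ Ioo (-T) T)
    (hR0 : 0 ≤ R) (hR : R < r) :
    sliceIntegral μ h R s = ∫ q, (∫ z in (-R)..R, h (s, q, z)) ∂μ := by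
  have h1 := integrable_slab_slice (μ := μ) hh hs hR
  rw [sliceIntegral, ← Measure.prod_restrict, Measure.restrict_univ,
    Measure.restrict_congr_set Ioo_ae_eq_Ioc, integral_prod _ h1]
  simp_rw [intervalIntegral.integral_of_le (by linarith : -R ≤ R)]

theorem integrable_section (hh : ContinuousOn h (slab M T r)) (hs : s ∈ Ioo (-T) T)
    (hR0 : 0 ≤ R) (hR : R < r) : Integrable (fun q => ∫ z in (-R)..R, h (s, q, z)) μ := by
  have h1 := (integrable_slab_slice (μ := μ) hh hs hR).integral_prod_left
  simpa only [intervalIntegral.integral_of_le (by linarith : -R ≤ R)] using h1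

theorem intervalIntegrable_section (hh : ContinuousOn h (slab M T r)) (hs : s ∈ Ioo (-T) T)
    (hR0 : 0 ≤ R) (hR : R < r) (q : M) :
    IntervalIntegrable (fun z => h (s, q, z)) volume (-R) R :=
  (hh.comp (by fun_prop) fun _ hz => mem_slab_of_mem_Icc hs hR
    (by rwa [uIcc_of_le (by linarith)] at hz)).intervalIntegrable

theorem sliceIntegral_mono (hh : ContinuousOn h (slab M T r)) (hk : ContinuousOn k (slab M T r))
    (hs : s ∈ Ioo (-T) T) (hR : R < r) (hle : ∀ p ∈ slab M T r, h p ≤ k p) :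
    sliceIntegral μ h R s ≤ sliceIntegral μ k R s :=
  setIntegral_mono_on (integrableOn_slab_slice hh hs hR) (integrableOn_slab_slice hk hs hR)
    (MeasurableSet.univ.prod measurableSet_Ioo)
    fun _ hq => hle _ (mem_slab_of_mem_Icc hs hR (Ioo_subset_Icc_self hq.2))

theorem sliceIntegral_mono_radius {R' : ℝ} (hh : ContinuousOn h (slab M T r))
    (hs : s ∈ Ioo (-T) T) (hRR : R ≤ R') (hR : R' < r) (h0 : ∀ p ∈ slab M T r, 0 ≤ h p) :
    sliceIntegral μ h R s ≤ sliceIntegral μ h R' s := by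
  refine setIntegral_mono_set (integrableOn_slab_slice hh hs hR) ?_
    (Filter.Eventually.of_forall fun q hq => ?_)
  · exact (ae_restrict_mem (MeasurableSet.univ.prod measurableSet_Ioo)).mono
      fun q hq => h0 _ (mem_slab_of_mem_Icc hs hR (Ioo_subset_Icc_self hq.2))
  · exact ⟨trivial, Ioo_subset_Ioo (by linarith) hRR hq.2⟩

theorem sliceIntegral_nonneg (hs : s ∈ Ioo (-T) T) (hR : R < r)
    (h0 : ∀ p ∈ slab M T r, 0 ≤ h p) : 0 ≤ sliceIntegral μ h R s :=
  setIntegral_nonneg (MeasurableSet.univ.prod measurableSet_Ioo)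
    fun _ hq => h0 _ (mem_slab_of_mem_Icc hs hR (Ioo_subset_Icc_self hq.2))

/-- Rescaling the slices to `M × [-1, 1]`. -/
theorem sliceIntegral_eq_rescaled (hh : ContinuousOn h (slab M T r)) (hs : s ∈ Ioo (-T) T)
    (hR0 : 0 ≤ R) (hR : R < r) :
    sliceIntegral μ h R s = ∫ q, (∫ w in (-1 : ℝ)..1, R * h (s, q, R * w)) ∂μ := by
  rw [sliceIntegral_eq hh hs hR0 hR]
  congr 1; ext q
  rw [intervalIntegral.integral_const_mul,
    intervalIntegral.mul_integral_comp_mul_left (f := fun z => h (s, q, z))]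
  simp

/-- Rescaling to `M × [-1, 1]` makes the domain independent of time, so continuity of parametric
integrals applies. -/
theorem continuousOn_sliceIntegral {R : ℝ → ℝ} {S : ℝ} (hh : ContinuousOn h (slab M T r))
    (hR : Continuous R) (hS0 : 0 ≤ S) (hS : S < T) (hR0 : ∀ s ∈ Icc 0 S, 0 ≤ R s)
    (hRr : ∀ s ∈ Icc 0 S, R s < r) :
    ContinuousOn (fun s => sliceIntegral μ h (R s) s) (Icc 0 S) := by
  -- Clamping the time and the rescaled variable to their intervals makes the integrand continuous
  -- everywhere without changing the integral.
  set c : ℝ → ℝ := fun s => projIcc 0 S hS0 s with hc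
  set d : ℝ → ℝ := fun w => projIcc (-1 : ℝ) 1 (by norm_num) w with hd
  have cc : Continuous c := continuous_subtype_val.comp continuous_projIcc
  have cd : Continuous d := continuous_subtype_val.comp continuous_projIcc
  have hcm : ∀ s, c s ∈ Icc 0 S := fun s => (projIcc 0 S hS0 s).2
  have hdm : ∀ w, d w ∈ Icc (-1 : ℝ) 1 := fun w => (projIcc (-1 : ℝ) 1 (by norm_num) w).2
  have hT : ∀ s ∈ Icc 0 S, s ∈ Ioo (-T) T := fun s hs => ⟨by linarith [hs.1], by linarith [hs.2]⟩
  have hmem : ∀ s ∈ Icc 0 S, ∀ w ∈ Icc (-1 : ℝ) 1, ∀ q : M, (s, q, R s * w) ∈ slab M T r := by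
    intro s hs w hw q
    refine mem_slab_of_mem_Icc (hT s hs) (hRr s hs) ⟨?_, ?_⟩ <;> nlinarith [hR0 s hs, hw.1, hw.2]
  set f : ℝ → M × ℝ → ℝ := fun s q => R (c s) * h (c s, q.1, R (c s) * d q.2) with hf
  have hfc : Continuous f.uncurry := by
    refine (hR.comp (cc.comp continuous_fst)).mul ?_
    refine hh.comp_continuous (f := fun x : ℝ × M × ℝ => (c x.1, x.2.1, R (c x.1) * d x.2.2))
      ?_ fun x => hmem _ (hcm _) _ (hdm _) _
    fun_prop
  have h1 := continuous_parametric_integral_of_continuous (μ := μ.prod (volume : Measure ℝ)) hfc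
    (isCompact_univ.prod isCompact_Icc : IsCompact ((univ : Set M) ×ˢ Icc (-1 : ℝ) 1))
  refine h1.continuousOn.congr fun s hs => ?_
  simp only
  have h2 : IntegrableOn (f s) (univ ×ˢ Icc (-1 : ℝ) 1) (μ.prod (volume : Measure ℝ)) :=
    (hfc.comp (by fun_prop : Continuous fun q : M × ℝ => (s, q))).continuousOn.integrableOn_compact
      (isCompact_univ.prod isCompact_Icc)
  have hcs : c s = s := by simp only [hc, projIcc_of_mem hS0 hs]
  rw [sliceIntegral_eq_rescaled hh (hT s hs) (hR0 s hs) (hRr s hs), setIntegral_prod _ h2,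
    Measure.restrict_univ]
  congr 1; ext q
  rw [intervalIntegral.integral_of_le (by norm_num), ← integral_Icc_eq_integral_Ioc]
  refine setIntegral_congr_fun measurableSet_Icc fun w hw => ?_
  have hdw : d w = w := by simp only [hd, projIcc_of_mem (by norm_num : (-1 : ℝ) ≤ 1) hw]
  simp only [hf, hcs, hdw]

end Slices

/-! ### Smooth volumes -/

section Cutoff

variable {m : ℕ} {M : Type*} [TopologicalSpace M] [ChartedSpace (EuclideanSpace ℝ (Fin m)) M]
  [IsManifold (𝓡 m) ∞ M] [T2Space M] [CompactSpace M] {e : Chart m M}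

/-- A cutoff on the manifold, multiplied by the volume density, is a cutoff in the chart. -/
theorem exists_chart_cutoff (he : e ∈ IsManifold.maximalAtlas (𝓡 m) ∞ M) {w : EuclideanSpace ℝ (Fin m) → ℝ}
    (hw : ContDiffOn ℝ ∞ w e.target) {χ : M → ℝ} (hχ : ContMDiff (𝓡 m) 𝓘(ℝ, ℝ) ∞ χ)
    (hχt : tsupport χ ⊆ e.source) :
    ∃ φ : EuclideanSpace ℝ (Fin m) → ℝ, ContDiff ℝ ∞ φ ∧ HasCompactSupport φ ∧
      tsupport φ ⊆ e.target ∧ (∀ x ∈ e.target, φ x = w x * χ (e.symm x)) ∧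
      ∀ x ∉ e.target, φ x = 0 := by
  classical
  set φ : EuclideanSpace ℝ (Fin m) → ℝ := e.target.indicator fun x => w x * χ (e.symm x) with hφ
  have hK : IsCompact (e '' tsupport χ) :=
    (isClosed_tsupport χ).isCompact.image_of_continuousOn (e.continuousOn.mono hχt)
  have hKt : e '' tsupport χ ⊆ e.target := by
    rintro _ ⟨q, hq, rfl⟩
    exact e.map_source (hχt hq)
  have hz : ∀ x ∉ e '' tsupport χ, φ x = 0 := by
    intro x hx
    by_cases hxt : x ∈ e.target
    · rw [hφ, indicator_of_mem hxt]
      have : e.symm x ∉ tsupport χ := fun h => hx ⟨_, h, e.right_inv hxt⟩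
      rw [image_eq_zero_of_notMem_tsupport this, mul_zero]
    · exact indicator_of_notMem hxt _
  have hts : tsupport φ ⊆ e '' tsupport χ :=
    closure_minimal (fun x hx => by_contra fun h => hx (hz x h)) hK.isClosed
  refine ⟨φ, ?_, HasCompactSupport.intro hK hz, hts.trans hKt,
    fun x hx => indicator_of_mem hx _, fun x hx => indicator_of_notMem hx _⟩
  rw [contDiff_iff_contDiffAt]
  intro x
  by_cases hxt : x ∈ e.target
  · have h1 : ContDiffOn ℝ ∞ (fun x => χ (e.symm x)) e.target :=
      ContMDiffOn.contDiffOn (hχ.comp_contMDiffOn (contMDiffOn_symm_of_mem_maximalAtlas he))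
    refine ((hw.mul h1).contDiffAt (e.open_target.mem_nhds hxt)).congr_of_eventuallyEq ?_
    filter_upwards [e.open_target.mem_nhds hxt] with z hz
    exact indicator_of_mem hz _
  · have hxK : x ∉ e '' tsupport χ := fun h => hxt (hKt h)
    refine (contDiffAt_const (c := (0 : ℝ))).congr_of_eventuallyEq ?_
    filter_upwards [hK.isClosed.isOpen_compl.mem_nhds hxK] with z hzK
    exact hz z hzK

end Cutoff

section Volume

variable {m : ℕ} {M : Type*} [TopologicalSpace M] [ChartedSpace (EuclideanSpace ℝ (Fin m)) M]
  [MeasurableSpace M] [BorelSpace M] {μ : Measure M} {e : Chart m M}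

theorem IsSmoothVolume.isFiniteMeasure [IsManifold (𝓡 m) ∞ M] [CompactSpace M]
    (hμ : IsSmoothVolume m μ) : IsFiniteMeasure μ := by
  have : IsLocallyFiniteMeasure μ := by
    refine ⟨fun q => ?_⟩
    set e := chartAt (EuclideanSpace ℝ (Fin m)) q with he
    obtain ⟨w, hw, -, hwμ⟩ := hμ e (IsManifold.chart_mem_maximalAtlas q)
    have hq : e q ∈ e.target := mem_chart_target _ q
    obtain ⟨K, hKx, hKt, hKc⟩ := local_compact_nhds (e.open_target.mem_nhds hq)
    refine ⟨e.symm '' K, ?_, ?_⟩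
    · have := e.symm.image_mem_nhds hq hKx
      rwa [e.left_inv (mem_chart_source _ q)] at this
    · rw [hwμ K hKt hKc.measurableSet]
      obtain ⟨B, hB⟩ := hKc.exists_bound_of_continuousOn (hw.continuousOn.mono hKt)
      calc ∫⁻ x in K, ENNReal.ofReal (w x) ≤ ∫⁻ x in K, ENNReal.ofReal B :=
            setLIntegral_mono' hKc.measurableSet fun x hx =>
              ENNReal.ofReal_le_ofReal ((le_abs_self _).trans (hB x hx))
        _ = ENNReal.ofReal B * volume K := by simp
        _ < ⊤ := ENNReal.mul_lt_top ENNReal.ofReal_lt_top hKc.measure_lt_top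
  exact ⟨isCompact_univ.measure_lt_top⟩

/-- The hypothesis gives measures of images of sets under the inverse chart; as an equality of
measures it permits change of variables in integrals. -/
theorem map_symm_withDensity {w : EuclideanSpace ℝ (Fin m) → ℝ}
    (hwμ : ∀ A ⊆ e.target, MeasurableSet A →
      μ (e.symm '' A) = ∫⁻ x in A, ENNReal.ofReal (w x)) :
    Measure.map e.symm ((volume.restrict e.target).withDensity fun x => ENNReal.ofReal (w x))
      = μ.restrict e.source := by
  have hm : MeasurableSet e.target := e.open_target.measurableSet
  have hs : AEMeasurable e.symm
      ((volume.restrict e.target).withDensity fun x => ENNReal.ofReal (w x)) :=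
    (e.continuousOn_symm.aemeasurable hm).mono_ac (withDensity_absolutelyContinuous _ _)
  ext B hB
  rw [Measure.map_apply_of_aemeasurable hs hB, ← restrict_withDensity hm,
    Measure.restrict_apply' hm, Measure.restrict_apply hB]
  have hA : MeasurableSet (e.symm ⁻¹' B ∩ e.target) := by
    have h1 : Measurable (e.target.domRestrict e.symm) := e.continuousOn_symm.domRestrict.measurable
    have h2 := hm.subtype_image (h1 hB)
    convert! h2 using 1
    ext x; simp [and_comm, Set.domRestrict_apply]
  rw [withDensity_apply _ hA, ← hwμ _ inter_subset_right hA]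
  congr 1
  ext q
  constructor
  · rintro ⟨x, ⟨hx1, hx2⟩, rfl⟩
    exact ⟨hx1, e.map_target hx2⟩
  · rintro ⟨h1, h2⟩
    exact ⟨e q, ⟨by simpa [e.left_inv h2] using h1, e.map_source h2⟩, e.left_inv h2⟩

theorem integral_source_eq {w : EuclideanSpace ℝ (Fin m) → ℝ} (hw : ContinuousOn w e.target)
    (hw0 : ∀ x ∈ e.target, 0 < w x)
    (hwμ : ∀ A ⊆ e.target, MeasurableSet A →
      μ (e.symm '' A) = ∫⁻ x in A, ENNReal.ofReal (w x)) {h : M → ℝ} (hh : Integrable h μ) :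
    IntegrableOn (fun x => w x * h (e.symm x)) e.target ∧
      ∫ q in e.source, h q ∂μ = ∫ x in e.target, w x * h (e.symm x) := by
  have hm : MeasurableSet e.target := e.open_target.measurableSet
  have hs : AEMeasurable e.symm
      ((volume.restrict e.target).withDensity fun x => ENNReal.ofReal (w x)) :=
    (e.continuousOn_symm.aemeasurable hm).mono_ac (withDensity_absolutelyContinuous _ _)
  have hwm : AEMeasurable (fun x => ENNReal.ofReal (w x)) (volume.restrict e.target) :=
    (hw.aemeasurable hm).ennreal_ofReal
  have htop : ∀ᵐ x ∂(volume.restrict e.target), ENNReal.ofReal (w x) < ⊤ :=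
    Filter.Eventually.of_forall fun _ => ENNReal.ofReal_lt_top
  have hr : Integrable h (μ.restrict e.source) := hh.restrict
  have heq := map_symm_withDensity hwμ
  have hto : ∀ x ∈ e.target, (ENNReal.ofReal (w x)).toReal • h (e.symm x) = w x * h (e.symm x) :=
    fun x hx => by rw [ENNReal.toReal_ofReal (hw0 x hx).le, smul_eq_mul]
  rw [← heq] at hr ⊢
  constructor
  · have h1 := (integrable_map_measure hr.aestronglyMeasurable hs).1 hr
    rw [integrable_withDensity_iff_integrable_smul₀' hwm htop] at h1
    exact (integrable_congr ((ae_restrict_mem hm).mono fun x hx => hto x hx)).1 h1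
  · rw [integral_map hs hr.aestronglyMeasurable,
      integral_withDensity_eq_integral_toReal_smul₀ hwm htop]
    exact setIntegral_congr_fun hm fun x hx => hto x hx

end Volume

/-! ### The global energy inequality -/

section GlobalEnergy

variable {m : ℕ} {M : Type*} [TopologicalSpace M] [ChartedSpace (EuclideanSpace ℝ (Fin m)) M]
  [T2Space M] [CompactSpace M] [SecondCountableTopology M]
  [MeasurableSpace M] [BorelSpace M] {μ : Measure M} [IsFiniteMeasure μ] {e : Chart m M}
  {h : ℝ × M × ℝ → ℝ} {k : (Fin (m + 2) → ℝ) → ℝ} {T r R s : ℝ}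

theorem integral_section_eq_chart (hs : s ∈ Ioo (-T) T) (hR0 : 0 ≤ R) (hR : R < r)
    (heq : ∀ p ∈ slab M T r, p.2.1 ∈ e.source → h p = k (coords e p)) {x : EuclideanSpace ℝ (Fin m)}
    (hx : x ∈ e.target) :
    ∫ z in (-R)..R, h (s, e.symm x, z)
      = ∫ w in (-1 : ℝ)..1, R * k (coordPoint s x (R * w)) := by
  have h1 : ∫ w in (-1 : ℝ)..1, R * k (coordPoint s x (R * w))
      = ∫ w in (-1 : ℝ)..1, R * h (s, e.symm x, R * w) := by
    refine intervalIntegral.integral_congr fun w hw => ?_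
    rw [uIcc_of_le (by norm_num)] at hw
    have h2 := heq (s, e.symm x, R * w)
      (mem_slab_of_mem_Icc hs hR ⟨by nlinarith [hw.1], by nlinarith [hw.2]⟩) (e.map_target hx)
    rw [h2, coords_eq, e.right_inv hx]
  rw [h1, intervalIntegral.integral_const_mul,
    intervalIntegral.mul_integral_comp_mul_left (f := fun z => h (s, e.symm x, z))]
  simp

/-- The density `w` is absorbed into the cutoff `φ` of the chart, so the localized energy inequality
with respect to Lebesgue measure becomes one for the volume of `M`. -/
theorem integral_cutoff_eq_chart {w : EuclideanSpace ℝ (Fin m) → ℝ}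
    (hw : ContinuousOn w e.target) (hw0 : ∀ x ∈ e.target, 0 < w x)
    (hwμ : ∀ A ⊆ e.target, MeasurableSet A →
      μ (e.symm '' A) = ∫⁻ x in A, ENNReal.ofReal (w x))
    {χ : M → ℝ} (hχ : Continuous χ) (hχt : tsupport χ ⊆ e.source)
    {φ : EuclideanSpace ℝ (Fin m) → ℝ} (hφ : ∀ x ∈ e.target, φ x = w x * χ (e.symm x))
    (hφ0 : ∀ x ∉ e.target, φ x = 0) (hh : ContinuousOn h (slab M T r))
    (heq : ∀ p ∈ slab M T r, p.2.1 ∈ e.source → h p = k (coords e p))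
    (hs : s ∈ Ioo (-T) T) (hR0 : 0 ≤ R) (hR : R < r) :
    ∫ x, ∫ w in (-1 : ℝ)..1, R * (φ x * k (coordPoint s x (R * w)))
      = ∫ q, χ q * (∫ z in (-R)..R, h (s, q, z)) ∂μ := by
  have hint : Integrable (fun q => χ q * ∫ z in (-R)..R, h (s, q, z)) μ := by
    obtain ⟨B, hB⟩ := isCompact_univ.exists_bound_of_continuousOn hχ.continuousOn
    exact (integrable_section hh hs hR0 hR).bdd_mul hχ.aestronglyMeasurable
      (Filter.Eventually.of_forall fun q => hB q trivial)
  have h1 : ∀ x, ∫ w in (-1 : ℝ)..1, R * (φ x * k (coordPoint s x (R * w)))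
      = φ x * ∫ w in (-1 : ℝ)..1, R * k (coordPoint s x (R * w)) := by
    intro x
    rw [← intervalIntegral.integral_const_mul]
    congr 1; ext w; ring
  simp_rw [h1]
  rw [← setIntegral_eq_integral_of_forall_compl_eq_zero (s := e.target)
    fun x hx => by rw [hφ0 x hx, zero_mul]]
  rw [← setIntegral_eq_integral_of_forall_compl_eq_zero (s := e.source) (μ := μ)
    (f := fun q => χ q * ∫ z in (-R)..R, h (s, q, z))
    fun q hq => by rw [image_eq_zero_of_notMem_tsupport fun h => hq (hχt h), zero_mul]]
  rw [(integral_source_eq hw hw0 hwμ hint).2]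
  refine setIntegral_congr_fun e.open_target.measurableSet fun x hx => ?_
  rw [hφ x hx, integral_section_eq_chart hs hR0 hR heq hx, mul_assoc]

/-- The sources come as Lebesgue integrals over the support of the cutoff. There the density is at
least `δ`, and as the integrand is nonnegative, enlarging the domain to all of `M` is harmless. -/
theorem integral_compact_chart_le {w : EuclideanSpace ℝ (Fin m) → ℝ}
    (hw : ContinuousOn w e.target) (hw0 : ∀ x ∈ e.target, 0 < w x)
    (hwμ : ∀ A ⊆ e.target, MeasurableSet A →
      μ (e.symm '' A) = ∫⁻ x in A, ENNReal.ofReal (w x))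
    {K : Set (EuclideanSpace ℝ (Fin m))} (hK : IsCompact K) (hKt : K ⊆ e.target) {δ : ℝ}
    (hδ : 0 < δ) (hδw : ∀ x ∈ K, δ ≤ w x) (hh : ContinuousOn h (slab M T r))
    (h0 : ∀ p ∈ slab M T r, 0 ≤ h p)
    (heq : ∀ p ∈ slab M T r, p.2.1 ∈ e.source → h p = k (coords e p))
    (hs : s ∈ Ioo (-T) T) (hR0 : 0 ≤ R) (hR : R < r) :
    0 ≤ (∫ x in K, ∫ w in (-1 : ℝ)..1, R * k (coordPoint s x (R * w))) ∧
      ∫ x in K, ∫ w in (-1 : ℝ)..1, R * k (coordPoint s x (R * w))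
        ≤ δ⁻¹ * sliceIntegral μ h R s := by
  set J : M → ℝ := fun q => ∫ z in (-R)..R, h (s, q, z) with hJ
  have hJ0 : ∀ q, 0 ≤ J q := fun q => intervalIntegral.integral_nonneg (by linarith)
    fun z hz => h0 _ (mem_slab_of_mem_Icc hs hR hz)
  have hJi : Integrable J μ := integrable_section hh hs hR0 hR
  have hsrc := integral_source_eq hw hw0 hwμ hJi
  have e1 : ∫ x in K, ∫ w in (-1 : ℝ)..1, R * k (coordPoint s x (R * w))
      = ∫ x in K, J (e.symm x) :=
    setIntegral_congr_fun hK.measurableSet fun x hx =>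
      (integral_section_eq_chart hs hR0 hR heq (hKt hx)).symm
  rw [e1]
  refine ⟨setIntegral_nonneg hK.measurableSet fun x _ => hJ0 _, ?_⟩
  have e2 : ∫ x in K, J (e.symm x) ≤ ∫ x in K, δ⁻¹ * (w x * J (e.symm x)) := by
    refine integral_mono_of_nonneg (Filter.Eventually.of_forall fun x => hJ0 _)
      ((hsrc.1.mono_set hKt).const_mul _) ?_
    refine (ae_restrict_mem hK.measurableSet).mono fun x hx => ?_
    simp only
    rw [← mul_assoc]
    refine le_mul_of_one_le_left (hJ0 _) ?_
    rw [inv_mul_eq_div, one_le_div hδ]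
    exact hδw x hx
  refine e2.trans ?_
  rw [integral_const_mul, sliceIntegral_eq hh hs hR0 hR]
  refine mul_le_mul_of_nonneg_left ?_ (by positivity)
  calc ∫ x in K, w x * J (e.symm x) ≤ ∫ x in e.target, w x * J (e.symm x) :=
        setIntegral_mono_set hsrc.1 ((ae_restrict_mem e.open_target.measurableSet).mono
          fun x hx => mul_nonneg (hw0 x hx).le (hJ0 _)) (Filter.Eventually.of_forall hKt)
    _ = ∫ q in e.source, J q ∂μ := hsrc.2.symm
    _ ≤ ∫ q, J q ∂μ := setIntegral_le_integral hJi (Filter.Eventually.of_forall hJ0)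

variable [IsManifold (𝓡 m) ∞ M] {𝒰 : Set (Chart m M)} {g : BilinField m M} {κ : ℝ × M × ℝ → ℝ}
  {F : ℝ → ℝ} {v : ℝ × M × ℝ → ℝ} {ρ Λ ε c₂ c₃ c₄ c₅ : ℝ}

/-- The energy inequality localized by a cutoff on `M`. -/
theorem exists_cutoff_energy_le (hμ : IsSmoothVolume m μ) (hF : IsDoubleWell F)
    (h𝒰 : IsFiniteCover 𝒰)
    (hg : IsAdapted 𝒰 g κ T ρ Λ) (hc : AreEnergyConstants 𝒰 g T ρ c₂ c₃ c₄ c₅) (hT : 0 < T)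
    (hρ : 0 < ρ) (he : e ∈ 𝒰) {χ : M → ℝ} (hχ : ContMDiff (𝓡 m) 𝓘(ℝ, ℝ) ∞ χ)
    (hχt : tsupport χ ⊆ e.source) (hχ0 : ∀ q, 0 ≤ χ q) :
    ∃ C, 0 ≤ C ∧ ∀ ε ∈ Ioc (0 : ℝ) 1, ∀ v, IsSmoothSolution g κ F ε T (2 * ρ) v →
      ∀ s, 0 ≤ s → s < T → c₅ * s < ρ →
      ∫ q, χ q * (∫ z in (-(ρ - c₅ * s))..(ρ - c₅ * s),
          (1 + c₂ * z ^ 2) * energyDensity g F ε v (s, q, z)) ∂μ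
        ≤ ∫ q, χ q * (∫ z in (-(ρ - c₅ * 0))..(ρ - c₅ * 0),
            (1 + c₂ * z ^ 2) * energyDensity g F ε v (0, q, z)) ∂μ
          + C * ∫ τ in (0 : ℝ)..s, sliceIntegral μ (excessDensity g F ε v) (ρ - c₅ * τ) τ := by
  have hem := h𝒰.smooth he
  have hsm := hg.smoothFieldOn
  have hL := hg.lorentzian
  have p5 := hc.pos₅
  obtain ⟨w, hw, hw0, hwμ⟩ := hμ e hem
  obtain ⟨φ, hφ, hφc, hφt, hφ1, hφ2⟩ := exists_chart_cutoff hem hw hχ hχt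
  have hφ0 : ∀ x, 0 ≤ φ x := by
    intro x
    by_cases hx : x ∈ e.target
    · rw [hφ1 x hx]; exact mul_nonneg (hw0 x hx).le (hχ0 _)
    · rw [hφ2 x hx]
  obtain ⟨C, hC0, hC⟩ := exists_chart_energy_le hF h𝒰 hg hc hT hρ he hφ hφc hφt hφ0
  obtain ⟨δ, hδ, hδw⟩ := IsCompact.exists_forall_le' (f := w) hφc (hw.continuousOn.mono hφt)
    fun x hx => hw0 x (hφt hx)
  refine ⟨C * δ⁻¹, by positivity, fun ε hε v hv s hs hsT hcs => ?_⟩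
  have key := hC ε hε v hv s hs hsT hcs
  have hmem : ∀ τ ∈ Icc 0 s, τ ∈ Ioo (-T) T ∧ 0 ≤ ρ - c₅ * τ ∧ ρ - c₅ * τ < 2 * ρ := by
    intro τ hτ
    have h1 : c₅ * τ ≤ c₅ * s := by gcongr; exact hτ.2
    have h2 : 0 ≤ c₅ * τ := mul_nonneg p5.le hτ.1
    exact ⟨⟨by linarith [hτ.1], by linarith [hτ.2]⟩, by linarith, by linarith⟩
  have hEc : ContinuousOn (fun p : ℝ × M × ℝ => (1 + c₂ * p.2.2 ^ 2) * energyDensity g F ε v p)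
      (slab M T (2 * ρ)) :=
    (by fun_prop : Continuous fun p : ℝ × M × ℝ => 1 + c₂ * p.2.2 ^ 2).continuousOn.mul
      (continuousOn_energyDensity h𝒰 hF hsm hL hv.smooth)
  have hEq : ∀ p ∈ slab M T (2 * ρ), p.2.1 ∈ e.source →
      (1 + c₂ * p.2.2 ^ 2) * energyDensity g F ε v p
        = (fun y : Fin (m + 2) → ℝ => (1 + c₂ * y (Fin.last (m + 1)) ^ 2)
          * chartEnergy g F ε e v y) (coords e p) := fun p hp hpe => by
    rw [energyDensity_eq hv.smooth hp (hL p hp) hem hpe]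
    simp [coords]
  have hlhs : ∀ τ ∈ Icc 0 s,
      ∫ x, ∫ w in (-1 : ℝ)..1, (ρ - c₅ * τ) * (φ x * ((1 + c₂ * ((ρ - c₅ * τ) * w) ^ 2)
          * chartEnergy g F ε e v (coordPoint τ x ((ρ - c₅ * τ) * w))))
        = ∫ q, χ q * (∫ z in (-(ρ - c₅ * τ))..(ρ - c₅ * τ),
          (1 + c₂ * z ^ 2) * energyDensity g F ε v (τ, q, z)) ∂μ := by
    intro τ hτ
    obtain ⟨h1, h2, h3⟩ := hmem τ hτ
    have := integral_cutoff_eq_chart (μ := μ) (k := fun y : Fin (m + 2) → ℝ =>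
      (1 + c₂ * y (Fin.last (m + 1)) ^ 2) * chartEnergy g F ε e v y) hw.continuousOn hw0 hwμ hχ.continuous hχt hφ1 hφ2 hEc
      hEq h1 h2 h3
    simpa only [coordPoint_last] using this
  rw [hlhs s ⟨hs, le_rfl⟩, hlhs 0 ⟨le_rfl, hs⟩] at key
  refine key.trans (add_le_add_right ?_ _)
  have hnc := continuousOn_excessDensity (ε := ε) h𝒰 hF hsm hL hv.smooth
  have hb : ∀ τ ∈ Icc 0 s,
      0 ≤ (∫ x in tsupport φ, ∫ w in (-1 : ℝ)..1, (ρ - c₅ * τ) *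
        (C * chartExcess g F ε e v (coordPoint τ x ((ρ - c₅ * τ) * w)))) ∧
      ∫ x in tsupport φ, ∫ w in (-1 : ℝ)..1, (ρ - c₅ * τ) *
        (C * chartExcess g F ε e v (coordPoint τ x ((ρ - c₅ * τ) * w)))
      ≤ C * δ⁻¹ * sliceIntegral μ (excessDensity g F ε v) (ρ - c₅ * τ) τ := by
    intro τ hτ
    obtain ⟨h1, h2, h3⟩ := hmem τ hτ
    have h4 := integral_compact_chart_le (μ := μ) hw.continuousOn hw0 hwμ hφc hφt hδ hδw hnc
      (fun p hp => excessDensity_nonneg h𝒰 hL hF hc hε.1 hv.smooth hp)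
      (fun p hp hpe => excessDensity_eq hv.smooth hp (hL p hp) hem hpe) h1 h2 h3
    have h5 : ∫ x in tsupport φ, ∫ w in (-1 : ℝ)..1, (ρ - c₅ * τ) *
        (C * chartExcess g F ε e v (coordPoint τ x ((ρ - c₅ * τ) * w)))
      = C * ∫ x in tsupport φ, ∫ w in (-1 : ℝ)..1, (ρ - c₅ * τ) *
        chartExcess g F ε e v (coordPoint τ x ((ρ - c₅ * τ) * w)) := by
      simp_rw [mul_left_comm _ C, intervalIntegral.integral_const_mul C, integral_const_mul C]
    rw [h5, mul_assoc]
    exact ⟨mul_nonneg hC0 h4.1, mul_le_mul_of_nonneg_left h4.2 hC0⟩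
  have hNc : ContinuousOn (fun τ => sliceIntegral μ (excessDensity g F ε v) (ρ - c₅ * τ) τ)
      (Icc 0 s) :=
    continuousOn_sliceIntegral hnc (by fun_prop) hs hsT (fun τ hτ => (hmem τ hτ).2.1)
      fun τ hτ => (hmem τ hτ).2.2
  rw [← intervalIntegral.integral_const_mul, intervalIntegral.integral_of_le hs,
    intervalIntegral.integral_of_le hs]
  refine integral_mono_of_nonneg ?_ ?_ ?_
  · exact (ae_restrict_mem measurableSet_Ioc).mono fun τ hτ => (hb τ (Ioc_subset_Icc_self hτ)).1
  · exact ((hNc.const_smul (C * δ⁻¹)).integrableOn_compact isCompact_Icc).mono_set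
      Ioc_subset_Icc_self
  · exact (ae_restrict_mem measurableSet_Ioc).mono fun τ hτ => (hb τ (Ioc_subset_Icc_self hτ)).2

/-- The weighted energy grows at most by the time integral of the excess. -/
theorem exists_zeta1_le (hμ : IsSmoothVolume m μ) (hF : IsDoubleWell F) (h𝒰 : IsFiniteCover 𝒰)
    (hg : IsAdapted 𝒰 g κ T ρ Λ) (hc : AreEnergyConstants 𝒰 g T ρ c₂ c₃ c₄ c₅) (hT : 0 < T)
    (hρ : 0 < ρ) :
    ∃ C, 0 ≤ C ∧ ∀ ε ∈ Ioc (0 : ℝ) 1, ∀ v, IsSmoothSolution g κ F ε T (2 * ρ) v →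
      ∀ s, 0 ≤ s → s < T → c₅ * s < ρ →
      zeta1 μ g F ρ c₂ c₅ ε v s ≤ zeta1 μ g F ρ c₂ c₅ ε v 0
          + C * ∫ τ in (0 : ℝ)..s, sliceIntegral μ (excessDensity g F ε v) (ρ - c₅ * τ) τ := by
  have hsm := hg.smoothFieldOn
  have hL := hg.lorentzian
  have p5 := hc.pos₅
  have : Fintype 𝒰 := h𝒰.finite.fintype
  -- The localized inequalities are added over a partition of unity. On the left and at time `0`
  -- they sum to the full energy, and the constants `C e` add up in front of the source.
  obtain ⟨χ, hχ⟩ := SmoothPartitionOfUnity.exists_isSubordinate (𝓡 m) isClosed_univ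
    (fun e : 𝒰 => e.1.source) (fun e => e.1.open_source) fun x _ => by
      obtain ⟨e, he, hx⟩ := h𝒰.cover x
      exact mem_iUnion.2 ⟨⟨e, he⟩, hx⟩
  choose C hC0 hC using fun e : 𝒰 => exists_cutoff_energy_le hμ hF h𝒰 hg hc hT hρ e.2
    (χ e).contMDiff (hχ e) (fun q => χ.nonneg e q)
  refine ⟨∑ e, C e, Finset.sum_nonneg fun e _ => hC0 e, fun ε hε v hv s hs hsT hcs => ?_⟩
  have hmem : ∀ τ ∈ Icc 0 s, τ ∈ Ioo (-T) T ∧ 0 ≤ ρ - c₅ * τ ∧ ρ - c₅ * τ < 2 * ρ := by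
    intro τ hτ
    have h1 : c₅ * τ ≤ c₅ * s := by gcongr; exact hτ.2
    have h2 : 0 ≤ c₅ * τ := mul_nonneg p5.le hτ.1
    exact ⟨⟨by linarith [hτ.1], by linarith [hτ.2]⟩, by linarith, by linarith⟩
  have hEc : ContinuousOn (fun p : ℝ × M × ℝ => (1 + c₂ * p.2.2 ^ 2) * energyDensity g F ε v p)
      (slab M T (2 * ρ)) :=
    (by fun_prop : Continuous fun p : ℝ × M × ℝ => 1 + c₂ * p.2.2 ^ 2).continuousOn.mul
      (continuousOn_energyDensity h𝒰 hF hsm hL hv.smooth)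
  have hsum : ∀ τ ∈ Icc 0 s,
      sliceIntegral μ (fun p => (1 + c₂ * p.2.2 ^ 2) * energyDensity g F ε v p) (ρ - c₅ * τ) τ
        = ∑ e : 𝒰, ∫ q, χ e q * (∫ z in (-(ρ - c₅ * τ))..(ρ - c₅ * τ),
          (1 + c₂ * z ^ 2) * energyDensity g F ε v (τ, q, z)) ∂μ := by
    intro τ hτ
    obtain ⟨h1, h2, h3⟩ := hmem τ hτ
    have hi := integrable_section (μ := μ) hEc h1 h2 h3
    rw [sliceIntegral_eq hEc h1 h2 h3, ← integral_finsetSum]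
    · congr 1; ext q
      have := χ.sum_eq_one (mem_univ q)
      rw [finsum_eq_sum_of_fintype] at this
      rw [← Finset.sum_mul, this, one_mul]
    · intro e _
      obtain ⟨B, hB⟩ := isCompact_univ.exists_bound_of_continuousOn
        (χ e).contMDiff.continuous.continuousOn
      exact hi.bdd_mul (χ e).contMDiff.continuous.aestronglyMeasurable
        (Filter.Eventually.of_forall fun q => hB q trivial)
  unfold zeta1
  rw [hsum s ⟨hs, le_rfl⟩, hsum 0 ⟨le_rfl, hs⟩, Finset.sum_mul]
  have := Finset.sum_le_sum fun (e : 𝒰) (_ : e ∈ Finset.univ) => hC e ε hε v hv s hs hsT hcs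
  rw [Finset.sum_add_distrib] at this
  linarith

end GlobalEnergy

/-! ### The differential inequality for the excess -/

section Growth

variable {m : ℕ} {M : Type*} [TopologicalSpace M] [ChartedSpace (EuclideanSpace ℝ (Fin m)) M]
  [T2Space M] [CompactSpace M] [SecondCountableTopology M] [IsManifold (𝓡 m) ∞ M]
  [MeasurableSpace M] [BorelSpace M] {μ : Measure M} [IsFiniteMeasure μ]
  {𝒰 : Set (Chart m M)} {g : BilinField m M} {κ : ℝ × M × ℝ → ℝ}
  {F : ℝ → ℝ} {T ρ Λ c₂ c₃ c₄ c₅ : ℝ}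

/-- The radius is fixed, so this is the fundamental theorem of calculus in time at each point
followed by Fubini. -/
theorem sliceIntegral_le_add_integral {h D n : ℝ × M × ℝ → ℝ} {T r R s : ℝ}
    (hh : ContinuousOn h (slab M T r)) (hD : ContinuousOn D (slab M T r))
    (hn : ContinuousOn n (slab M T r))
    (hder : ∀ p ∈ slab M T r, HasDerivAt (fun t => h (t, p.2)) (D p) p.1)
    (hDn : ∀ p ∈ slab M T r, D p ≤ n p) (hs : 0 ≤ s) (hsT : s < T) (hR : R < r) :
    sliceIntegral μ h R s ≤ sliceIntegral μ h R 0 + ∫ τ in (0 : ℝ)..s, sliceIntegral μ n R τ := by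
  have hT : ∀ τ ∈ Icc 0 s, τ ∈ Ioo (-T) T := fun τ hτ => ⟨by linarith [hτ.1], by linarith [hτ.2]⟩
  have hmem : ∀ τ ∈ Icc 0 s, ∀ q : M, ∀ z ∈ Icc (-R) R, (τ, q, z) ∈ slab M T r :=
    fun τ hτ q z hz => mem_slab_of_mem_Icc (hT τ hτ) hR hz
  have hline : ∀ q : M, ∀ z ∈ Icc (-R) R, ∀ {k : ℝ × M × ℝ → ℝ}, ContinuousOn k (slab M T r) →
      IntervalIntegrable (fun τ => k (τ, q, z)) volume 0 s := fun q z hz k hk =>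
    (hk.comp (by fun_prop) fun τ hτ => hmem τ (by rwa [uIcc_of_le hs] at hτ) q z
      hz).intervalIntegrable
  have is := integrableOn_slab_slice (μ := μ) hh (hT s ⟨hs, le_rfl⟩) hR
  have i0 := integrableOn_slab_slice (μ := μ) hh (hT 0 ⟨le_rfl, hs⟩) hR
  have hσm : MeasurableSet ((univ : Set M) ×ˢ Ioo (-R) R) := MeasurableSet.univ.prod measurableSet_Ioo
  have hswap : Integrable (Function.uncurry fun (q : M × ℝ) τ => n (τ, q.1, q.2))
      (((μ.prod (volume : Measure ℝ)).restrict (univ ×ˢ Ioo (-R) R)).prod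
        (volume.restrict (Ioc 0 s))) := by
    rw [Measure.prod_restrict]
    refine IntegrableOn.mono_set (t := (univ ×ˢ Icc (-R) R) ×ˢ Icc 0 s) ?_
      (by gcongr <;> first | exact Ioo_subset_Icc_self | exact Ioc_subset_Icc_self)
    refine ContinuousOn.integrableOn_compact ((isCompact_univ.prod isCompact_Icc).prod
      isCompact_Icc) (hn.comp (f := fun x : (M × ℝ) × ℝ => (x.2, x.1.1, x.1.2)) (by fun_prop) ?_)
    exact fun x hx => hmem _ hx.2 _ _ hx.1.2
  have hpt : ∀ᵐ q ∂((μ.prod (volume : Measure ℝ)).restrict (univ ×ˢ Ioo (-R) R)),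
      h (s, q.1, q.2) - h (0, q.1, q.2) ≤ ∫ τ in Ioc 0 s, n (τ, q.1, q.2) := by
    refine (ae_restrict_mem hσm).mono fun q hq => ?_
    have hz := Ioo_subset_Icc_self hq.2
    have h1 := intervalIntegral.integral_eq_sub_of_hasDerivAt (a := 0) (b := s)
      (f := fun τ => h (τ, q.1, q.2)) (f' := fun τ => D (τ, q.1, q.2))
      (fun τ hτ => hder _ (hmem τ (by rwa [uIcc_of_le hs] at hτ) q.1 q.2 hz)) (hline q.1 q.2 hz hD)
    rw [← h1, ← intervalIntegral.integral_of_le hs]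
    exact intervalIntegral.integral_mono_on hs (hline q.1 q.2 hz hD)
      (hline q.1 q.2 hz hn) fun τ hτ => hDn _ (hmem τ hτ q.1 q.2 hz)
  have h2 := integral_mono_ae (is.sub i0) hswap.integral_prod_left hpt
  rw [integral_sub' is i0] at h2
  have h3 := integral_integral_swap hswap
  rw [intervalIntegral.integral_of_le hs]
  unfold sliceIntegral
  refine sub_le_iff_le_add'.1 (h2.trans (le_of_eq ?_))
  exact h3

theorem exists_signDist_slice_le (hF : IsDoubleWell F) (h𝒰 : IsFiniteCover 𝒰)
    (hg : IsAdapted 𝒰 g κ T ρ Λ) (hc : AreEnergyConstants 𝒰 g T ρ c₂ c₃ c₄ c₅) (hρ : 0 < ρ) :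
    ∃ C, 0 ≤ C ∧ ∀ ε > 0, ∀ v, ContMDiffOn (model m) 𝓘(ℝ, ℝ) ∞ v (slab M T (2 * ρ)) →
      ∀ s, 0 ≤ s → s < T → c₅ * s ≤ ρ / 2 →
      sliceIntegral μ (fun p => signDist p.2.2 (v p)) (ρ / 2) s
        ≤ sliceIntegral μ (fun p => signDist p.2.2 (v p)) (ρ / 2) 0
          + C * ∫ τ in (0 : ℝ)..s, sliceIntegral μ (excessDensity g F ε v) (ρ - c₅ * τ) τ := by
  have hsm := hg.smoothFieldOn
  have hL := hg.lorentzian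
  have p5 := hc.pos₅
  obtain ⟨C, hC0, hC⟩ := exists_signDistDeriv_mul_le h𝒰 hL hF hc
  refine ⟨C, hC0, fun ε hε v hv s hs hsT hcs => ?_⟩
  have hr : ρ / 2 < 2 * ρ := by linarith
  have hT : ∀ τ ∈ Icc 0 s, τ ∈ Ioo (-T) T := fun τ hτ => ⟨by linarith [hτ.1], by linarith [hτ.2]⟩
  have hn := continuousOn_excessDensity (ε := ε) h𝒰 hF hsm hL hv
  have hn0 := fun p hp => excessDensity_nonneg (p := p) h𝒰 hL hF hc hε hv hp
  have hvc := hv.continuousOn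
  have hdc : ContinuousOn (fun p : ℝ × M × ℝ => signDist p.2.2 (v p)) (slab M T (2 * ρ)) :=
    continuous_signDist.comp_continuousOn
      ((continuous_snd.comp continuous_snd).continuousOn.prodMk hvc)
  have hDc : ContinuousOn (fun p : ℝ × M × ℝ => signDistDeriv p.2.2 (v p) * timeDeriv v p)
      (slab M T (2 * ρ)) :=
    (continuous_signDistDeriv.comp_continuousOn
      ((continuous_snd.comp continuous_snd).continuousOn.prodMk hvc)).mul
      (continuousOn_timeDeriv h𝒰 hv)
  have hb := sliceIntegral_le_add_integral (μ := μ) hdc hDc (hn.const_smul C) (fun p hp =>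
    HasDerivAt.comp (h₂ := signDist p.2.2) (h := fun t => v (t, p.2)) p.1
      (hasDerivAt_signDist p.2.2 (v p)) (hasDerivAt_time_slab hv hp))
    (fun p hp => hC ε hε v hv p hp) hs hsT hr
  -- The shrinking slices still contain `M^{ρ/2}` up to time `s`, so the excess over `M^{ρ/2}` is at
  -- most the excess over `M^{ρ(τ)}`.
  have hRc : ∀ τ ∈ Icc 0 s, ρ / 2 ≤ ρ - c₅ * τ ∧ ρ - c₅ * τ < 2 * ρ := by
    intro τ hτ
    have h1 : c₅ * τ ≤ c₅ * s := by gcongr; exact hτ.2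
    have h2 : 0 ≤ c₅ * τ := mul_nonneg p5.le hτ.1
    exact ⟨by linarith, by linarith⟩
  have hNc : ContinuousOn (fun τ => sliceIntegral μ (excessDensity g F ε v) (ρ - c₅ * τ) τ)
      (Icc 0 s) :=
    continuousOn_sliceIntegral hn (by fun_prop) hs hsT (fun τ hτ => by linarith [hRc τ hτ])
      fun τ hτ => (hRc τ hτ).2
  refine hb.trans (add_le_add_right ?_ _)
  rw [← intervalIntegral.integral_const_mul, intervalIntegral.integral_of_le hs,
    intervalIntegral.integral_of_le hs]
  simp only [Pi.smul_def, smul_eq_mul, sliceIntegral_const_mul]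
  refine integral_mono_of_nonneg ?_ ?_ ?_
  · exact (ae_restrict_mem measurableSet_Ioc).mono fun τ hτ => mul_nonneg hC0
      (sliceIntegral_nonneg (hT τ (Ioc_subset_Icc_self hτ)) hr hn0)
  · exact ((hNc.const_smul C).integrableOn_compact isCompact_Icc).mono_set Ioc_subset_Icc_self
  · refine (ae_restrict_mem measurableSet_Ioc).mono fun τ hτ => mul_le_mul_of_nonneg_left ?_ hC0
    have hτ' := Ioc_subset_Icc_self hτ
    exact sliceIntegral_mono_radius hn (hT τ hτ') (hRc τ hτ').1 (hRc τ hτ').2 hn0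

/-- The excess is controlled by the energy excess and the distance to the sign of `yⁿ`. -/
theorem exists_excess_slice_le (hF : IsDoubleWell F) (h𝒰 : IsFiniteCover 𝒰)
    (hg : IsAdapted 𝒰 g κ T ρ Λ) (hc : AreEnergyConstants 𝒰 g T ρ c₂ c₃ c₄ c₅) (hρ : 0 < ρ) :
    ∃ C, 0 ≤ C ∧ ∀ ε > 0, ∀ v, ContMDiffOn (model m) 𝓘(ℝ, ℝ) ∞ v (slab M T (2 * ρ)) →
      ∀ s, 0 ≤ s → s < T → c₅ * s ≤ ρ / 2 →
      min (1 / 4) c₂ * sliceIntegral μ (excessDensity g F ε v) (ρ - c₅ * s) s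
        ≤ zeta1 μ g F ρ c₂ c₅ ε v s + C * zeta2 μ ρ v s := by
  have hsm := hg.smoothFieldOn
  have hL := hg.lorentzian
  have p5 := hc.pos₅
  obtain ⟨C, hC0, hC⟩ := hF.profile_energy_lower hρ
  refine ⟨C, hC0, fun ε hε v hv s hs hsT hcs => ?_⟩
  have hsI : s ∈ Ioo (-T) T := ⟨by linarith, hsT⟩
  have hcs0 : 0 ≤ c₅ * s := mul_nonneg p5.le hs
  set R := ρ - c₅ * s with hR
  have hR1 : ρ / 2 ≤ R := by linarith
  have hR2 : R < 2 * ρ := by linarith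
  have hR0 : 0 ≤ R := by linarith
  have hr : ρ / 2 < 2 * ρ := by linarith
  have hn := continuousOn_excessDensity (ε := ε) h𝒰 hF hsm hL hv
  have hvc := hv.continuousOn
  have hdn := continuousOn_normalDeriv h𝒰 hv
  have hE : ContinuousOn (fun p : ℝ × M × ℝ => (1 + c₂ * p.2.2 ^ 2) * energyDensity g F ε v p)
      (slab M T (2 * ρ)) :=
    (by fun_prop : Continuous fun p : ℝ × M × ℝ => 1 + c₂ * p.2.2 ^ 2).continuousOn.mul
      (continuousOn_energyDensity h𝒰 hF hsm hL hv)
  have hP : ContinuousOn (fun p => ε / 2 * normalDeriv v p ^ 2 + 1 / ε * F (v p))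
      (slab M T (2 * ρ)) :=
    (continuousOn_const.mul (hdn.pow 2)).add
      (continuousOn_const.mul (hF.smooth.continuous.comp_continuousOn hvc))
  have hG : ContinuousOn (fun p => (ε * normalDeriv v p - f1 F (v p)) ^ 2 / (4 * ε))
      (slab M T (2 * ρ)) :=
    (((continuousOn_const.mul hdn).sub (hF.continuous_f1.comp_continuousOn hvc)).pow 2).div_const _
  have hZ : ContinuousOn (fun p : ℝ × M × ℝ => |p.2.2| * |v p - Real.sign p.2.2| ^ 2)
      (slab M T (2 * ρ)) := by
    simp_rw [abs_mul_sub_sign_sq]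
    fun_prop
  -- On each normal line the profile estimate and the pointwise bound both contain a quarter of the
  -- defect, on opposite sides, and it drops out. Integrating over `M` turns `c₀` into `c₀ vol₀(M)`.
  have hq : ∀ q : M, min (1 / 4) c₂ * (∫ z in (-R)..R, excessDensity g F ε v (s, q, z)) + c0 F
      ≤ (∫ z in (-R)..R, (1 + c₂ * z ^ 2) * energyDensity g F ε v (s, q, z))
        + C * ∫ z in (-(ρ / 2))..(ρ / 2), |z| * |v (s, q, z) - Real.sign z| ^ 2 := by
    intro q
    have h1 := hC ε hε R hR1 (fun z => v (s, q, z)) (fun z => normalDeriv v (s, q, z))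
      (fun z hz => hasDerivAt_normal_slab hv (mem_slab_of_mem_Icc (q := q) hsI hR2 hz))
      (hdn.comp (by fun_prop) fun z hz => mem_slab_of_mem_Icc hsI hR2 hz)
    have in1 := intervalIntegrable_section hn hsI hR0 hR2 q
    have in2 := intervalIntegrable_section hP hsI hR0 hR2 q
    have in3 := intervalIntegrable_section hE hsI hR0 hR2 q
    have in4 := intervalIntegrable_section hG hsI hR0 hR2 q
    have h2 := intervalIntegral.integral_mono_on (by linarith : -R ≤ R)
      ((in1.const_mul (min (1 / 4) c₂)).add in2) (in3.add in4) fun z hz =>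
        excessDensity_le h𝒰 hL hF hc hε hv (mem_slab_of_mem_Icc (q := q) hsI hR2 hz)
    rw [intervalIntegral.integral_add (in1.const_mul _) in2, intervalIntegral.integral_const_mul,
      intervalIntegral.integral_add in3 in4] at h2
    linarith
  have J1 := integrable_section (μ := μ) hn hsI hR0 hR2
  have J2 := integrable_section (μ := μ) hE hsI hR0 hR2
  have J3 := integrable_section (μ := μ) hZ hsI (by linarith : 0 ≤ ρ / 2) hr
  have h3 := integral_mono ((J1.const_mul (min (1 / 4) c₂)).add (integrable_const (c0 F)))
    (J2.add (J3.const_mul C)) hq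
  rw [integral_add' (J1.const_mul _) (integrable_const _), integral_add' J2 (J3.const_mul C),
    integral_const_mul, integral_const_mul, integral_const] at h3
  unfold zeta1 zeta2
  rw [sliceIntegral_eq hn hsI hR0 hR2, sliceIntegral_eq hE hsI hR0 hR2,
    sliceIntegral_eq hZ hsI (by linarith) hr]
  rw [smul_eq_mul] at h3
  linarith

end Growth

theorem zeta2_nonneg {M : Type*} [MeasurableSpace M] {μ : Measure M} {ρ : ℝ} (v : ℝ × M × ℝ → ℝ)
    (s : ℝ) : 0 ≤ zeta2 μ ρ v s :=
  integral_nonneg fun _ => by positivity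

/-! ### Stability of the front -/

section Stability

variable {m : ℕ} {M : Type*} [TopologicalSpace M] [ChartedSpace (EuclideanSpace ℝ (Fin m)) M]
  [T2Space M] [CompactSpace M] [SecondCountableTopology M] [IsManifold (𝓡 m) ∞ M]
  [MeasurableSpace M] [BorelSpace M] {μ : Measure M} [IsFiniteMeasure μ]
  {𝒰 : Set (Chart m M)} {g : BilinField m M} {κ : ℝ × M × ℝ → ℝ}
  {F : ℝ → ℝ} {v : ℝ × M × ℝ → ℝ} {T ρ Λ ε c₂ c₃ c₄ c₅ : ℝ}

theorem zeta3_le (hF : IsDoubleWell F) (h𝒰 : IsFiniteCover 𝒰) (hg : IsAdapted 𝒰 g κ T ρ Λ)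
    (hε : 0 < ε) (hv : ContMDiffOn (model m) 𝓘(ℝ, ℝ) ∞ v (slab M T (2 * ρ))) {s : ℝ}
    (hs : s ∈ Ioo (-T) T) (hR : ρ - c₅ * s < 2 * ρ) :
    zeta3 μ g F ρ c₅ ε v s ≤ sliceIntegral μ (excessDensity g F ε v) (ρ - c₅ * s) s := by
  have hn := continuousOn_excessDensity (ε := ε) h𝒰 hF hg.smoothFieldOn hg.lorentzian hv
  have hG : ContinuousOn (fun p => (ε * normalDeriv v p - f1 F (v p)) ^ 2 / ε)
      (slab M T (2 * ρ)) :=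
    (((continuousOn_const.mul (continuousOn_normalDeriv h𝒰 hv)).sub
      (hF.continuous_f1.comp_continuousOn hv.continuousOn)).pow 2).div_const _
  refine sliceIntegral_mono ((hn.sub hG).congr fun p _ => ?_) hn hs hR fun p _ => ?_
  · simp [excessDensity]
  · have : 0 ≤ (ε * normalDeriv v p - f1 F (v p)) ^ 2 / ε := by positivity
    unfold excessDensity
    linarith

theorem signDist_slice_bounds (hρ : 0 < ρ)
    (hv : ContMDiffOn (model m) 𝓘(ℝ, ℝ) ∞ v (slab M T (2 * ρ))) {s : ℝ} (hs : s ∈ Ioo (-T) T) :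
    1 / 8 * zeta2 μ ρ v s ≤ sliceIntegral μ (fun p => signDist p.2.2 (v p)) (ρ / 2) s ∧
      sliceIntegral μ (fun p => signDist p.2.2 (v p)) (ρ / 2) s ≤ zeta2 μ ρ v s := by
  have hvc := hv.continuousOn
  have hr : ρ / 2 < 2 * ρ := by linarith
  have hZ : ContinuousOn (fun p : ℝ × M × ℝ => |p.2.2| * |v p - Real.sign p.2.2| ^ 2)
      (slab M T (2 * ρ)) := by
    simp_rw [abs_mul_sub_sign_sq]
    fun_prop
  have hd : ContinuousOn (fun p : ℝ × M × ℝ => signDist p.2.2 (v p)) (slab M T (2 * ρ)) :=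
    continuous_signDist.comp_continuousOn
      ((continuous_snd.comp continuous_snd).continuousOn.prodMk hvc)
  constructor
  · rw [zeta2, ← sliceIntegral_const_mul]
    exact sliceIntegral_mono (continuousOn_const.mul hZ) hd hs hr fun p _ => le_signDist _ _
  · exact sliceIntegral_mono hd hZ hs hr fun p _ => signDist_le _ _

/-- Closes the argument. The condition `c₅ s < ρ/2` keeps the radius above `ρ/2`, as both the
distance and the profile estimates require. -/
theorem exists_zeta_le (hμ : IsSmoothVolume m μ) (hF : IsDoubleWell F) (h𝒰 : IsFiniteCover 𝒰)
    (hg : IsAdapted 𝒰 g κ T ρ Λ) (hc : AreEnergyConstants 𝒰 g T ρ c₂ c₃ c₄ c₅) (hT : 0 < T)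
    (hρ : 0 < ρ) :
    ∃ C, ∀ ε ∈ Ioc (0 : ℝ) 1, ∀ v, IsSmoothSolution g κ F ε T (2 * ρ) v →
      ∀ s, 0 ≤ s → s < T → c₅ * s < ρ / 2 →
        zeta1 μ g F ρ c₂ c₅ ε v s
            ≤ C * max (zeta1 μ g F ρ c₂ c₅ ε v 0) (zeta2 μ ρ v 0) ∧
        zeta2 μ ρ v s ≤ C * max (zeta1 μ g F ρ c₂ c₅ ε v 0) (zeta2 μ ρ v 0) ∧
        zeta3 μ g F ρ c₅ ε v s
            ≤ C * max (zeta1 μ g F ρ c₂ c₅ ε v 0) (zeta2 μ ρ v 0) := by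
  have p2 := hc.pos₂
  have p5 := hc.pos₅
  obtain ⟨B₁, hB₁, h1⟩ := exists_zeta1_le hμ hF h𝒰 hg hc hT hρ
  obtain ⟨B₂, hB₂, h2⟩ := exists_signDist_slice_le (μ := μ) hF h𝒰 hg hc hρ
  obtain ⟨L, hL, h3⟩ := exists_excess_slice_le (μ := μ) hF h𝒰 hg hc hρ
  set δ := min (1 / 4) c₂ with hδ
  have hδ0 : 0 < δ := lt_min (by norm_num) p2
  set B := B₁ + (8 * L + 1) * B₂ with hB
  have hB0 : 0 ≤ B := by positivity
  set E := 1 + B * T / δ * Real.exp (B / δ * T) with hE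
  have hE0 : 0 ≤ E := by positivity
  refine ⟨(9 + 1 / δ) * (E * (8 * L + 2)), fun ε hε v hv s hs hsT hcs => ?_⟩
  have hmem : ∀ τ ∈ Icc 0 s, τ ∈ Ioo (-T) T ∧ c₅ * τ ≤ ρ / 2 ∧ 0 ≤ c₅ * τ := by
    intro τ hτ
    have h1 : c₅ * τ ≤ c₅ * s := by gcongr; exact hτ.2
    exact ⟨⟨by linarith [hτ.1], by linarith [hτ.2]⟩, by linarith, mul_nonneg p5.le hτ.1⟩
  set N : ℝ → ℝ := fun τ => sliceIntegral μ (excessDensity g F ε v) (ρ - c₅ * τ) τ with hN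
  set Z₁ : ℝ → ℝ := zeta1 μ g F ρ c₂ c₅ ε v
  set Z₂ : ℝ → ℝ := zeta2 μ ρ v
  set D : ℝ → ℝ := fun τ => sliceIntegral μ (fun p => signDist p.2.2 (v p)) (ρ / 2) τ with hD
  have hD1 : ∀ τ ∈ Icc 0 s, 1 / 8 * Z₂ τ ≤ D τ ∧ D τ ≤ Z₂ τ := fun τ hτ =>
    signDist_slice_bounds hρ hv.smooth (hmem τ hτ).1
  have hZ0 : ∀ τ, 0 ≤ Z₂ τ := fun τ => zeta2_nonneg v τ
  have hND : ∀ τ ∈ Icc 0 s, δ * N τ ≤ Z₁ τ + 8 * L * D τ := by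
    intro τ hτ
    have k1 := h3 ε hε.1 v hv.smooth τ hτ.1 (hτ.2.trans_lt hsT) (hmem τ hτ).2.1
    have k2 := mul_le_mul_of_nonneg_left (hD1 τ hτ).1 hL
    linarith
  have hN0 : ∀ τ ∈ Icc 0 s, 0 ≤ N τ := fun τ hτ =>
    sliceIntegral_nonneg (hmem τ hτ).1 (by linarith [(hmem τ hτ).2.2] : ρ - c₅ * τ < 2 * ρ)
      fun p hp => excessDensity_nonneg h𝒰 hg.lorentzian hF hc hε.1 hv.smooth hp
  have hNc : ContinuousOn N (Icc 0 s) :=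
    continuousOn_sliceIntegral
      (continuousOn_excessDensity h𝒰 hF hg.smoothFieldOn hg.lorentzian hv.smooth) (by fun_prop)
      hs hsT (fun τ hτ => by linarith [(hmem τ hτ).2.1]) fun τ hτ => by
        linarith [(hmem τ hτ).2.2]
  -- The summand `8 L D` pays for `L ζ₂ ≤ 8 L D`. The extra `D`, together with `N ≥ 0`, makes `A`
  -- dominate `D` although `ζ₁` may be negative.
  set A : ℝ → ℝ := fun τ => Z₁ τ + (8 * L + 1) * D τ with hA
  have hAN : ∀ τ ∈ Icc 0 s, δ * N τ ≤ A τ ∧ D τ ≤ A τ := by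
    intro τ hτ
    have k1 := hND τ hτ
    have k2 := mul_nonneg hδ0.le (hN0 τ hτ)
    have k3 : 0 ≤ D τ := by linarith [(hD1 τ hτ).1, hZ0 τ]
    simp only [hA]
    constructor <;> linarith
  have hAle : ∀ τ ∈ Icc 0 s, A τ ≤ A 0 + B * ∫ t in (0 : ℝ)..τ, N t := by
    intro τ hτ
    have k1 := h1 ε hε v hv τ hτ.1 (hτ.2.trans_lt hsT) (by linarith [(hmem τ hτ).2.1])
    have k2 := h2 ε hε.1 v hv.smooth τ hτ.1 (hτ.2.trans_lt hsT) (hmem τ hτ).2.1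
    have k3 := mul_le_mul_of_nonneg_left k2 (by positivity : 0 ≤ 8 * L + 1)
    calc A τ = Z₁ τ + (8 * L + 1) * D τ := rfl
      _ ≤ (Z₁ 0 + B₁ * ∫ t in (0 : ℝ)..τ, N t)
          + (8 * L + 1) * (D 0 + B₂ * ∫ t in (0 : ℝ)..τ, N t) := add_le_add k1 k3
      _ = A 0 + B * ∫ t in (0 : ℝ)..τ, N t := by simp only [hA, hB]; ring
  have h0s : (0 : ℝ) ∈ Icc 0 s := ⟨le_rfl, hs⟩
  have hss : s ∈ Icc 0 s := ⟨hs, le_rfl⟩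
  have hA0 : 0 ≤ A 0 := (mul_nonneg hδ0.le (hN0 0 h0s)).trans (hAN 0 h0s).1
  -- Grönwall is applied to `N`, through `δ N ≤ A ≤ A 0 + B ∫ N`.
  have hgr := le_mul_exp_of_le_add_integral (N := N) (a := A 0 / δ) (b := B / δ) (by positivity) hNc
    fun τ hτ => by
      have k1 := (hAN τ hτ).1.trans (hAle τ hτ)
      rw [← le_div_iff₀' hδ0] at k1
      exact k1.trans (le_of_eq (by ring))
  have hint : ∫ t in (0 : ℝ)..s, N t ≤ T * (A 0 / δ * Real.exp (B / δ * T)) := by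
    calc ∫ t in (0 : ℝ)..s, N t ≤ ∫ t in (0 : ℝ)..s, A 0 / δ * Real.exp (B / δ * T) := by
          refine intervalIntegral.integral_mono_on hs
            (hNc.mono (by rw [uIcc_of_le hs])).intervalIntegrable intervalIntegrable_const
            fun t ht => (hgr t ht).trans ?_
          have : t ≤ T := by linarith [ht.2]
          gcongr
      _ = s * (A 0 / δ * Real.exp (B / δ * T)) := by
        rw [intervalIntegral.integral_const, sub_zero, smul_eq_mul]
      _ ≤ _ := by gcongr
  set X := max (Z₁ 0) (Z₂ 0) with hX
  -- The energy excess may be negative, but `ζ₂` is not, so constants in front of the maximum may be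
  -- enlarged.
  have hX0 : 0 ≤ X := (hZ0 0).trans (le_max_right _ _)
  have hAX : A 0 ≤ (8 * L + 2) * X := by
    have k1 : Z₁ 0 ≤ X := le_max_left _ _
    have k2 : D 0 ≤ X := (hD1 0 h0s).2.trans (le_max_right _ _)
    have k3 := mul_le_mul_of_nonneg_left k2 (by positivity : 0 ≤ 8 * L + 1)
    simp only [hA]; linarith
  have hAs : A s ≤ E * (8 * L + 2) * X := by
    calc A s ≤ A 0 + B * (T * (A 0 / δ * Real.exp (B / δ * T))) :=
          (hAle s hss).trans (by gcongr)
      _ = E * A 0 := by rw [hE]; ring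
      _ ≤ E * ((8 * L + 2) * X) := by gcongr
      _ = _ := by ring
  set Y := E * (8 * L + 2) * X with hY
  have hY0 : 0 ≤ Y := by positivity
  have hYδ : 0 ≤ 1 / δ * Y := by positivity
  -- One constant serves all three: `ζ₁ ≤ Y`, `ζ₂ ≤ 8 Y` and `ζ₃ ≤ Y/δ`.
  have hfin : (9 + 1 / δ) * (E * (8 * L + 2)) * X = 9 * Y + 1 / δ * Y := by rw [hY]; ring
  rw [hfin]
  have hDs := hD1 s hss
  have hDA := (hAN s hss).2
  refine ⟨?_, ?_, ?_⟩
  · have k1 : 0 ≤ (8 * L + 1) * D s := mul_nonneg (by positivity) (by linarith [hZ0 s])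
    have k2 : Z₁ s ≤ A s := by simp only [hA]; linarith
    linarith
  · linarith
  · have k1 : N s ≤ 1 / δ * Y := by
      rw [one_div_mul_eq_div, le_div_iff₀' hδ0]
      exact (hAN s hss).1.trans hAs
    have k2 : zeta3 μ g F ρ c₅ ε v s ≤ N s :=
      zeta3_le hF h𝒰 hg hε.1 hv.smooth (hmem s hss).1 (by linarith [(hmem s hss).2.2])
    linarith

end Stability

end AcceleratingFronts

end

theorem proposition5p1 {m : ℕ} (hm : 1 ≤ m)
    {M : Type*} [TopologicalSpace M] [T2Space M] [CompactSpace M]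
    [ChartedSpace (EuclideanSpace ℝ (Fin m)) M] [IsManifold (𝓡 m) ∞ M]
    [MeasurableSpace M] [BorelSpace M]
    (vol₀ : Measure M) (hvol : AcceleratingFronts.IsSmoothVolume m vol₀)
    (F : ℝ → ℝ) (hF : AcceleratingFronts.IsDoubleWell F)
    (T ρ : ℝ) (hT : 0 < T) (hρ : 0 < ρ)
    (𝒰 : Set (AcceleratingFronts.Chart m M)) (h𝒰 : AcceleratingFronts.IsFiniteCover 𝒰)
    (g : AcceleratingFronts.BilinField m M) (κ : ℝ × M × ℝ → ℝ) (K : ℝ)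
    (hg : AcceleratingFronts.IsAdapted 𝒰 g κ T ρ K)
    (c₂ c₃ c₄ c₅ : ℝ) (hc : AcceleratingFronts.AreEnergyConstants 𝒰 g T ρ c₂ c₃ c₄ c₅) :
    ∃ C : ℝ, ∀ ε ∈ Ioc (0 : ℝ) 1, ∀ v : ℝ × M × ℝ → ℝ,
      AcceleratingFronts.IsSmoothSolution g κ F ε T (2 * ρ) v →
      ∀ s : ℝ, 0 < s → s < min T (ρ / (3 * c₅)) →
        AcceleratingFronts.zeta1 vol₀ g F ρ c₂ c₅ ε v s
            ≤ C * max (AcceleratingFronts.zeta1 vol₀ g F ρ c₂ c₅ ε v 0)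
                (AcceleratingFronts.zeta2 vol₀ ρ v 0) ∧
        AcceleratingFronts.zeta2 vol₀ ρ v s
            ≤ C * max (AcceleratingFronts.zeta1 vol₀ g F ρ c₂ c₅ ε v 0)
                (AcceleratingFronts.zeta2 vol₀ ρ v 0) ∧
        AcceleratingFronts.zeta3 vol₀ g F ρ c₅ ε v s
            ≤ C * max (AcceleratingFronts.zeta1 vol₀ g F ρ c₂ c₅ ε v 0)
                (AcceleratingFronts.zeta2 vol₀ ρ v 0) := by
  have : SecondCountableTopology M :=
    ChartedSpace.secondCountable_of_sigmaCompact (EuclideanSpace ℝ (Fin m)) M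
  have := hvol.isFiniteMeasure
  obtain ⟨C, hC⟩ := AcceleratingFronts.exists_zeta_le hvol hF h𝒰 hg hc hT hρ
  refine ⟨C, fun ε hε v hv s hs hsT => hC ε hε v hv s hs.le (hsT.trans_le (min_le_left _ _)) ?_⟩
  have h1 := hsT.trans_le (min_le_right _ _)
  -- The hypothesis gives `c₅ s < ρ/3`, which is below the `ρ/2` that is needed.
  rw [lt_div_iff₀ (mul_pos three_pos hc.pos₅)] at h1
  linarith
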